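/- **Theorem.** Appell's hypergeometric function $F_4$ does not admit, for generic parameters, an integral representation as a dehomogenized Euler-type integral over a rotation of the positive orthant. Precisely, let $$F_4(a,b;c,c';y_1,y_2)=\sum_{p,q\ge 0}\frac{(a)_{p+q}(b)_{p+q}}{(c)_p(c')_q\,p!\,q!}\,y_1^p y_2^q ,\qquad \sqrt{|y_1|}+\sqrt{|y_2|}<1,$$ $$A=\begin{bmatrix}1&1&1&1&1&1\\1&1&1&0&0&0\\0&1&0&0&-1&0\\0&0&1&0&0&-1\end{bmatrix},\qquad \kappa=(-a,c-1,c'-1,-b,0,0)^T,\qquad \beta=A\kappa ,$$ and let $$\Phi(x)=x_1^{-a}x_2^{c-1}x_3^{c'-1}x_4^{-b}\,F_4\Big(a,b;c,c';\frac{x_2x_5}{x_1x_4},\frac{x_3x_6}{x_1x_4}\Big)$$ be the $A$-hypergeometric form of $F_4$. Let $a,b,c,c'\in\mathbb C$ be generic in the following sense: $c,c'\notin\{0,-1,-2,\dots\}$, and $\beta$ is nonresonant, i.e. none of $a$, $b$, $a-c$, $b-c$, $a-c'$, $b-c'$, $a-c-c'$, $b-c-c'$ is an integer. Write $A$ in any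 block form: let $g\in GL_4(\mathbb Z)$ be such that $gA$ has $m$ rows that are the indicator vectors of a partition of the six columns into $m$ blocks $B_1,\dots,B_m$, followed by $r=4-m$ rows, whose columns are $\alpha_1,\dots,\alpha_6\in\mathbb Z^r$; put $\beta'=g\beta$ and $f_i(w)=\sum_{j\in B_i}x_j w^{\alpha_j}$. For $\theta\in\mathbb R^r$ let $\varepsilon_\theta=\{(t_1e^{i\theta_1},\dots,t_re^{i\theta_r}) : t_k>0\}$. Then there are no $g$ (with its block form), $\theta\in\mathbb R^r$, constant $K\in\mathbb C$, and nonempty open set $U$ in $\{x\in(\mathbb C^*)^6 : \sqrt{|x_2x_5/(x_1x_4)|}+\sqrt{|x_3x_6/(x_1x_4)|}<1\}$ on which continuous branches of all $\log x_j$ exist, such that for all $x\in U$ the $f_i$ have no zero on $\varepsilon_\theta$, the integral below converges absolutely, and $$\Phi(x)=K\int_{\varepsilon_\theta} w_1^{-\beta'_{m+1}}\cdots w_r^{-\beta'_{m+r}}\prod_{i=1}^m f_i(w)^{\beta'_i}\;\frac{dw_1}{w_1}\wedge\dots\wedge\frac{dw_r}{w_r},$$ whatever continuous branches of the powers are chosen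 (those of $f_i(w)^{\beta'_i}$ being continuous in $(x,w)\in U\times\varepsilon_\theta$). -/

import Mathlib

open scoped Nat

/-! ### Euler-type integrals attached to an integer matrix -/

/-- `block j` is the block of the `j`-th column and `expo j` its lower part: the matrix whose `j`-th
column is the basis vector `e_{block j}` on top of the integer vector `expo j`. -/
def blockMatrix {n m r : ℕ} (block : Fin n → Fin m) (expo : Fin n → Fin r → ℤ) :
    Matrix (Fin m ⊕ Fin r) (Fin n) ℤ :=
  fun i j => Sum.elim (fun i' => if block j = i' then 1 else 0) (fun k => expo j k) i

/-- A way of writing `A` in block form by a unimodular change of coordinates of `ℤ ^ d`: the matrix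
`toMat` is invertible over `ℤ` and `toMat * A` is a block matrix with `m` rows of block indicators
and `r` further rows (so that `m + r = d`). -/
structure StandardForm {d n : ℕ} (A : Matrix (Fin d) (Fin n) ℤ) (m r : ℕ) where
  block : Fin n → Fin m
  expo : Fin n → Fin r → ℤ
  toMat : Matrix (Fin m ⊕ Fin r) (Fin d) ℤ
  invMat : Matrix (Fin d) (Fin m ⊕ Fin r) ℤ
  toMat_mul_invMat : toMat * invMat = 1
  invMat_mul_toMat : invMat * toMat = 1
  toMat_mul : toMat * A = blockMatrix block expo

namespace StandardForm

variable {d n m r : ℕ} {A : Matrix (Fin d) (Fin n) ℤ}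

/-- The parameter vector in the coordinates of the block form. -/
noncomputable def param (S : StandardForm A m r) (β : Fin d → ℂ) : Fin m ⊕ Fin r → ℂ :=
  (S.toMat.map (fun z : ℤ => (z : ℂ))).mulVec β

/-- The Laurent polynomial `f_i(w) = ∑_{j in block i} x_j w^{expo j}` in `r` variables. -/
noncomputable def poly (S : StandardForm A m r) (i : Fin m) (x : Fin n → ℂ) (w : Fin r → ℂ) : ℂ :=
  ∑ j : Fin n, if S.block j = i then x j * ∏ k : Fin r, w k ^ S.expo j k else 0

end StandardForm

/-- The rotation `{(t_1 e^{iθ_1}, …, t_r e^{iθ_r}) : t_k > 0}` of the positive orthant, parametrized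
by `t_k = e^{u_k}` with `u ∈ ℝ ^ r`. In this parametrization the Haar measure
`dη = dw_1 / w_1 ∧ ⋯ ∧ dw_r / w_r` is the Lebesgue measure `du`. -/
noncomputable def rotatedOrthant {r : ℕ} (θ : Fin r → ℝ) (u : Fin r → ℝ) : Fin r → ℂ :=
  fun k => Complex.exp ((u k : ℂ) + (θ k : ℂ) * Complex.I)

namespace StandardForm

variable {d n m r : ℕ} {A : Matrix (Fin d) (Fin n) ℤ}

/-- `L i x u` is a continuous choice of `log f_i(w)`, for `x ∈ U` and `w` the point of the rotated
orthant with coordinate `u`. In particular no `f_i` vanishes on the rotated orthant for `x ∈ U`. -/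
def IsLogBranch (S : StandardForm A m r) (θ : Fin r → ℝ) (U : Set (Fin n → ℂ))
    (L : Fin m → (Fin n → ℂ) → (Fin r → ℝ) → ℂ) : Prop :=
  ∀ i : Fin m,
    ContinuousOn (fun q : (Fin n → ℂ) × (Fin r → ℝ) => L i q.1 q.2) (U ×ˢ Set.univ) ∧
    ∀ x ∈ U, ∀ u : Fin r → ℝ, Complex.exp (L i x u) = S.poly i x (rotatedOrthant θ u)

/-- The integrand `∏_k w_k ^ (-β_{m+k}) ∏_i f_i(w) ^ β_i` on the rotated orthant, where the powers
of the `w_k` are formed with `log w_k = u_k + i θ_k` and those of the `f_i` with the branch `L`. -/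
noncomputable def integrand (S : StandardForm A m r) (β : Fin d → ℂ) (θ : Fin r → ℝ)
    (L : Fin m → (Fin n → ℂ) → (Fin r → ℝ) → ℂ) (x : Fin n → ℂ) (u : Fin r → ℝ) : ℂ :=
  Complex.exp (-∑ k : Fin r, S.param β (Sum.inr k) * ((u k : ℂ) + (θ k : ℂ) * Complex.I)) *
    Complex.exp (∑ i : Fin m, S.param β (Sum.inl i) * L i x u)

/-- On `U` the function `Φ` is `K` times the dehomogenized Euler-type integral
`∫_ε ∏_k w_k ^ (-β_{m+k}) ∏_i f_i(w) ^ β_i dη` over the orthant `ε` rotated by `θ`: the `f_i` do not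
vanish on `ε`, continuous branches of their powers are chosen, and the integral converges. -/
def Represents (S : StandardForm A m r) (β : Fin d → ℂ) (θ : Fin r → ℝ) (U : Set (Fin n → ℂ))
    (Φ : (Fin n → ℂ) → ℂ) (K : ℂ) : Prop :=
  ∃ L : Fin m → (Fin n → ℂ) → (Fin r → ℝ) → ℂ, S.IsLogBranch θ U L ∧
    ∀ x ∈ U, MeasureTheory.Integrable (S.integrand β θ L x) ∧
      Φ x = K * ∫ u : Fin r → ℝ, S.integrand β θ L x u

end StandardForm

/-! ### Appell's function `F₄` -/

/-- Appell's series `∑ (a)_{r+s} (b)_{r+s} / ((c)_r (c')_s r! s!) y₁^r y₂^s`; it converges absolutely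
for `√|y₁| + √|y₂| < 1`. -/
noncomputable def appellF4 (a b c c' y₁ y₂ : ℂ) : ℂ :=
  ∑' p : ℕ × ℕ,
    (ascPochhammer ℂ (p.1 + p.2)).eval a * (ascPochhammer ℂ (p.1 + p.2)).eval b /
      ((ascPochhammer ℂ p.1).eval c * (ascPochhammer ℂ p.2).eval c' * (p.1 ! : ℂ) * (p.2 ! : ℂ)) *
      y₁ ^ p.1 * y₂ ^ p.2

/-- The matrix of the `A`-hypergeometric system of `F₄`. -/
def appellMatrix : Matrix (Fin 4) (Fin 6) ℤ :=
  !![1, 1, 1, 1,  1,  1;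
     1, 1, 1, 0,  0,  0;
     0, 1, 0, 0, -1,  0;
     0, 0, 1, 0,  0, -1]

/-- The exponent vector `κ = (-a, c - 1, c' - 1, -b, 0, 0)`. -/
def appellKappa (a b c c' : ℂ) : Fin 6 → ℂ := ![-a, c - 1, c' - 1, -b, 0, 0]

/-- The parameter `β = A κ`. -/
noncomputable def appellBeta (a b c c' : ℂ) : Fin 4 → ℂ :=
  (appellMatrix.map (fun z : ℤ => (z : ℂ))).mulVec (appellKappa a b c c')

/-- `y₁ = x₂ x₅ / (x₁ x₄)` (indices start from `0` in the code). -/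
noncomputable def appellY₁ (x : Fin 6 → ℂ) : ℂ := x 1 * x 4 / (x 0 * x 3)

/-- `y₂ = x₃ x₆ / (x₁ x₄)`. -/
noncomputable def appellY₂ (x : Fin 6 → ℂ) : ℂ := x 2 * x 5 / (x 0 * x 3)

/-- Where the series `F₄(y₁, y₂)` converges: `x` has nonzero coordinates and
`√|y₁| + √|y₂| < 1`. -/
def appellDomain : Set (Fin 6 → ℂ) :=
  {x | (∀ j, x j ≠ 0) ∧ Real.sqrt ‖appellY₁ x‖ + Real.sqrt ‖appellY₂ x‖ < 1}

/-- The homogenization `x^κ F₄(a, b; c, c'; y₁, y₂)` of `F₄`, where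
`x^κ = x₁^{-a} x₂^{c-1} x₃^{c'-1} x₄^{-b}` is formed with the branches `ℓ j x` of `log x_j`. -/
noncomputable def appellPhi (a b c c' : ℂ) (ℓ : Fin 6 → (Fin 6 → ℂ) → ℂ) (x : Fin 6 → ℂ) : ℂ :=
  Complex.exp (∑ j : Fin 6, appellKappa a b c c' j * ℓ j x) *
    appellF4 a b c c' (appellY₁ x) (appellY₂ x)

/-- Generic parameters of `F₄`: the series is defined, and `β = A κ` is nonresonant, that is, no
primitive integral linear form defining one of the eight facets of the cone over the columns of `A`
(an octahedron) takes an integer value at `β`. -/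
structure AppellGeneric (a b c c' : ℂ) : Prop where
  c_ne : ∀ k : ℕ, c ≠ -(k : ℂ)
  c'_ne : ∀ k : ℕ, c' ≠ -(k : ℂ)
  a_ne : ∀ k : ℤ, a ≠ k
  b_ne : ∀ k : ℤ, b ≠ k
  a_sub_c_ne : ∀ k : ℤ, a - c ≠ k
  b_sub_c_ne : ∀ k : ℤ, b - c ≠ k
  a_sub_c'_ne : ∀ k : ℤ, a - c' ≠ k
  b_sub_c'_ne : ∀ k : ℤ, b - c' ≠ k
  a_sub_c_sub_c'_ne : ∀ k : ℤ, a - c - c' ≠ k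
  b_sub_c_sub_c'_ne : ∀ k : ℤ, b - c - c' ≠ k

/-!
The Euler-type integral over an orthant continues analytically much further than `F₄` does.

Let `F₄` be represented near some point by an integral over a rotated orthant. Rotating the
coordinates `w` of the torus and multiplying the coefficients of the block form by phases turns the
rotated orthant into the positive one; the phases cancel in `y₁` and `y₂`, because the three pairs
of antipodal columns of `A` (the vertices of an octahedron) have the same sum. On the set of
*admissible* coefficients, for which stably no `f_i` takes a value in `(-∞, 0]` on the positive
orthant, the modulus of the integrand is comparable to a function that depends on the coefficients
only through locally uniform constants: if changing a coefficient by less than `δ` never produces a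
zero, then `|f_i|` is at least `δ` times each of its monomials. So convergence at one admissible
point implies convergence and holomorphy on all of them (`differentiableAt_eulerIntegral`).
Coefficients in the open right half-plane are admissible, whatever their moduli.

The representation can be continued to this region (`exists_admissible_path`). If the `f_i` stably
have no zeros, there is no nontrivial relation `∑ s_k X_k = 0` with `s_k ≥ 0` among three
coefficients of a block, one from each antipodal pair, since torus elements can make any such choice
dominate. If there are two blocks, the coefficients of each therefore lie in a half-plane and can be
rotated into the right one. If there is one block, either this holds as well, or, after a rotation,
one antipodal pair has directions `-e^{∓iα}` and the other four coefficients lie in the sector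
`|arg| < α`. In the latter case the pair is turned outward until it is in the right half-plane; the
sums of the pair with weights `e^{±t}` run through a branch of a hyperbola, which gets flatter under
this motion, so that no zeros appear (`pair_sum_ne_zero_of_le`).

Hence `x^κ F₄` is a multiple of the integral wherever the series converges and the coefficients have
arguments less than `π / 2` in modulus. Take coefficients `e^{± w / 4}` for which `y₁ = y₂ = e^w`.
The integral is holomorphic for `|Im w| < 2π`, without restriction on `Re w`. A strip of height `4π`
overlaps its translate by `2πi`, so `F₄(s, s)` extends to an entire function of `s = e^w`
(`tendsto_coeff_of_strip`). But by Vandermonde's identity the coefficients of `F₄(s, s)` satisfy a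
first-order recurrence whose ratio tends to `4`; those of high degree are not zero since `a` and `b`
are not integers, and so they do not tend to zero (`not_tendsto_appellDiagCoeff`).
-/

open Filter Topology

/-! ### Convergence and holomorphy of Appell's series -/

/-- A nonnegative sequence whose consecutive ratios are eventually at most `q` is `O(q ^ n)`. -/
theorem exists_le_mul_pow_of_eventually_succ_le {v : ℕ → ℝ} {q : ℝ} (hq : 0 < q)
    (hv : ∀ᶠ n in atTop, v (n + 1) ≤ q * v n) : ∃ C : ℝ, 0 < C ∧ ∀ n, v n ≤ C * q ^ n := by
  obtain ⟨N, hN⟩ := eventually_atTop.1 hv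
  set C : ℝ := 1 + ∑ k ∈ Finset.range (N + 1), |v k| / q ^ k with hC
  have hsum : ∀ k ∈ Finset.range (N + 1), 0 ≤ |v k| / q ^ k := fun k _ => by positivity
  have hpos : 0 < C := by have := Finset.sum_nonneg hsum; linarith
  refine ⟨C, hpos, fun n => ?_⟩
  have hsmall : ∀ k ≤ N, v k ≤ C * q ^ k := by
    intro k hk
    have h1 := Finset.single_le_sum hsum (Finset.mem_range.2 (Nat.lt_succ_of_le hk))
    have h2 : |v k| / q ^ k ≤ C := by linarith
    rw [div_le_iff₀ (by positivity)] at h2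
    exact (le_abs_self _).trans h2
  rcases le_total n N with h | h
  · exact hsmall n h
  · induction n, h using Nat.le_induction with
    | base => exact hsmall N le_rfl
    | succ k hk ih =>
      calc v (k + 1) ≤ q * v k := hN k hk
        _ ≤ q * (C * q ^ k) := by gcongr
        _ = C * q ^ (k + 1) := by ring

theorem norm_add_natCast_le (a : ℂ) (n : ℕ) : ‖a + n‖ ≤ ‖a‖ + n := by
  simpa using norm_add_le a (n : ℂ)

theorem natCast_sub_norm_le (a : ℂ) (n : ℕ) : (n : ℝ) - ‖a‖ ≤ ‖a + n‖ := by
  have := norm_sub_norm_le (n : ℂ) (-a)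
  simp only [norm_neg, sub_neg_eq_add, Complex.norm_natCast] at this
  rwa [add_comm]

theorem exists_norm_ascPochhammer_le (a : ℂ) {q : ℝ} (hq : 1 < q) :
    ∃ C : ℝ, 0 < C ∧ ∀ n : ℕ, ‖(ascPochhammer ℂ n).eval a‖ ≤ C * q ^ n * (n ! : ℝ) := by
  obtain ⟨C, hC, h⟩ := exists_le_mul_pow_of_eventually_succ_le
    (v := fun n => ‖(ascPochhammer ℂ n).eval a‖ / (n ! : ℝ)) (q := q) (by linarith) (by
      filter_upwards [eventually_ge_atTop (⌈‖a‖ / (q - 1)⌉₊)] with n hn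
      have hn' : ‖a‖ ≤ (q - 1) * n := by
        have := (Nat.ceil_le.1 hn)
        rw [div_le_iff₀ (by linarith)] at this
        linarith
      have h1 : ‖a + n‖ ≤ q * (n + 1) := by
        have := norm_add_natCast_le a n
        linarith
      rw [ascPochhammer_succ_eval, Nat.factorial_succ, norm_mul, ← mul_div_assoc,
        div_le_div_iff₀ (by positivity) (by positivity)]
      push_cast
      have h2 : 0 ≤ ‖(ascPochhammer ℂ n).eval a‖ * (n ! : ℝ) := by positivity
      nlinarith [mul_le_mul_of_nonneg_left h1 h2])
  refine ⟨C, hC, fun n => ?_⟩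
  have := h n
  rwa [div_le_iff₀ (by positivity)] at this

theorem exists_factorial_le_norm_ascPochhammer {c : ℂ} (hc : ∀ k : ℕ, c ≠ -(k : ℂ)) {q : ℝ}
    (hq : 1 < q) :
    ∃ C : ℝ, 0 < C ∧ ∀ n : ℕ, (n ! : ℝ) ≤ C * q ^ n * ‖(ascPochhammer ℂ n).eval c‖ := by
  have hne : ∀ n : ℕ, 0 < ‖(ascPochhammer ℂ n).eval c‖ := by
    intro n
    rw [norm_pos_iff, Ne, ascPochhammer_eval_eq_zero_iff]
    rintro ⟨k, -, hk⟩
    exact hc k (by rw [hk, neg_neg])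
  obtain ⟨C, hC, h⟩ := exists_le_mul_pow_of_eventually_succ_le
    (v := fun n => (n ! : ℝ) / ‖(ascPochhammer ℂ n).eval c‖) (q := q) (by linarith) (by
      filter_upwards [eventually_ge_atTop (⌈(1 + q * ‖c‖) / (q - 1)⌉₊)] with n hn
      have hn' : 1 + q * ‖c‖ ≤ (q - 1) * n := by
        have := (Nat.ceil_le.1 hn)
        rw [div_le_iff₀ (by linarith)] at this
        linarith
      have h1 : (n : ℝ) + 1 ≤ q * ‖c + n‖ := by
        have := mul_le_mul_of_nonneg_left (natCast_sub_norm_le c n) (by linarith : 0 ≤ q)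
        linarith
      have h3 := hne (n + 1)
      rw [ascPochhammer_succ_eval, norm_mul] at h3
      rw [ascPochhammer_succ_eval, Nat.factorial_succ, norm_mul, ← mul_div_assoc,
        div_le_div_iff₀ h3 (hne n)]
      push_cast
      have h2 : 0 ≤ ‖(ascPochhammer ℂ n).eval c‖ * (n ! : ℝ) := by positivity
      nlinarith [mul_le_mul_of_nonneg_left h1 h2])
  refine ⟨C, hC, fun n => ?_⟩
  have := h n
  rwa [div_le_iff₀ (hne n)] at this

/-- The coefficient of `y₁ ^ p y₂ ^ q` in Appell's series. -/
noncomputable def appellCoeff (a b c c' : ℂ) (p : ℕ × ℕ) : ℂ :=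
  (ascPochhammer ℂ (p.1 + p.2)).eval a * (ascPochhammer ℂ (p.1 + p.2)).eval b /
    ((ascPochhammer ℂ p.1).eval c * (ascPochhammer ℂ p.2).eval c' * (p.1 ! : ℂ) * (p.2 ! : ℂ))

/-- Up to a factor `q ^ (3 n)` with `q > 1` arbitrary, the coefficients of degree `n` of Appell's
series are at most the squares of the binomial coefficients. -/
theorem exists_norm_appellCoeff_le (a b : ℂ) {c c' : ℂ} (hc : ∀ k : ℕ, c ≠ -(k : ℂ))
    (hc' : ∀ k : ℕ, c' ≠ -(k : ℂ)) {q : ℝ} (hq : 1 < q) :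
    ∃ C : ℝ, 0 < C ∧ ∀ p : ℕ × ℕ, ‖appellCoeff a b c c' p‖ ≤
      C * (q ^ 3) ^ (p.1 + p.2) * (((p.1 + p.2).choose p.1 : ℕ) : ℝ) ^ 2 := by
  obtain ⟨Ca, hCa, ha⟩ := exists_norm_ascPochhammer_le a hq
  obtain ⟨Cb, hCb, hb⟩ := exists_norm_ascPochhammer_le b hq
  obtain ⟨Cc, hCc, hcb⟩ := exists_factorial_le_norm_ascPochhammer hc hq
  obtain ⟨Cc', hCc', hcb'⟩ := exists_factorial_le_norm_ascPochhammer hc' hq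
  refine ⟨Ca * Cb * Cc * Cc', by positivity, ?_⟩
  rintro ⟨m, n⟩
  have hq0 : 0 < q := by linarith
  have h1 := hcb m
  have h2 := hcb' n
  have hm : 0 < ‖(ascPochhammer ℂ m).eval c‖ := by
    by_contra h
    have h0 : ‖(ascPochhammer ℂ m).eval c‖ = 0 := le_antisymm (not_lt.1 h) (norm_nonneg _)
    rw [h0, mul_zero] at h1
    have : (0 : ℝ) < (m ! : ℝ) := by positivity
    linarith
  have hn : 0 < ‖(ascPochhammer ℂ n).eval c'‖ := by
    by_contra h
    have h0 : ‖(ascPochhammer ℂ n).eval c'‖ = 0 := le_antisymm (not_lt.1 h) (norm_nonneg _)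
    rw [h0, mul_zero] at h2
    have : (0 : ℝ) < (n ! : ℝ) := by positivity
    linarith
  have hch : (((m + n).choose m : ℕ) : ℝ) * (m ! : ℝ) * (n ! : ℝ) = ((m + n)! : ℝ) := by
    have := Nat.add_choose_mul_factorial_mul_factorial m n
    rw [← Nat.choose_symm_add] at this
    exact_mod_cast this
  simp only [appellCoeff, norm_div, norm_mul, Complex.norm_natCast]
  rw [div_le_iff₀ (by positivity)]
  set A := ‖(ascPochhammer ℂ (m + n)).eval a‖
  set B := ‖(ascPochhammer ℂ (m + n)).eval b‖
  set X := ‖(ascPochhammer ℂ m).eval c‖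
  set Y := ‖(ascPochhammer ℂ n).eval c'‖
  set M : ℝ := (m ! : ℝ)
  set N : ℝ := (n ! : ℝ)
  have hM : 0 < M := by positivity
  have hN : 0 < N := by positivity
  set H : ℝ := (((m + n).choose m : ℕ) : ℝ)
  have hab : A * B ≤ (Ca * q ^ (m + n) * (H * M * N)) * (Cb * q ^ (m + n) * (H * M * N)) := by
    rw [hch]
    exact mul_le_mul (ha _) (hb _) (norm_nonneg _) (by positivity)
  have hMN : M * N ≤ (Cc * q ^ m * X) * (Cc' * q ^ n * Y) :=
    mul_le_mul h1 h2 hN.le (by positivity)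
  calc A * B ≤ (Ca * q ^ (m + n) * (H * M * N)) * (Cb * q ^ (m + n) * (H * M * N)) := hab
    _ = (Ca * Cb * (q ^ (m + n)) ^ 2 * H ^ 2 * (M * N)) * (M * N) := by ring
    _ ≤ (Ca * Cb * (q ^ (m + n)) ^ 2 * H ^ 2 * (M * N)) *
        ((Cc * q ^ m * X) * (Cc' * q ^ n * Y)) := by gcongr
    _ = Ca * Cb * Cc * Cc' * (q ^ 3) ^ (m + n) * H ^ 2 * (X * Y * M * N) := by
      rw [← pow_mul, ← pow_mul, show 3 * (m + n) = (m + n) * 2 + (m + n) by ring, pow_add q (_ * 2),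
        pow_add q m n]
      ring

theorem choose_mul_pow_mul_pow_le {X Y : ℝ} (hX : 0 ≤ X) (hY : 0 ≤ Y) (m n : ℕ) :
    (((m + n).choose m : ℕ) : ℝ) * X ^ m * Y ^ n ≤ (X + Y) ^ (m + n) := by
  rw [add_pow]
  have := Finset.single_le_sum
    (f := fun k => X ^ k * Y ^ (m + n - k) * (((m + n).choose k : ℕ) : ℝ))
    (fun k _ => by positivity) (Finset.mem_range.2 (by omega : m < m + n + 1))
  simp only [add_tsub_cancel_left] at this
  linarith

/-- A summable majorant of Appell's series, uniform on a closed polydisc with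
`√ρ₁ + √ρ₂ < 1`. -/
theorem exists_summable_appell_majorant (a b : ℂ) {c c' : ℂ} (hc : ∀ k : ℕ, c ≠ -(k : ℂ))
    (hc' : ∀ k : ℕ, c' ≠ -(k : ℂ)) {ρ₁ ρ₂ : ℝ} (h₁ : 0 ≤ ρ₁) (h₂ : 0 ≤ ρ₂)
    (h : Real.sqrt ρ₁ + Real.sqrt ρ₂ < 1) :
    ∃ M : ℕ × ℕ → ℝ, Summable M ∧ ∀ (p : ℕ × ℕ) (y₁ y₂ : ℂ), ‖y₁‖ ≤ ρ₁ → ‖y₂‖ ≤ ρ₂ →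
      ‖appellCoeff a b c c' p * y₁ ^ p.1 * y₂ ^ p.2‖ ≤ M p := by
  set σ := Real.sqrt ρ₁ + Real.sqrt ρ₂ with hσ
  have hσ0 : 0 ≤ σ := by positivity
  obtain ⟨q, hq, hqσ⟩ : ∃ q : ℝ, 1 < q ∧ q ^ 3 * σ ^ 2 < 1 := by
    have hcont : Filter.Tendsto (fun q : ℝ => q ^ 3 * σ ^ 2) (nhdsWithin 1 (Set.Ioi 1))
        (nhds (1 ^ 3 * σ ^ 2)) :=
      ((Continuous.tendsto (by fun_prop) 1).mono_left nhdsWithin_le_nhds)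
    have hlt : (1 : ℝ) ^ 3 * σ ^ 2 < 1 := by nlinarith
    obtain ⟨q, hq1, hq2⟩ := ((hcont.eventually (gt_mem_nhds hlt)).and
      (eventually_mem_nhdsWithin)).exists
    exact ⟨q, hq2, hq1⟩
  obtain ⟨C, hC, hb⟩ := exists_norm_appellCoeff_le a b hc hc' hq
  have hq0 : 0 < q := by linarith
  set t := q ^ 3 * σ ^ 2 with ht
  have ht0 : 0 ≤ t := by positivity
  refine ⟨fun p => C * (t ^ p.1 * t ^ p.2), ?_, ?_⟩
  · have hg := summable_geometric_of_lt_one ht0 hqσ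
    exact (hg.mul_of_nonneg hg (fun n => pow_nonneg ht0 n) (fun n => pow_nonneg ht0 n)).mul_left C
  · rintro ⟨m, n⟩ y₁ y₂ hy₁ hy₂
    have hch := choose_mul_pow_mul_pow_le (Real.sqrt_nonneg ρ₁) (Real.sqrt_nonneg ρ₂) m n
    have hsq : (((m + n).choose m : ℕ) : ℝ) ^ 2 * (ρ₁ ^ m * ρ₂ ^ n) ≤ (σ ^ 2) ^ (m + n) := by
      have h3 := pow_le_pow_left₀ (by positivity) hch 2
      calc (((m + n).choose m : ℕ) : ℝ) ^ 2 * (ρ₁ ^ m * ρ₂ ^ n)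
          = ((((m + n).choose m : ℕ) : ℝ) * Real.sqrt ρ₁ ^ m * Real.sqrt ρ₂ ^ n) ^ 2 := by
            conv_lhs => rw [← Real.sq_sqrt h₁, ← Real.sq_sqrt h₂]
            ring
        _ ≤ _ := h3
        _ = (σ ^ 2) ^ (m + n) := by rw [← pow_mul, ← pow_mul, mul_comm]
    simp only [norm_mul, norm_pow]
    calc ‖appellCoeff a b c c' (m, n)‖ * ‖y₁‖ ^ m * ‖y₂‖ ^ n
        ≤ (C * (q ^ 3) ^ (m + n) * (((m + n).choose m : ℕ) : ℝ) ^ 2) * ρ₁ ^ m * ρ₂ ^ n := by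
          gcongr
          exact hb (m, n)
      _ = C * (q ^ 3) ^ (m + n) * ((((m + n).choose m : ℕ) : ℝ) ^ 2 * (ρ₁ ^ m * ρ₂ ^ n)) := by
          ring
      _ ≤ C * (q ^ 3) ^ (m + n) * (σ ^ 2) ^ (m + n) := by gcongr
      _ = C * (t ^ m * t ^ n) := by rw [ht, mul_assoc, ← mul_pow, pow_add]

theorem summable_appell (a b : ℂ) {c c' : ℂ} (hc : ∀ k : ℕ, c ≠ -(k : ℂ))
    (hc' : ∀ k : ℕ, c' ≠ -(k : ℂ)) {y₁ y₂ : ℂ} (h : Real.sqrt ‖y₁‖ + Real.sqrt ‖y₂‖ < 1) :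
    Summable fun p : ℕ × ℕ => appellCoeff a b c c' p * y₁ ^ p.1 * y₂ ^ p.2 := by
  obtain ⟨M, hM, hb⟩ := exists_summable_appell_majorant a b hc hc' (norm_nonneg y₁)
    (norm_nonneg y₂) h
  exact Summable.of_norm_bounded hM fun p => hb p y₁ y₂ le_rfl le_rfl

theorem differentiableAt_appellF4 (a b : ℂ) {c c' : ℂ} (hc : ∀ k : ℕ, c ≠ -(k : ℂ))
    (hc' : ∀ k : ℕ, c' ≠ -(k : ℂ)) {h₁ h₂ : ℂ → ℂ} (hd₁ : Differentiable ℂ h₁)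
    (hd₂ : Differentiable ℂ h₂) {w : ℂ} (hw : Real.sqrt ‖h₁ w‖ + Real.sqrt ‖h₂ w‖ < 1) :
    DifferentiableAt ℂ (fun ζ => appellF4 a b c c' (h₁ ζ) (h₂ ζ)) w := by
  obtain ⟨ε, hε, hlt⟩ : ∃ ε : ℝ, 0 < ε ∧ Real.sqrt (‖h₁ w‖ + ε) + Real.sqrt (‖h₂ w‖ + ε) < 1 := by
    have hcont : Tendsto (fun ε : ℝ => Real.sqrt (‖h₁ w‖ + ε) + Real.sqrt (‖h₂ w‖ + ε))
        (𝓝[>] 0) (𝓝 (Real.sqrt (‖h₁ w‖ + 0) + Real.sqrt (‖h₂ w‖ + 0))) :=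
      ((Continuous.tendsto (by fun_prop) 0).mono_left nhdsWithin_le_nhds)
    rw [add_zero, add_zero] at hcont
    obtain ⟨ε, h1, h2⟩ := ((hcont.eventually (gt_mem_nhds hw)).and
      (eventually_mem_nhdsWithin)).exists
    exact ⟨ε, h2, h1⟩
  obtain ⟨M, hM, hb⟩ := exists_summable_appell_majorant a b hc hc'
    (by positivity : 0 ≤ ‖h₁ w‖ + ε) (by positivity : 0 ≤ ‖h₂ w‖ + ε) hlt
  set s : Set ℂ := {ζ | ‖h₁ ζ‖ < ‖h₁ w‖ + ε} ∩ {ζ | ‖h₂ ζ‖ < ‖h₂ w‖ + ε} with hs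
  have hsopen : IsOpen s :=
    (isOpen_lt hd₁.continuous.norm continuous_const).inter
      (isOpen_lt hd₂.continuous.norm continuous_const)
  have hws : w ∈ s := ⟨by simpa using hε, by simpa using hε⟩
  have := Complex.differentiableOn_tsum_of_summable_norm
    (F := fun (p : ℕ × ℕ) ζ => appellCoeff a b c c' p * h₁ ζ ^ p.1 * h₂ ζ ^ p.2) hM
    (fun p => by fun_prop) hsopen (fun p ζ hζ => hb p _ _ (le_of_lt hζ.1) (le_of_lt hζ.2))
  exact this.differentiableAt (hsopen.mem_nhds hws)

/-! ### The diagonal of Appell's series -/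

/-- The coefficient of `s ^ n` in `F₄(s, s)`. -/
noncomputable def appellDiagCoeff (a b c c' : ℂ) (n : ℕ) : ℂ :=
  ∑ p ∈ Finset.HasAntidiagonal.antidiagonal n, appellCoeff a b c c' p

theorem hasSum_appellDiagCoeff (a b : ℂ) {c c' : ℂ} (hc : ∀ k : ℕ, c ≠ -(k : ℂ))
    (hc' : ∀ k : ℕ, c' ≠ -(k : ℂ)) {s : ℂ} (hs : ‖s‖ < 1 / 4) :
    HasSum (fun n => s ^ n * appellDiagCoeff a b c c' n) (appellF4 a b c c' s s) := by
  have hsq : Real.sqrt ‖s‖ + Real.sqrt ‖s‖ < 1 := by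
    have : Real.sqrt ‖s‖ < 1 / 2 := by
      rw [Real.sqrt_lt' (by norm_num)]
      linarith
    linarith
  have h := (summable_appell a b hc hc' hsq).hasSum
  rw [← Finset.HasAntidiagonal.sigmaAntidiagonalEquivProd.hasSum_iff] at h
  have h2 := h.sigma (fun n => hasSum_fintype _)
  convert! h2 using 1
  funext n
  rw [appellDiagCoeff, Finset.mul_sum, ← Finset.sum_coe_sort]
  refine Finset.sum_congr rfl fun p _ => ?_
  have hp := Finset.HasAntidiagonal.mem_antidiagonal.1 p.2
  have hpow : s ^ n = s ^ (p : ℕ × ℕ).1 * s ^ (p : ℕ × ℕ).2 := by rw [← pow_add, hp]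
  simp only [Function.comp, Finset.HasAntidiagonal.sigmaAntidiagonalEquivProd_apply]
  rw [hpow]
  ring

theorem ascPochhammer_eval_add (x : ℂ) (m n : ℕ) :
    (ascPochhammer ℂ (m + n)).eval x =
      (ascPochhammer ℂ m).eval x * (ascPochhammer ℂ n).eval (x + m) := by
  rw [← ascPochhammer_mul]
  simp

/-- Vandermonde's identity for rising factorials, with the arguments shifted so that the summands
are those of the diagonal of Appell's series. -/
theorem ascPochhammer_vandermonde (c c' : ℂ) (n : ℕ) :
    (ascPochhammer ℂ n).eval (c + c' + n - 1) = ∑ p ∈ Finset.HasAntidiagonal.antidiagonal n,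
      (n.choose p.1 : ℂ) *
        ((ascPochhammer ℂ p.1).eval (c' + p.2) * (ascPochhammer ℂ p.2).eval (c + p.1)) := by
  have h := Ring.descPochhammer_smeval_add n (Commute.all (c' + n - 1) (c + n - 1))
  simp only [Polynomial.descPochhammer_smeval_eq_ascPochhammer,
    Polynomial.ascPochhammer_smeval_eq_eval] at h
  convert h using 1
  · congr 1; ring
  · refine Finset.sum_congr rfl fun p hp => ?_
    have hp := Finset.HasAntidiagonal.mem_antidiagonal.1 hp
    rw [← hp]
    push_cast
    congr 3 <;> ring

theorem ascPochhammer_eval_ne_zero {c : ℂ} (hc : ∀ k : ℕ, c ≠ -(k : ℂ)) (n : ℕ) :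
    (ascPochhammer ℂ n).eval c ≠ 0 := by
  rw [Ne, ascPochhammer_eval_eq_zero_iff]
  rintro ⟨k, -, hk⟩
  exact hc k (by rw [hk, neg_neg])

theorem appellDiagCoeff_mul (a b : ℂ) {c c' : ℂ} (hc : ∀ k : ℕ, c ≠ -(k : ℂ))
    (hc' : ∀ k : ℕ, c' ≠ -(k : ℂ)) (n : ℕ) :
    appellDiagCoeff a b c c' n *
        ((ascPochhammer ℂ n).eval c * (ascPochhammer ℂ n).eval c' * (n ! : ℂ)) =
      (ascPochhammer ℂ n).eval a * (ascPochhammer ℂ n).eval b *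
        (ascPochhammer ℂ n).eval (c + c' + n - 1) := by
  rw [ascPochhammer_vandermonde, appellDiagCoeff, Finset.sum_mul, Finset.mul_sum]
  refine Finset.sum_congr rfl fun p hp => ?_
  have hp := Finset.HasAntidiagonal.mem_antidiagonal.1 hp
  obtain ⟨i, j⟩ := p
  simp only at hp ⊢
  subst hp
  have e1 := ascPochhammer_eval_add c i j
  have e2 := ascPochhammer_eval_add c' j i
  rw [add_comm j i] at e2
  have e3 : (((i + j).choose i : ℕ) : ℂ) * (i ! : ℂ) * (j ! : ℂ) = ((i + j)! : ℂ) := by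
    have := Nat.add_choose_mul_factorial_mul_factorial i j
    rw [← Nat.choose_symm_add] at this
    exact_mod_cast this
  have n1 := ascPochhammer_eval_ne_zero hc i
  have n2 := ascPochhammer_eval_ne_zero hc' j
  have n3 : (i ! : ℂ) ≠ 0 := by exact_mod_cast Nat.factorial_ne_zero i
  have n4 : (j ! : ℂ) ≠ 0 := by exact_mod_cast Nat.factorial_ne_zero j
  rw [appellCoeff, e1, e2, ← e3]
  simp only
  field_simp

/-- The recurrence of the coefficients of `F₄(s, s)`, a generalized hypergeometric series `₄F₃` in
`4 s`. -/
theorem appellDiagCoeff_succ (a b : ℂ) {c c' : ℂ} (hc : ∀ k : ℕ, c ≠ -(k : ℂ))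
    (hc' : ∀ k : ℕ, c' ≠ -(k : ℂ)) (n : ℕ) :
    appellDiagCoeff a b c c' (n + 1) * ((c + n) * (c' + n) * (n + 1) * (c + c' + n - 1)) =
      appellDiagCoeff a b c c' n *
        ((a + n) * (b + n) * (c + c' + 2 * n - 1) * (c + c' + 2 * n)) := by
  have h0 := appellDiagCoeff_mul a b hc hc' n
  have h1 := appellDiagCoeff_mul a b hc hc' (n + 1)
  have hv : (c + c' + n - 1) * (ascPochhammer ℂ (n + 1)).eval (c + c' + n) =
      (ascPochhammer ℂ n).eval (c + c' + n - 1) * (c + c' + 2 * n - 1) * (c + c' + 2 * n) := by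
    have e1 := ascPochhammer_eval_add (c + c' + n - 1) 1 (n + 1)
    rw [show 1 + (n + 1) = n + 1 + 1 by ring, ascPochhammer_succ_eval, ascPochhammer_succ_eval,
      ascPochhammer_one, Polynomial.eval_X] at e1
    push_cast at e1
    rw [show c + c' + (n : ℂ) - 1 + 1 = c + c' + n by ring] at e1
    rw [← e1]
    ring
  rw [ascPochhammer_succ_eval, ascPochhammer_succ_eval, ascPochhammer_succ_eval,
    ascPochhammer_succ_eval, Nat.factorial_succ] at h1
  push_cast at h1
  rw [show c + c' + ((n : ℂ) + 1) - 1 = c + c' + n by ring] at h1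
  have n1 := ascPochhammer_eval_ne_zero hc n
  have n2 := ascPochhammer_eval_ne_zero hc' n
  have n3 : (n ! : ℂ) ≠ 0 := by exact_mod_cast Nat.factorial_ne_zero n
  apply mul_right_cancel₀ (mul_ne_zero (mul_ne_zero n1 n2) n3)
  linear_combination (c + c' + (n : ℂ) - 1) * h1 -
    ((a + n) * (b + n) * (c + c' + 2 * n - 1) * (c + c' + 2 * n)) * h0 +
    (ascPochhammer ℂ n).eval a * (a + n) * ((ascPochhammer ℂ n).eval b * (b + n)) * hv

/-- The power series `F₄(s, s)` does not converge at `s = 1`: the moduli of its coefficients are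
eventually increasing, their consecutive ratios tending to `4`. -/
theorem not_tendsto_appellDiagCoeff {a b c c' : ℂ} (ha : ∀ k : ℕ, a ≠ -(k : ℂ))
    (hb : ∀ k : ℕ, b ≠ -(k : ℂ)) (hc : ∀ k : ℕ, c ≠ -(k : ℂ)) (hc' : ∀ k : ℕ, c' ≠ -(k : ℂ)) :
    ¬ Tendsto (appellDiagCoeff a b c c') atTop (𝓝 0) := by
  -- For `n ≥ 10 R` all factors of the recurrence are within ten percent of `n` or `2 n`, and
  -- `1.1 ^ 4 ≤ 4 * 0.9 ^ 4`.
  set R : ℝ := ‖a‖ + ‖b‖ + ‖c‖ + ‖c'‖ + 2 with hR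
  have hRa := norm_nonneg a
  have hRb := norm_nonneg b
  have hRc := norm_nonneg c
  have hRc' := norm_nonneg c'
  obtain ⟨N, hN⟩ := exists_nat_ge (10 * R)
  have he : ‖c + c'‖ ≤ R - 2 := (norm_add_le c c').trans (by linarith)
  have he1 : ‖c + c' - 1‖ ≤ R - 1 := by
    have := norm_sub_le (c + c') 1
    rw [norm_one] at this
    linarith
  have hstep : ∀ n ≥ N, ‖appellDiagCoeff a b c c' n‖ ≤ ‖appellDiagCoeff a b c c' (n + 1)‖ := by
    intro n hn
    have hn' : 10 * R ≤ n := hN.trans (by exact_mod_cast hn)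
    have hrec := congrArg norm (appellDiagCoeff_succ a b hc hc' n)
    simp only [norm_mul] at hrec
    have hx : (0 : ℝ) < n := by linarith
    have l1 : 9 / 10 * (n : ℝ) ≤ ‖a + n‖ := le_trans (by linarith) (natCast_sub_norm_le a n)
    have l2 : 9 / 10 * (n : ℝ) ≤ ‖b + n‖ := le_trans (by linarith) (natCast_sub_norm_le b n)
    have l3 : 9 / 10 * (2 * (n : ℝ)) ≤ ‖c + c' + 2 * n - 1‖ := by
      have := natCast_sub_norm_le (c + c' - 1) (2 * n)
      push_cast at this
      rw [show c + c' + 2 * (n : ℂ) - 1 = c + c' - 1 + 2 * n by ring]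
      linarith
    have l4 : 9 / 10 * (2 * (n : ℝ)) ≤ ‖c + c' + 2 * n‖ := by
      have := natCast_sub_norm_le (c + c') (2 * n)
      push_cast at this
      linarith
    have u1 : ‖c + n‖ ≤ 11 / 10 * (n : ℝ) := (norm_add_natCast_le c n).trans (by linarith)
    have u2 : ‖c' + n‖ ≤ 11 / 10 * (n : ℝ) := (norm_add_natCast_le c' n).trans (by linarith)
    have u3 : ‖(n : ℂ) + 1‖ ≤ 11 / 10 * (n : ℝ) := by
      have := norm_add_natCast_le 1 n
      rw [add_comm, norm_one] at this
      linarith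
    have u4 : ‖c + c' + n - 1‖ ≤ 11 / 10 * (n : ℝ) := by
      have := norm_add_natCast_le (c + c' - 1) n
      rw [show c + c' + (n : ℂ) - 1 = c + c' - 1 + n by ring]
      linarith
    have hlow : (9 / 10 * (n : ℝ)) * (9 / 10 * n) * (9 / 10 * (2 * n)) * (9 / 10 * (2 * n)) ≤
        ‖a + n‖ * ‖b + n‖ * ‖c + c' + 2 * n - 1‖ * ‖c + c' + 2 * n‖ := by gcongr
    have hupp : ‖c + n‖ * ‖c' + n‖ * ‖(n : ℂ) + 1‖ * ‖c + c' + n - 1‖ ≤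
        (11 / 10 * (n : ℝ)) * (11 / 10 * n) * (11 / 10 * n) * (11 / 10 * n) := by gcongr
    have hP : 0 < (11 / 10 * (n : ℝ)) * (11 / 10 * n) * (11 / 10 * n) * (11 / 10 * n) := by
      positivity
    have hle : (11 / 10 * (n : ℝ)) * (11 / 10 * n) * (11 / 10 * n) * (11 / 10 * n) ≤
        (9 / 10 * (n : ℝ)) * (9 / 10 * n) * (9 / 10 * (2 * n)) * (9 / 10 * (2 * n)) := by
      nlinarith [pow_pos hx 4]
    refine le_of_mul_le_mul_right ?_ hP
    calc _ ≤ ‖appellDiagCoeff a b c c' n‖ *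
          (‖a + n‖ * ‖b + n‖ * ‖c + c' + 2 * n - 1‖ * ‖c + c' + 2 * n‖) := by
            exact mul_le_mul_of_nonneg_left (hle.trans hlow) (norm_nonneg _)
      _ = _ := hrec.symm
      _ ≤ _ := by gcongr
  have hne : appellDiagCoeff a b c c' N ≠ 0 := by
    intro h0
    have h := appellDiagCoeff_mul a b hc hc' N
    rw [h0, zero_mul] at h
    rcases mul_eq_zero.1 h.symm with h | h
    · exact mul_ne_zero (ascPochhammer_eval_ne_zero ha N) (ascPochhammer_eval_ne_zero hb N) h
    · obtain ⟨k, -, hk⟩ := (ascPochhammer_eval_eq_zero_iff _ _).1 h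
      have h1 : c + c' - 1 + ((N + k : ℕ) : ℂ) = 0 := by
        push_cast
        rw [hk]
        ring
      have h2 := natCast_sub_norm_le (c + c' - 1) (N + k)
      rw [h1, norm_zero] at h2
      push_cast at h2
      have : (0 : ℝ) ≤ k := Nat.cast_nonneg k
      linarith
  intro ht
  have hge : ∀ n ≥ N, ‖appellDiagCoeff a b c c' N‖ ≤ ‖appellDiagCoeff a b c c' n‖ := by
    intro n hn
    induction n, hn using Nat.le_induction with
    | base => exact le_rfl
    | succ k hk ih => exact ih.trans (hstep k hk)
  have := ge_of_tendsto ht.norm (eventually_atTop.2 ⟨N, hge⟩)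
  rw [norm_zero] at this
  exact hne (norm_le_zero_iff.1 this)

/-! ### Holomorphy of Euler-type integrals -/

namespace StandardForm

variable {d n m r : ℕ} {A : Matrix (Fin d) (Fin n) ℤ}

/-- The modulus `|w ^ α_j|` of the `j`-th monomial at the point of the orthant with logarithmic
coordinate `u`. -/
noncomputable def weight (S : StandardForm A m r) (j : Fin n) (u : Fin r → ℝ) : ℝ :=
  Real.exp (∑ k, (S.expo j k : ℝ) * u k)

/-- The value of `f_i` on the positive orthant. -/
noncomputable def orthantPoly (S : StandardForm A m r) (i : Fin m) (x : Fin n → ℂ)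
    (u : Fin r → ℝ) : ℂ :=
  ∑ j, if S.block j = i then x j * (S.weight j u : ℂ) else 0

/-- The value on the positive orthant of the polynomial with the exponents of `f_i` and all
coefficients equal to `1`. -/
noncomputable def envelope (S : StandardForm A m r) (i : Fin m) (u : Fin r → ℝ) : ℝ :=
  ∑ j, if S.block j = i then S.weight j u else 0

/-- `f_i(w)` as a linear form in the coefficients. -/
noncomputable def orthantPolyCLM (S : StandardForm A m r) (i : Fin m) (u : Fin r → ℝ) :
    (Fin n → ℂ) →L[ℂ] ℂ :=
  ∑ j, if S.block j = i then (S.weight j u : ℂ) • ContinuousLinearMap.proj j else 0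

/-- The open set of coefficients for which, stably under small perturbations, no `f_i` takes a value
in `(-∞, 0]` on the positive orthant. There the principal branch of the logarithm can be used for
all the `f_i`. -/
def admissible (S : StandardForm A m r) : Set (Fin n → ℂ) :=
  interior {x | ∀ i u, S.orthantPoly i x u ∈ Complex.slitPlane}

/-- The integrand of the Euler-type integral over the positive orthant, formed with the principal
branches of the powers. -/
noncomputable def kernel (S : StandardForm A m r) (b : Fin m ⊕ Fin r → ℂ) (x : Fin n → ℂ)
    (u : Fin r → ℝ) : ℂ :=
  Complex.exp (-∑ k, b (Sum.inr k) * (u k : ℂ) +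
    ∑ i, b (Sum.inl i) * Complex.log (S.orthantPoly i x u))

/-- A positive function which bounds the modulus of the integrand from both sides, up to constants
that are locally uniform in the coefficients. -/
noncomputable def kernelBound (S : StandardForm A m r) (b : Fin m ⊕ Fin r → ℂ)
    (u : Fin r → ℝ) : ℝ :=
  Real.exp (-∑ k, (b (Sum.inr k)).re * u k +
    ∑ i, (b (Sum.inl i)).re * Real.log (S.envelope i u))

/-- The Euler-type integral over the positive orthant as a function of the coefficients. -/
noncomputable def eulerIntegral (S : StandardForm A m r) (b : Fin m ⊕ Fin r → ℂ)
    (x : Fin n → ℂ) : ℂ :=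
  ∫ u, S.kernel b x u

variable (S : StandardForm A m r)

theorem weight_pos (j : Fin n) (u : Fin r → ℝ) : 0 < S.weight j u := Real.exp_pos _

theorem continuous_weight (j : Fin n) : Continuous (S.weight j) := by
  unfold weight
  fun_prop

theorem orthantPolyCLM_apply (i : Fin m) (x : Fin n → ℂ) (u : Fin r → ℝ) :
    S.orthantPolyCLM i u x = S.orthantPoly i x u := by
  simp only [orthantPolyCLM, orthantPoly, sum_apply]
  refine Finset.sum_congr rfl fun j _ => ?_
  split_ifs <;> simp [mul_comm]

theorem continuous_orthantPolyCLM (i : Fin m) : Continuous (S.orthantPolyCLM i) := by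
  unfold orthantPolyCLM
  refine continuous_finsetSum _ fun j _ => ?_
  have := S.continuous_weight j
  split_ifs <;> fun_prop

theorem continuous_orthantPoly (i : Fin m) :
    Continuous fun p : (Fin n → ℂ) × (Fin r → ℝ) => S.orthantPoly i p.1 p.2 := by
  unfold orthantPoly
  refine continuous_finsetSum _ fun j _ => ?_
  have := S.continuous_weight j
  split_ifs <;> fun_prop

theorem norm_orthantPoly_le (i : Fin m) (x : Fin n → ℂ) (u : Fin r → ℝ) :
    ‖S.orthantPoly i x u‖ ≤ ‖x‖ * S.envelope i u := by
  unfold orthantPoly envelope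
  rw [Finset.mul_sum]
  refine norm_sum_le_of_le _ fun j _ => ?_
  split_ifs
  · rw [norm_mul, Complex.norm_real, Real.norm_of_nonneg (S.weight_pos j u).le]
    exact mul_le_mul_of_nonneg_right (norm_le_pi_norm x j) (S.weight_pos j u).le
  · simp

theorem norm_orthantPolyCLM_le (i : Fin m) (u : Fin r → ℝ) :
    ‖S.orthantPolyCLM i u‖ ≤ S.envelope i u := by
  refine ContinuousLinearMap.opNorm_le_bound _ ?_ fun x => ?_
  · exact Finset.sum_nonneg fun j _ => by
      split_ifs
      exacts [(S.weight_pos j u).le, le_rfl]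
  · rw [orthantPolyCLM_apply, mul_comm]
    exact S.norm_orthantPoly_le i x u

/-- If `f_i` has no zero on the orthant for all coefficients at distance less than `δ` from `x`,
then `|f_i|` is at least `δ` times each monomial of `f_i`: otherwise a small change of the
coefficient of this monomial would produce a zero. -/
theorem mul_weight_le_norm_orthantPoly {i : Fin m} {x : Fin n → ℂ} {δ : ℝ} {u : Fin r → ℝ}
    (h : ∀ y ∈ Metric.ball x δ, S.orthantPoly i y u ≠ 0) {j : Fin n} (hj : S.block j = i) :
    δ * S.weight j u ≤ ‖S.orthantPoly i x u‖ := by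
  by_contra! hlt
  have hw := S.weight_pos j u
  set v := S.orthantPoly i x u with hv
  have hwc : (S.weight j u : ℂ) ≠ 0 := by exact_mod_cast hw.ne'
  refine h (x - Pi.single j (v / (S.weight j u : ℂ))) ?_ ?_
  · rw [Metric.mem_ball, dist_eq_norm, sub_sub_cancel_left, norm_neg, Pi.norm_single, norm_div,
      Complex.norm_real, Real.norm_of_nonneg hw.le, div_lt_iff₀ hw]
    exact hlt
  · rw [← orthantPolyCLM_apply, map_sub, orthantPolyCLM_apply, orthantPolyCLM_apply, ← hv,
      sub_eq_zero, orthantPoly, Finset.sum_eq_single j]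
    · simp [hj, div_mul_cancel₀ _ hwc]
    · intro k _ hk
      simp [Pi.single_eq_of_ne hk]
    · simp

theorem mul_envelope_le_norm_orthantPoly {i : Fin m} {x : Fin n → ℂ} {δ : ℝ} {u : Fin r → ℝ}
    (h : ∀ y ∈ Metric.ball x δ, S.orthantPoly i y u ≠ 0) :
    δ * S.envelope i u ≤ n * ‖S.orthantPoly i x u‖ := by
  unfold envelope
  rw [Finset.mul_sum]
  calc _ ≤ ∑ _j : Fin n, ‖S.orthantPoly i x u‖ := Finset.sum_le_sum fun j _ => by
        split_ifs with hj
        · exact S.mul_weight_le_norm_orthantPoly h hj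
        · simp
    _ = _ := by simp

/-- On the admissible set `|f_i|` is comparable with the envelope, locally uniformly in the
coefficients and uniformly on the orthant. -/
theorem exists_envelope_comparison {x : Fin n → ℂ} (hx : x ∈ S.admissible) :
    ∃ C : ℝ, 1 ≤ C ∧ ∀ᶠ y in 𝓝 x, ∀ i u, S.orthantPoly i y u ∈ Complex.slitPlane ∧
      S.envelope i u ≤ C * ‖S.orthantPoly i y u‖ ∧
      ‖S.orthantPoly i y u‖ ≤ C * S.envelope i u := by
  obtain ⟨ε, hε, hball⟩ := Metric.mem_nhds_iff.1 (mem_interior_iff_mem_nhds.1 hx)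
  refine ⟨1 + n / (ε / 2) + (‖x‖ + ε), ?_, ?_⟩
  · have : 0 ≤ (n : ℝ) / (ε / 2) := by positivity
    have := norm_nonneg x
    linarith
  · filter_upwards [Metric.ball_mem_nhds x (half_pos hε)] with y hy i u
    have hsub : ∀ z ∈ Metric.ball y (ε / 2), z ∈ Metric.ball x ε := by
      intro z hz
      rw [Metric.mem_ball] at *
      linarith [dist_triangle z y x]
    have henv : 0 ≤ S.envelope i u := (norm_nonneg _).trans (S.norm_orthantPolyCLM_le i u)
    refine ⟨hball (hsub y (Metric.mem_ball_self (half_pos hε))) i u, ?_, ?_⟩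
    · have h := S.mul_envelope_le_norm_orthantPoly (i := i) (x := y) (δ := ε / 2) (u := u)
        fun z hz => Complex.slitPlane_ne_zero (hball (hsub z hz) i u)
      have h2 : S.envelope i u ≤ n / (ε / 2) * ‖S.orthantPoly i y u‖ := by
        rw [div_mul_eq_mul_div, le_div_iff₀ (half_pos hε)]
        linarith
      have h3 : 0 ≤ (1 + (‖x‖ + ε)) * ‖S.orthantPoly i y u‖ := by positivity
      linarith
    · have h := S.norm_orthantPoly_le i y u
      have hyx : ‖y‖ ≤ ‖x‖ + ε := by
        have := norm_le_norm_add_norm_sub' y x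
        rw [Metric.mem_ball, dist_eq_norm] at hy
        linarith
      have h2 := mul_le_mul_of_nonneg_right hyx henv
      have h3 : 0 ≤ (1 + n / (ε / 2)) * S.envelope i u := by positivity
      linarith

theorem exists_kernel_comparison (b : Fin m ⊕ Fin r → ℂ) {x : Fin n → ℂ}
    (hx : x ∈ S.admissible) :
    ∃ C : ℝ, 0 < C ∧ ∀ᶠ y in 𝓝 x, ∀ u,
      ‖S.kernel b y u‖ ≤ C * S.kernelBound b u ∧ S.kernelBound b u ≤ C * ‖S.kernel b y u‖ := by
  obtain ⟨C, hC, h⟩ := S.exists_envelope_comparison hx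
  have hC0 : 0 < C := by linarith
  set D : ℝ := ∑ i, (|(b (Sum.inl i)).re| * Real.log C + |(b (Sum.inl i)).im| * Real.pi) with hD
  refine ⟨Real.exp D, Real.exp_pos _, ?_⟩
  filter_upwards [h] with y hy u
  have hdiff : |∑ i, ((b (Sum.inl i)) * Complex.log (S.orthantPoly i y u)).re -
      ∑ i, (b (Sum.inl i)).re * Real.log (S.envelope i u)| ≤ D := by
    rw [← Finset.sum_sub_distrib, hD]
    refine (Finset.abs_sum_le_sum_abs _ _).trans (Finset.sum_le_sum fun i _ => ?_)
    obtain ⟨h1, h2, h3⟩ := hy i u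
    have hp : 0 < ‖S.orthantPoly i y u‖ := norm_pos_iff.2 (Complex.slitPlane_ne_zero h1)
    have he : 0 < S.envelope i u := by
      by_contra hcon
      have := mul_nonneg hC0.le (neg_nonneg.2 (not_lt.1 hcon))
      linarith
    have l1 := Real.log_le_log he h2
    have l2 := Real.log_le_log hp h3
    rw [Real.log_mul hC0.ne' hp.ne'] at l1
    rw [Real.log_mul hC0.ne' he.ne'] at l2
    have habs : |Real.log ‖S.orthantPoly i y u‖ - Real.log (S.envelope i u)| ≤ Real.log C := by
      rw [abs_le]
      constructor <;> linarith
    rw [Complex.mul_re, Complex.log_re, Complex.log_im]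
    calc _ = |(b (Sum.inl i)).re *
            (Real.log ‖S.orthantPoly i y u‖ - Real.log (S.envelope i u)) -
            (b (Sum.inl i)).im * Complex.arg (S.orthantPoly i y u)| := by ring_nf
      _ ≤ |(b (Sum.inl i)).re| * |Real.log ‖S.orthantPoly i y u‖ - Real.log (S.envelope i u)| +
            |(b (Sum.inl i)).im| * |Complex.arg (S.orthantPoly i y u)| := by
          rw [← abs_mul, ← abs_mul]
          exact abs_sub _ _
      _ ≤ _ := by
          gcongr
          exact Complex.abs_arg_le_pi _
  have hre : ‖S.kernel b y u‖ = Real.exp (-∑ k, (b (Sum.inr k)).re * u k +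
      ∑ i, ((b (Sum.inl i)) * Complex.log (S.orthantPoly i y u)).re) := by
    rw [kernel, Complex.norm_exp, Complex.add_re, Complex.neg_re, Complex.re_sum, Complex.re_sum]
    simp
  rw [abs_le] at hdiff
  rw [hre, kernelBound, ← Real.exp_add, ← Real.exp_add, Real.exp_le_exp, Real.exp_le_exp]
  constructor <;> linarith [hdiff.1, hdiff.2]

theorem continuous_kernel (b : Fin m ⊕ Fin r → ℂ) {x : Fin n → ℂ}
    (hx : ∀ i u, S.orthantPoly i x u ∈ Complex.slitPlane) : Continuous (S.kernel b x) := by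
  unfold kernel
  have h : ∀ i, Continuous fun u => Complex.log (S.orthantPoly i x u) := fun i =>
    ((S.continuous_orthantPoly i).comp (Continuous.prodMk_right x)).clog (hx i)
  fun_prop

theorem measurable_kernelBound (b : Fin m ⊕ Fin r → ℂ) : Measurable (S.kernelBound b) := by
  have : ∀ i, Measurable (S.envelope i) := by
    intro i
    unfold envelope
    refine Finset.measurable_sum _ fun j _ => ?_
    have := (S.continuous_weight j).measurable
    split_ifs <;> fun_prop
  unfold kernelBound
  fun_prop

theorem integrable_kernelBound (b : Fin m ⊕ Fin r → ℂ) {x : Fin n → ℂ} (hx : x ∈ S.admissible)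
    (hint : MeasureTheory.Integrable (S.kernel b x)) :
    MeasureTheory.Integrable (S.kernelBound b) := by
  obtain ⟨C, hC, h⟩ := S.exists_kernel_comparison b hx
  refine (hint.norm.const_mul C).mono' (S.measurable_kernelBound b).aestronglyMeasurable ?_
  refine Filter.Eventually.of_forall fun u => ?_
  rw [Real.norm_of_nonneg (show 0 ≤ S.kernelBound b u from (Real.exp_pos _).le)]
  exact (h.self_of_nhds u).2

theorem hasFDerivAt_kernel (b : Fin m ⊕ Fin r → ℂ) {x : Fin n → ℂ} {u : Fin r → ℝ}
    (hx : ∀ i, S.orthantPoly i x u ∈ Complex.slitPlane) :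
    HasFDerivAt (fun y => S.kernel b y u) (S.kernel b x u •
      ∑ i, (b (Sum.inl i) * (S.orthantPoly i x u)⁻¹) • S.orthantPolyCLM i u) x := by
  have hP : ∀ i, HasFDerivAt (fun y => S.orthantPoly i y u) (S.orthantPolyCLM i u) x := by
    intro i
    simp only [← orthantPolyCLM_apply]
    exact (S.orthantPolyCLM i u).hasFDerivAt
  have hsum : HasFDerivAt
      (fun y => ∑ i, b (Sum.inl i) * Complex.log (S.orthantPoly i y u))
      (∑ i, (b (Sum.inl i) * (S.orthantPoly i x u)⁻¹) • S.orthantPolyCLM i u) x := by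
    refine HasFDerivAt.fun_sum fun i _ => ?_
    have := ((hP i).clog (hx i)).const_mul (b (Sum.inl i))
    simpa only [smul_smul] using this
  exact (hsum.const_add _).cexp

/-- If the Euler-type integral converges absolutely at one admissible point, then it is a
holomorphic function of the coefficients on the whole admissible set. -/
theorem differentiableAt_eulerIntegral (b : Fin m ⊕ Fin r → ℂ) {x₀ x : Fin n → ℂ}
    (hx₀ : x₀ ∈ S.admissible) (hint : MeasureTheory.Integrable (S.kernel b x₀))
    (hx : x ∈ S.admissible) : DifferentiableAt ℂ (S.eulerIntegral b) x := by
  have hW := S.integrable_kernelBound b hx₀ hint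
  obtain ⟨C, hC, hcmp⟩ := S.exists_kernel_comparison b hx
  obtain ⟨D, hD, henv⟩ := S.exists_envelope_comparison hx
  have hself := henv.self_of_nhds
  have hcont := S.continuous_kernel b fun i u => (hself i u).1
  have hcontP : ∀ i, Continuous fun u => S.orthantPoly i x u := fun i =>
    (S.continuous_orthantPoly i).comp (Continuous.prodMk_right x)
  refine (hasFDerivAt_integral_of_dominated_of_fderiv_le (𝕜 := ℂ)
    (F' := fun y u => S.kernel b y u •
      ∑ i, (b (Sum.inl i) * (S.orthantPoly i y u)⁻¹) • S.orthantPolyCLM i u)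
    (bound := fun u => C * S.kernelBound b u * ∑ i, ‖b (Sum.inl i)‖ * D)
    (hcmp.and henv) ?_ ?_ ?_ ?_ ?_ ?_).differentiableAt
  · filter_upwards [henv] with y hy
    exact (S.continuous_kernel b fun i u => (hy i u).1).aestronglyMeasurable
  · exact (hW.const_mul C).mono' hcont.aestronglyMeasurable
      (Filter.Eventually.of_forall fun u => (hcmp.self_of_nhds u).1)
  · refine Continuous.aestronglyMeasurable (hcont.smul (continuous_finsetSum _ fun i _ => ?_))
    exact (continuous_const.mul ((hcontP i).inv₀ fun u =>
      Complex.slitPlane_ne_zero (hself i u).1)).smul (S.continuous_orthantPolyCLM i)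
  · refine Filter.Eventually.of_forall fun u y hy => ?_
    rw [norm_smul]
    refine mul_le_mul (hy.1 u).1 (norm_sum_le_of_le _ fun i _ => ?_) (norm_nonneg _)
      (mul_nonneg hC.le (Real.exp_pos _).le)
    obtain ⟨h1, h2, -⟩ := hy.2 i u
    have hp : 0 < ‖S.orthantPoly i y u‖ := norm_pos_iff.2 (Complex.slitPlane_ne_zero h1)
    rw [norm_smul, norm_mul, norm_inv, mul_assoc]
    refine mul_le_mul_of_nonneg_left ?_ (norm_nonneg _)
    rw [inv_mul_le_iff₀ hp, mul_comm]
    exact (S.norm_orthantPolyCLM_le i u).trans h2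
  · exact (hW.const_mul C).mul_const _
  · exact Filter.Eventually.of_forall fun u y hy =>
      S.hasFDerivAt_kernel b fun i => (hy.2 i u).1

end StandardForm

/-! ### Block forms of the matrix of Appell's system -/

/-- The vertices of the octahedron spanned by the columns of `appellMatrix`, as three pairs of
antipodal vertices. -/
def vertex (k : Fin 3) (σ : Bool) : Fin 6 :=
  if σ then ![0, 1, 2] k else ![3, 4, 5] k

theorem exists_eq_vertex (j : Fin 6) : ∃ k σ, j = vertex k σ := by
  revert j
  decide

theorem vertex_eq_vertex_iff {k k' : Fin 3} {σ σ' : Bool} :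
    vertex k σ = vertex k' σ' ↔ k = k' ∧ σ = σ' := by
  revert k k' σ σ'
  decide

theorem sum_eq_sum_vertex {M : Type*} [AddCommMonoid M] (f : Fin 6 → M) :
    ∑ j, f j = ∑ k, (f (vertex k true) + f (vertex k false)) := by
  simp only [Fin.sum_univ_six, Fin.sum_univ_three, vertex]
  simp only [if_true, Bool.false_eq_true, if_false, Matrix.cons_val]
  abel

/-- A sum over the vertices of the octahedron, with coefficients `X`, in which the members of the
`k`-th antipodal pair have the reciprocal weights `e^{±τ k}`. -/
noncomputable def pairSum (X : Fin 3 → Bool → ℂ) (τ : Fin 3 → ℝ) : ℂ :=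
  ∑ k, (X k true * (Real.exp (τ k) : ℂ) + X k false * (Real.exp (-τ k) : ℂ))

namespace StandardForm

variable {m r : ℕ} (S : StandardForm appellMatrix m r)

theorem toMat_mul_col (i : Fin m ⊕ Fin r) (j : Fin 6) :
    S.toMat i 0 * appellMatrix 0 j + S.toMat i 1 * appellMatrix 1 j +
      S.toMat i 2 * appellMatrix 2 j + S.toMat i 3 * appellMatrix 3 j =
      blockMatrix S.block S.expo i j := by
  rw [← S.toMat_mul, Matrix.mul_apply, Fin.sum_univ_four]

/-- Antipodal vertices have the same midpoint: the sum of two antipodal columns of any matrix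
`g * A` does not depend on the pair. -/
theorem blockMatrix_vertex_add (i : Fin m ⊕ Fin r) (k l : Fin 3) :
    blockMatrix S.block S.expo i (vertex k true) + blockMatrix S.block S.expo i (vertex k false) =
      blockMatrix S.block S.expo i (vertex l true) +
        blockMatrix S.block S.expo i (vertex l false) := by
  have key : ∀ k : Fin 3, blockMatrix S.block S.expo i (vertex k true) +
      blockMatrix S.block S.expo i (vertex k false) = 2 * S.toMat i 0 + S.toMat i 1 := by
    intro k
    simp only [← S.toMat_mul_col]
    fin_cases k <;> simp [vertex, appellMatrix] <;> ring
  rw [key, key]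

theorem expo_vertex_add (k l : Fin 3) (i : Fin r) :
    S.expo (vertex k true) i + S.expo (vertex k false) i =
      S.expo (vertex l true) i + S.expo (vertex l false) i :=
  S.blockMatrix_vertex_add (Sum.inr i) k l

theorem indicator_block_vertex_add (k l : Fin 3) (i : Fin m) :
    (if S.block (vertex k true) = i then (1 : ℤ) else 0) +
        (if S.block (vertex k false) = i then 1 else 0) =
      (if S.block (vertex l true) = i then 1 else 0) +
        (if S.block (vertex l false) = i then 1 else 0) :=
  S.blockMatrix_vertex_add (Sum.inl i) k l

/-- Either there is only one block containing columns, or the blocks are two antipodal facets of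
the octahedron. -/
theorem block_dichotomy :
    (∀ j j', S.block j = S.block j') ∨ ∀ k, S.block (vertex k true) ≠ S.block (vertex k false) := by
  by_cases h : ∀ k, S.block (vertex k true) ≠ S.block (vertex k false)
  · exact Or.inr h
  · left
    push Not at h
    obtain ⟨k, hk⟩ := h
    have key : ∀ j, S.block j = S.block (vertex k true) := by
      intro j
      obtain ⟨l, σ, rfl⟩ := exists_eq_vertex j
      have := S.indicator_block_vertex_add k l (S.block (vertex k true))
      rw [if_pos rfl, if_pos hk.symm] at this
      by_contra hne
      cases σ
      · rw [if_neg hne] at this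
        split_ifs at this <;> omega
      · rw [if_neg hne] at this
        split_ifs at this <;> omega
    intro j j'
    rw [key j, key j']

/-- A block which contains a vertex meets every antipodal pair. -/
theorem exists_block_vertex_eq (j : Fin 6) (k : Fin 3) :
    ∃ σ, S.block (vertex k σ) = S.block j := by
  obtain ⟨l, σ, rfl⟩ := exists_eq_vertex j
  have := S.indicator_block_vertex_add k l (S.block (vertex l σ))
  by_contra! hne
  rw [if_neg (hne true), if_neg (hne false)] at this
  cases σ <;> simp at this <;> split_ifs at this <;> omega

/-- Since `g` is invertible, the torus acts on the monomials of the `f_i`, up to a common factor for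
each block, by arbitrary reciprocal positive factors on the three antipodal pairs. -/
theorem exists_weight_vertex (τ : Fin 3 → ℝ) : ∃ (ρ : Fin m → ℝ) (u : Fin r → ℝ), ∀ k σ,
    S.weight (vertex k σ) u =
      Real.exp (ρ (S.block (vertex k σ))) * Real.exp (if σ then τ k else -τ k) := by
  -- The linear form `v` takes the values `± τ k` on the columns of the matrix.
  set v : Fin 4 → ℝ := ![-τ 0, 2 * τ 0, τ 1 - τ 0, τ 2 - τ 0] with hv
  set c : Fin m ⊕ Fin r → ℝ := fun i => ∑ l, v l * (S.invMat l i : ℝ) with hc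
  have hcol : ∀ j, ∑ i, c i * (blockMatrix S.block S.expo i j : ℝ) =
      ∑ l, v l * (appellMatrix l j : ℝ) := by
    intro j
    have hA : appellMatrix = S.invMat * blockMatrix S.block S.expo := by
      rw [← S.toMat_mul, ← Matrix.mul_assoc, S.invMat_mul_toMat, Matrix.one_mul]
    have hentry : ∀ l, (appellMatrix l j : ℝ) =
        ∑ i, (S.invMat l i : ℝ) * (blockMatrix S.block S.expo i j : ℝ) := by
      intro l
      conv_lhs => rw [hA]
      rw [Matrix.mul_apply]
      push_cast
      rfl
    simp only [hentry, hc, Finset.sum_mul, Finset.mul_sum]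
    rw [Finset.sum_comm]
    simp only [mul_assoc]
  refine ⟨fun i => -c (Sum.inl i), fun k => c (Sum.inr k), fun k σ => ?_⟩
  have h := hcol (vertex k σ)
  rw [Fintype.sum_sum_type] at h
  have h1 : ∑ i, c (Sum.inl i) * (blockMatrix S.block S.expo (Sum.inl i) (vertex k σ) : ℝ) =
      c (Sum.inl (S.block (vertex k σ))) := by
    rw [Finset.sum_eq_single (S.block (vertex k σ))]
    · simp [blockMatrix]
    · intro i _ hi
      simp [blockMatrix, hi.symm]
    · simp
  have h2 : ∑ i, c (Sum.inr i) * (blockMatrix S.block S.expo (Sum.inr i) (vertex k σ) : ℝ) =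
      ∑ i, (S.expo (vertex k σ) i : ℝ) * c (Sum.inr i) := by
    simp [blockMatrix, mul_comm]
  have h3 : ∑ l, v l * (appellMatrix l (vertex k σ) : ℝ) = if σ then τ k else -τ k := by
    rw [Fin.sum_univ_four, hv]
    fin_cases k <;> cases σ <;> simp [vertex, appellMatrix] <;> ring
  rw [h1, h2, h3] at h
  rw [weight, ← Real.exp_add, ← h]
  congr 1
  ring

/-- The coefficient of the vertex `(k, σ)` in `f_i`, zero if it does not belong to the block. -/
noncomputable def vertexCoeff (i : Fin m) (x : Fin 6 → ℂ) (k : Fin 3) (σ : Bool) : ℂ :=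
  if S.block (vertex k σ) = i then x (vertex k σ) else 0

theorem exists_orthantPoly_eq (τ : Fin 3 → ℝ) : ∃ (ρ : Fin m → ℝ) (u : Fin r → ℝ),
    (∀ k σ, S.weight (vertex k σ) u =
      Real.exp (ρ (S.block (vertex k σ))) * Real.exp (if σ then τ k else -τ k)) ∧
    ∀ i x, S.orthantPoly i x u = (Real.exp (ρ i) : ℂ) *
      pairSum (S.vertexCoeff i x) τ := by
  obtain ⟨ρ, u, h⟩ := S.exists_weight_vertex τ
  refine ⟨ρ, u, h, fun i x => ?_⟩
  rw [orthantPoly, sum_eq_sum_vertex, pairSum, Finset.mul_sum]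
  refine Finset.sum_congr rfl fun k _ => ?_
  rw [h k true, h k false, vertexCoeff, vertexCoeff, mul_add, if_pos rfl,
    if_neg Bool.false_ne_true]
  congr 1
  · by_cases hb : S.block (vertex k true) = i
    · rw [if_pos hb, if_pos hb, hb]
      push_cast
      ring
    · rw [if_neg hb, if_neg hb]
      ring
  · by_cases hb : S.block (vertex k false) = i
    · rw [if_pos hb, if_pos hb, hb]
      push_cast
      ring
    · rw [if_neg hb, if_neg hb]
      ring

/-- When all vertices lie in one block, every value of its polynomial is, up to a positive factor,
the sum over the antipodal pairs with reciprocal positive weights. -/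
theorem orthantPoly_eq_of_block_eq (h : ∀ j j', S.block j = S.block j') {i : Fin m}
    (hi : ∃ j, S.block j = i) (u : Fin r → ℝ) : ∃ (ρ : ℝ) (τ : Fin 3 → ℝ), ∀ x : Fin 6 → ℂ,
    S.orthantPoly i x u = (Real.exp ρ : ℂ) *
      pairSum (fun k σ => x (vertex k σ)) τ := by
  set e : Fin 6 → ℝ := fun j => ∑ k, (S.expo j k : ℝ) * u k with he
  have hadd : ∀ k l, e (vertex k true) + e (vertex k false) =
      e (vertex l true) + e (vertex l false) := by
    intro k l
    simp only [he, ← Finset.sum_add_distrib, ← add_mul]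
    refine Finset.sum_congr rfl fun i _ => ?_
    have := S.expo_vertex_add k l i
    rw [← Int.cast_add, this, Int.cast_add]
  have hb : ∀ j, S.block j = i := by
    obtain ⟨j, hj⟩ := hi
    intro j'
    rw [h j' j, hj]
  refine ⟨(e (vertex 0 true) + e (vertex 0 false)) / 2,
    fun k => (e (vertex k true) - e (vertex k false)) / 2, fun x => ?_⟩
  rw [orthantPoly, sum_eq_sum_vertex, pairSum, Finset.mul_sum]
  refine Finset.sum_congr rfl fun k _ => ?_
  rw [if_pos (hb _), if_pos (hb _), hadd 0 k, weight, weight, mul_add, mul_left_comm,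
    mul_left_comm _ (x (vertex k false)), ← Complex.ofReal_mul, ← Complex.ofReal_mul,
    ← Real.exp_add, ← Real.exp_add]
  congr 4 <;> ring

end StandardForm

/-! ### Half-planes and sectors -/

/-- Let `pairSum X τ` be bounded from below by `δ` times one of its six weights. When the selected
members of the three pairs dominate, this becomes the same bound for the combinations of these
members with nonnegative coefficients. -/
theorem mul_le_norm_sum_selection {X : Fin 3 → Bool → ℂ} {δ : ℝ} {k₀ : Fin 3} {sel : Fin 3 → Bool}
    (h : ∀ τ : Fin 3 → ℝ, δ * Real.exp (if sel k₀ then τ k₀ else -τ k₀) ≤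
      ‖pairSum X τ‖)
    {s : Fin 3 → ℝ} (hs : ∀ k, 0 ≤ s k) :
    δ * s k₀ ≤ ‖∑ k, (s k : ℂ) * X k (sel k)‖ := by
  -- First the case of positive coefficients, with the opposite members scaled down by `ε`.
  have hpos : ∀ s : Fin 3 → ℝ, (∀ k, 0 < s k) → ∀ ε : ℝ, 0 < ε → δ * s k₀ ≤
      ‖∑ k, ((s k : ℂ) * X k (sel k) + (ε : ℂ) * (s k : ℂ)⁻¹ * X k (!sel k))‖ := by
    intro s hs ε hε
    set T : ℝ := Real.sqrt ε with hT
    have hT0 : 0 < T := Real.sqrt_pos.2 hε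
    have hTT : T * T = ε := Real.mul_self_sqrt hε.le
    have hTc : (T : ℂ) ≠ 0 := by exact_mod_cast hT0.ne'
    have hsc : ∀ k, (s k : ℂ) ≠ 0 := fun k => by exact_mod_cast (hs k).ne'
    have hlog : ∀ k, Real.exp (Real.log (s k / T)) = s k / T := fun k =>
      Real.exp_log (div_pos (hs k) hT0)
    have hlog' : ∀ k, Real.exp (-Real.log (s k / T)) = (s k / T)⁻¹ := fun k => by
      rw [Real.exp_neg, hlog]
    have h1 := h fun k => if sel k then Real.log (s k / T) else -Real.log (s k / T)
    have e1 : Real.exp (if sel k₀ then (if sel k₀ then Real.log (s k₀ / T)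
        else -Real.log (s k₀ / T)) else -(if sel k₀ then Real.log (s k₀ / T)
        else -Real.log (s k₀ / T))) = s k₀ / T := by
      cases sel k₀ <;> simp [hlog]
    have e2 : ∑ k, (X k true * (Real.exp (if sel k then Real.log (s k / T)
          else -Real.log (s k / T)) : ℂ) +
        X k false * (Real.exp (-(if sel k then Real.log (s k / T)
          else -Real.log (s k / T))) : ℂ)) = (T : ℂ)⁻¹ *
        ∑ k, ((s k : ℂ) * X k (sel k) + (ε : ℂ) * (s k : ℂ)⁻¹ * X k (!sel k)) := by
      rw [Finset.mul_sum]
      refine Finset.sum_congr rfl fun k _ => ?_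
      have := hsc k
      rw [← hTT]
      cases hk : sel k
      · simp only [Bool.false_eq_true, if_false, neg_neg, hlog, hlog', Bool.not_false]
        push_cast
        field_simp
        ring
      · simp only [if_true, hlog, hlog', Bool.not_true]
        push_cast
        field_simp
    rw [pairSum, e1, e2, norm_mul, norm_inv, Complex.norm_real, Real.norm_of_nonneg hT0.le] at h1
    rw [← mul_div_assoc, div_eq_inv_mul] at h1
    exact le_of_mul_le_mul_left h1 (inv_pos.2 hT0)
  have hpos' : ∀ s : Fin 3 → ℝ, (∀ k, 0 < s k) → δ * s k₀ ≤ ‖∑ k, (s k : ℂ) * X k (sel k)‖ := by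
    intro s hs
    have hc : Tendsto (fun ε : ℝ =>
        ‖∑ k, ((s k : ℂ) * X k (sel k) + (ε : ℂ) * (s k : ℂ)⁻¹ * X k (!sel k))‖) (𝓝[>] 0)
        (𝓝 ‖∑ k, ((s k : ℂ) * X k (sel k) + ((0 : ℝ) : ℂ) * (s k : ℂ)⁻¹ * X k (!sel k))‖) :=
      (Continuous.tendsto (by fun_prop) 0).mono_left nhdsWithin_le_nhds
    have := ge_of_tendsto hc (eventually_mem_nhdsWithin.mono fun ε hε => hpos s hs ε hε)
    simpa using this
  have hc : Tendsto (fun η : ℝ => ‖∑ k, ((s k + η : ℝ) : ℂ) * X k (sel k)‖ - δ * (s k₀ + η))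
      (𝓝[>] 0) (𝓝 (‖∑ k, ((s k + 0 : ℝ) : ℂ) * X k (sel k)‖ - δ * (s k₀ + 0))) :=
    (Continuous.tendsto (by fun_prop) 0).mono_left nhdsWithin_le_nhds
  have := ge_of_tendsto hc (eventually_mem_nhdsWithin.mono fun η hη =>
    sub_nonneg.2 (hpos' (fun k => s k + η) fun k => add_pos_of_nonneg_of_pos (hs k) hη))
  simpa using this

/-- Finitely many complex numbers whose convex hull does not contain `0` lie in an open half-plane
through `0`. -/
theorem exists_rotation_re_pos {s : Set ℂ} (hs : s.Finite) (h : (0 : ℂ) ∉ convexHull ℝ s) :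
    ∃ ψ : ℝ, ∀ z ∈ s, 0 < (z * Complex.exp (ψ * Complex.I)).re := by
  obtain ⟨f, c, hc0, hc⟩ := geometric_hahn_banach_point_closed (E := ℂ) (convex_convexHull ℝ s)
    (hs.isClosed_convexHull ℝ) h
  rw [map_zero] at hc0
  set w : ℂ := ⟨f 1, -f Complex.I⟩ with hw
  have hf : ∀ z : ℂ, f z = (z * w).re := by
    intro z
    have hz : z = z.re • (1 : ℂ) + z.im • Complex.I := by
      apply Complex.ext <;> simp
    conv_lhs => rw [hz]
    rw [map_add, map_smul, map_smul, Complex.mul_re]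
    simp [hw]
  refine ⟨w.arg, fun z hz => ?_⟩
  have h1 := hc z (subset_convexHull ℝ s hz)
  rw [hf] at h1
  have h2 : z * w = (‖w‖ : ℂ) * (z * Complex.exp (w.arg * Complex.I)) := by
    conv_lhs => rw [← Complex.norm_mul_exp_arg_mul_I w]
    ring
  rw [h2, Complex.re_ofReal_mul] at h1
  exact pos_of_mul_pos_right (hc0.trans h1) (norm_nonneg w)

/-- The open sector of half-opening `α` around the positive real axis, intersected with the right
half-plane. -/
def openSector (α : ℝ) : Set ℂ := {z | 0 < z.re ∧ |z.im| * Real.cos α < z.re * Real.sin α}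

theorem abs_arg_lt_of_mem_openSector {α : ℝ} (hα₀ : 0 < α) (hα : α ≤ Real.pi / 2) {z : ℂ}
    (hz : z ∈ openSector α) : |z.arg| < α := by
  obtain ⟨h1, h2⟩ := hz
  have hlt := abs_lt.1 (Complex.abs_arg_lt_pi_div_two_iff.2 (Or.inl h1))
  have hn : 0 < ‖z‖ := norm_pos_iff.2 fun h => by simp [h] at h1
  have hcos : 0 ≤ Real.cos α := Real.cos_nonneg_of_mem_Icc ⟨by linarith, hα⟩
  have hre := Complex.norm_mul_cos_arg z
  have him := Complex.norm_mul_sin_arg z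
  have hpi := Real.pi_pos
  have hbound := abs_le.1 (le_refl |z.im|)
  have l1 : 0 < Real.sin (α + z.arg) := by
    rw [Real.sin_add]
    refine pos_of_mul_pos_right (a := ‖z‖) ?_ hn.le
    have := mul_le_mul_of_nonneg_right (neg_abs_le z.im) hcos
    calc 0 < z.re * Real.sin α + z.im * Real.cos α := by linarith
      _ = _ := by rw [← hre, ← him]; ring
  have l2 : 0 < Real.sin (α - z.arg) := by
    rw [Real.sin_sub]
    refine pos_of_mul_pos_right (a := ‖z‖) ?_ hn.le
    have := mul_le_mul_of_nonneg_right (le_abs_self z.im) hcos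
    calc 0 < z.re * Real.sin α - z.im * Real.cos α := by linarith
      _ = _ := by rw [← hre, ← him]; ring
  rw [abs_lt]
  constructor
  · by_contra! hcon
    exact absurd l1 (not_lt.2 (Real.sin_nonpos_of_nonpos_of_neg_pi_le (by linarith)
      (by linarith)))
  · by_contra! hcon
    exact absurd l2 (not_lt.2 (Real.sin_nonpos_of_nonpos_of_neg_pi_le (by linarith)
      (by linarith)))

theorem openSector_add {α : ℝ} {z w : ℂ} (hz : z ∈ openSector α) (hw : w ∈ openSector α)
    (hcos : 0 ≤ Real.cos α) : z + w ∈ openSector α := by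
  obtain ⟨h1, h2⟩ := hz
  obtain ⟨h3, h4⟩ := hw
  refine ⟨by simpa using add_pos h1 h3, ?_⟩
  have := mul_le_mul_of_nonneg_right (abs_add_le z.im w.im) hcos
  rw [Complex.add_re, Complex.add_im]
  linarith

theorem openSector_smul {α : ℝ} {z : ℂ} (hz : z ∈ openSector α) {t : ℝ} (ht : 0 < t) :
    z * (t : ℂ) ∈ openSector α := by
  obtain ⟨h1, h2⟩ := hz
  refine ⟨by simpa using mul_pos h1 ht, ?_⟩
  rw [mul_comm z, Complex.re_ofReal_mul, Complex.im_ofReal_mul, abs_mul, abs_of_pos ht]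
  nlinarith

/-- The quadratic form whose level sets are the hyperbolas with asymptotes `ℝ e^{±iα}`. -/
noncomputable def hyperbolicForm (α : ℝ) (z : ℂ) : ℝ :=
  z.re ^ 2 * Real.sin α ^ 2 - z.im ^ 2 * Real.cos α ^ 2

theorem hyperbolicForm_pos {α : ℝ} (hcos : 0 ≤ Real.cos α) {z : ℂ} (hz : z ∈ openSector α) :
    0 < hyperbolicForm α z := by
  obtain ⟨-, h2⟩ := hz
  have h0 : 0 ≤ |z.im| * Real.cos α := by positivity
  have := mul_self_lt_mul_self h0 h2
  rw [hyperbolicForm, ← sq_abs z.im]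
  linarith

/-- The form grows when a vector of the sector is added. -/
theorem hyperbolicForm_le_add {α : ℝ} (hcos : 0 ≤ Real.cos α) {z w : ℂ} (hz : z ∈ openSector α)
    (hw : w ∈ openSector α) : hyperbolicForm α z ≤ hyperbolicForm α (z + w) := by
  have hw0 := hyperbolicForm_pos hcos hw
  obtain ⟨-, h2⟩ := hz
  obtain ⟨-, h4⟩ := hw
  have h5 := mul_lt_mul'' h2 h4 (by positivity) (by positivity)
  have h6 : z.im * w.im ≤ |z.im| * |w.im| := by
    rw [← abs_mul]
    exact le_abs_self _
  have h7 := mul_le_mul_of_nonneg_right h6 (sq_nonneg (Real.cos α))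
  simp only [hyperbolicForm, Complex.add_re, Complex.add_im] at *
  nlinarith

/-! ### Turning one pair outward -/

theorem exp_neg_mul_I_re (α : ℝ) : (Complex.exp (-(α * Complex.I))).re = Real.cos α := by
  rw [← neg_mul, ← Complex.ofReal_neg, Complex.exp_ofReal_mul_I_re, Real.cos_neg]

theorem exp_neg_mul_I_im (α : ℝ) : (Complex.exp (-(α * Complex.I))).im = -Real.sin α := by
  rw [← neg_mul, ← Complex.ofReal_neg, Complex.exp_ofReal_mul_I_im, Real.sin_neg]

theorem exp_pi_sub_mul_I (α : ℝ) :
    Complex.exp ((Real.pi - α : ℝ) * Complex.I) = -Complex.exp (-(α * Complex.I)) := by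
  push_cast
  rw [sub_mul, sub_eq_add_neg, Complex.exp_add, Complex.exp_pi_mul_I]
  ring

/-- The sums of an antipodal pair `P, Q` with directions `-e^{∓iα}`, weighted by `e^{±t}`, trace a
branch of a hyperbola. If the sums `g` of the other two pairs, all in the sector between its
asymptotes, never lie opposite to it, then they lie on its convex side (they do at infinity).
Turning the directions of `P` and `Q` outward, to `-e^{∓iα'}` with `α ≤ α'`, flattens the branch, so
that `g` stays on the convex side, also after the addition of a vector of the sector. -/
theorem pair_sum_ne_zero_of_le {α α' ρ₁ ρ₂ : ℝ} (hα : 0 < α) (hαα' : α ≤ α') (hα' : α' < Real.pi)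
    (hρ₁ : 0 < ρ₁) (hρ₂ : 0 < ρ₂) {g : ℝ × ℝ → ℂ} {Y₁ Y₁' Y₂ Y₂' : ℂ}
    (hg : ∀ t, g t = Y₁ * (Real.exp t.1 : ℂ) + Y₁' * (Real.exp (-t.1) : ℂ) +
      (Y₂ * (Real.exp t.2 : ℂ) + Y₂' * (Real.exp (-t.2) : ℂ)))
    (h₁ : Y₁ ∈ openSector α) (h₁' : Y₁' ∈ openSector α) (h₂ : Y₂ ∈ openSector α)
    (h₂' : Y₂' ∈ openSector α)
    (hne : ∀ (t : ℝ) (v : ℝ × ℝ), -(ρ₁ * Complex.exp (-(α * Complex.I))) * (Real.exp t : ℂ) +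
      -(ρ₂ * Complex.exp (α * Complex.I)) * (Real.exp (-t) : ℂ) + g v ≠ 0)
    {z : ℂ} (hz : z = 0 ∨ z ∈ openSector α) (t : ℝ) (v : ℝ × ℝ) :
    -(ρ₁ * Complex.exp (-(α' * Complex.I))) * (Real.exp t : ℂ) +
      -(ρ₂ * Complex.exp (α' * Complex.I)) * (Real.exp (-t) : ℂ) + g v + z ≠ 0 := by
  have hre : ∀ (β a b : ℝ) (w : ℂ), (-(ρ₁ * Complex.exp (-(β * Complex.I))) * (a : ℂ) +
      -(ρ₂ * Complex.exp (β * Complex.I)) * (b : ℂ) + w).re =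
      w.re - Real.cos β * (ρ₁ * a + ρ₂ * b) := by
    intro β a b w
    simp only [Complex.add_re, neg_mul, Complex.neg_re, Complex.re_mul_ofReal,
      Complex.re_ofReal_mul, exp_neg_mul_I_re, Complex.exp_ofReal_mul_I_re]
    ring
  have him : ∀ (β a b : ℝ) (w : ℂ), (-(ρ₁ * Complex.exp (-(β * Complex.I))) * (a : ℂ) +
      -(ρ₂ * Complex.exp (β * Complex.I)) * (b : ℂ) + w).im =
      w.im + Real.sin β * (ρ₁ * a - ρ₂ * b) := by
    intro β a b w
    simp only [Complex.add_im, neg_mul, Complex.neg_im, Complex.im_mul_ofReal,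
      Complex.im_ofReal_mul, exp_neg_mul_I_im, Complex.exp_ofReal_mul_I_im]
    ring
  have het := Real.exp_pos t
  have het' := Real.exp_pos (-t)
  rw [add_assoc]
  rcases le_or_gt (Real.pi / 2) α' with hcase | hcase
  · -- Beyond the right angle all summands have nonnegative real part.
    intro h0
    have h0re := congrArg Complex.re h0
    rw [hre, Complex.zero_re] at h0re
    have hgre : 0 < (g v).re := by
      have e1 := mul_pos h₁.1 (Real.exp_pos v.1)
      have e2 := mul_pos h₁'.1 (Real.exp_pos (-v.1))
      have e3 := mul_pos h₂.1 (Real.exp_pos v.2)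
      have e4 := mul_pos h₂'.1 (Real.exp_pos (-v.2))
      simp only [hg, Complex.add_re, Complex.re_mul_ofReal]
      linarith
    have hzre : 0 ≤ z.re := by
      rcases hz with rfl | hz
      exacts [le_rfl, hz.1.le]
    have hcos : Real.cos α' ≤ 0 :=
      Real.cos_nonpos_of_pi_div_two_le_of_le hcase (by linarith)
    have : Real.cos α' * (ρ₁ * Real.exp t + ρ₂ * Real.exp (-t)) ≤ 0 :=
      mul_nonpos_of_nonpos_of_nonneg hcos (by positivity)
    rw [Complex.add_re] at h0re
    linarith
  · have hc' : 0 < Real.cos α' := Real.cos_pos_of_mem_Ioo ⟨by linarith, hcase⟩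
    have hcc' : Real.cos α' ≤ Real.cos α :=
      Real.cos_le_cos_of_nonneg_of_le_pi hα.le hα'.le hαα'
    have hc : 0 < Real.cos α := hc'.trans_le hcc'
    have hs : 0 < Real.sin α := Real.sin_pos_of_pos_of_lt_pi hα (by linarith)
    have hss' : Real.sin α ≤ Real.sin α' :=
      Real.sin_le_sin_of_le_of_le_pi_div_two (by linarith) hcase.le hαα'
    have hs' : 0 < Real.sin α' := hs.trans_le hss'
    have hgmem : ∀ v, g v ∈ openSector α := by
      intro v
      rw [hg]
      exact openSector_add (openSector_add (openSector_smul h₁ (Real.exp_pos _))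
        (openSector_smul h₁' (Real.exp_pos _)) hc.le)
        (openSector_add (openSector_smul h₂ (Real.exp_pos _))
        (openSector_smul h₂' (Real.exp_pos _)) hc.le) hc.le
    set κ : ℝ := 4 * (ρ₁ * ρ₂) * Real.sin α ^ 2 * Real.cos α ^ 2 with hκ
    -- On the hyperbola the quadratic form takes the value `κ`, which `g` avoids.
    have hneκ : ∀ v, hyperbolicForm α (g v) ≠ κ := by
      intro v hv
      set E := (g v).re / Real.cos α with hE
      set F := (g v).im / Real.sin α with hF
      have hEF : E ^ 2 - F ^ 2 = 4 * (ρ₁ * ρ₂) := by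
        rw [hyperbolicForm, hκ] at hv
        rw [hE, hF]
        field_simp
        linarith
      have hE0 : 0 < E := div_pos (hgmem v).1 hc
      have hlt : 0 < E - F := by
        by_contra! hcon
        have : 0 < ρ₁ * ρ₂ := by positivity
        nlinarith
      have hlt' : 0 < E + F := by
        by_contra! hcon
        have : 0 < ρ₁ * ρ₂ := by positivity
        nlinarith
      have hexp : Real.exp (Real.log ((E - F) / (2 * ρ₁))) = (E - F) / (2 * ρ₁) :=
        Real.exp_log (by positivity)
      have hexp' : Real.exp (-Real.log ((E - F) / (2 * ρ₁))) = (E + F) / (2 * ρ₂) := by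
        rw [Real.exp_neg, hexp, inv_div]
        rw [div_eq_div_iff (by positivity) (by positivity)]
        linarith
      refine hne (Real.log ((E - F) / (2 * ρ₁))) v (Complex.ext ?_ ?_)
      · rw [hre, hexp, hexp', Complex.zero_re]
        have : ρ₁ * ((E - F) / (2 * ρ₁)) + ρ₂ * ((E + F) / (2 * ρ₂)) = E := by
          field_simp
          ring
        rw [this, hE]
        field_simp
        ring
      · rw [him, hexp, hexp', Complex.zero_im]
        have : ρ₁ * ((E - F) / (2 * ρ₁)) - ρ₂ * ((E + F) / (2 * ρ₂)) = -F := by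
          field_simp
          ring
        rw [this, hF]
        field_simp
        ring
    -- Far out the form exceeds `κ`; by connectedness it does so everywhere.
    have hlarge : ∃ v, κ ≤ hyperbolicForm α (g v) := by
      have hY := openSector_add h₁ h₂ hc.le
      have hY' := openSector_add h₁' h₂' hc.le
      have hN := hyperbolicForm_pos hc.le hY
      obtain ⟨s, hs1, hs2⟩ : ∃ s : ℝ, 0 < s ∧ κ ≤ s ^ 2 * hyperbolicForm α (Y₁ + Y₂) := by
        refine ⟨1 + κ / hyperbolicForm α (Y₁ + Y₂), by positivity, ?_⟩
        have hk : 0 ≤ κ / hyperbolicForm α (Y₁ + Y₂) := by positivity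
        have hk2 : κ / hyperbolicForm α (Y₁ + Y₂) * hyperbolicForm α (Y₁ + Y₂) = κ :=
          div_mul_cancel₀ _ hN.ne'
        have hκ0 : 0 ≤ κ := by positivity
        set k := κ / hyperbolicForm α (Y₁ + Y₂)
        have hk3 : 0 ≤ k * κ := mul_nonneg hk hκ0
        calc κ ≤ hyperbolicForm α (Y₁ + Y₂) + 2 * κ + k * κ := by linarith
          _ = (1 + k) ^ 2 * hyperbolicForm α (Y₁ + Y₂) := by
            linear_combination (-(2 + k)) * hk2
      refine ⟨(Real.log s, Real.log s), hs2.trans ?_⟩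
      have hsplit : g (Real.log s, Real.log s) =
          (Y₁ + Y₂) * (s : ℂ) + (Y₁' + Y₂') * ((s⁻¹ : ℝ) : ℂ) := by
        rw [hg]
        simp only [Real.exp_neg, Real.exp_log hs1]
        ring
      rw [hsplit]
      refine le_trans (le_of_eq ?_) (hyperbolicForm_le_add hc.le (openSector_smul hY hs1)
        (openSector_smul hY' (inv_pos.2 hs1)))
      simp only [hyperbolicForm, Complex.re_mul_ofReal, Complex.im_mul_ofReal]
      ring
    have hcont : Continuous fun v => hyperbolicForm α (g v) := by
      have : Continuous g := by
        have : g = fun t => Y₁ * (Real.exp t.1 : ℂ) + Y₁' * (Real.exp (-t.1) : ℂ) +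
          (Y₂ * (Real.exp t.2 : ℂ) + Y₂' * (Real.exp (-t.2) : ℂ)) := funext hg
        rw [this]
        fun_prop
      unfold hyperbolicForm
      fun_prop
    have hgt : κ < hyperbolicForm α (g v) := by
      by_contra! hcon
      obtain ⟨w, hw⟩ := mem_range_of_exists_le_of_exists_ge hcont ⟨v, hcon⟩ hlarge
      exact hneκ w hw
    have hgz : κ < hyperbolicForm α (g v + z) := by
      rcases hz with rfl | hz
      · rwa [add_zero]
      · exact hgt.trans_le (hyperbolicForm_le_add hc.le (hgmem v) hz)
    set G := g v + z
    intro h0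
    have h0re := congrArg Complex.re h0
    have h0im := congrArg Complex.im h0
    rw [hre, Complex.zero_re] at h0re
    rw [him, Complex.zero_im] at h0im
    have hee : Real.exp t * Real.exp (-t) = 1 := by rw [← Real.exp_add]; simp
    have hGre : G.re = Real.cos α' * (ρ₁ * Real.exp t + ρ₂ * Real.exp (-t)) := by linarith
    have hGim : G.im = -(Real.sin α' * (ρ₁ * Real.exp t - ρ₂ * Real.exp (-t))) := by linarith
    set E := ρ₁ * Real.exp t + ρ₂ * Real.exp (-t) with hE
    set F := ρ₁ * Real.exp t - ρ₂ * Real.exp (-t) with hF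
    have hEF : E ^ 2 - F ^ 2 = 4 * (ρ₁ * ρ₂) := by
      rw [hE, hF]
      linear_combination (4 * (ρ₁ * ρ₂)) * hee
    rw [hyperbolicForm, hGre, hGim, hκ, ← hEF] at hgz
    have hA : (Real.cos α' * E) ^ 2 * Real.sin α ^ 2 ≤ (Real.cos α * E) ^ 2 * Real.sin α ^ 2 := by
      rw [mul_pow, mul_pow]
      gcongr
    have hB : (Real.sin α * F) ^ 2 * Real.cos α ^ 2 ≤ (Real.sin α' * F) ^ 2 * Real.cos α ^ 2 := by
      rw [mul_pow, mul_pow]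
      gcongr
    nlinarith

theorem mem_openSector_of_pos {α : ℝ} (hα : 0 < α) (hα' : α ≤ Real.pi / 2) {z : ℂ}
    (h₁ : 0 < z.re * Real.sin α + z.im * Real.cos α)
    (h₂ : 0 < z.re * Real.sin α - z.im * Real.cos α) : z ∈ openSector α := by
  have hs : 0 < Real.sin α := Real.sin_pos_of_pos_of_lt_pi hα (by linarith [Real.pi_pos])
  have hc : 0 ≤ Real.cos α := Real.cos_nonneg_of_mem_Icc ⟨by linarith [Real.pi_pos], hα'⟩
  refine ⟨pos_of_mul_pos_left (by linarith : 0 < z.re * Real.sin α) hs.le, ?_⟩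
  rcases abs_cases z.im with ⟨h, -⟩ | ⟨h, -⟩ <;> rw [h] <;> linarith

/-- If `P`, `Q` have directions `-e^{∓iα}`, and `R` lies in the open sector, then any `R'` outside
this sector has a relation with nonnegative coefficients with `P, R` or with `Q, R`. -/
theorem mem_openSector_of_no_relation {α p q : ℝ} (hα : 0 < α) (hα' : α ≤ Real.pi / 2)
    (hp : 0 < p) (hq : 0 < q) {R R' : ℂ} (hR : R ∈ openSector α)
    (hP : ∀ a b : ℝ, 0 ≤ a → 0 ≤ b →
      (a : ℂ) * -(p * Complex.exp (-(α * Complex.I))) + (b : ℂ) * R + R' ≠ 0)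
    (hQ : ∀ a b : ℝ, 0 ≤ a → 0 ≤ b →
      (a : ℂ) * -(q * Complex.exp (α * Complex.I)) + (b : ℂ) * R + R' ≠ 0) :
    R' ∈ openSector α := by
  have hs : 0 < Real.sin α := Real.sin_pos_of_pos_of_lt_pi hα (by linarith [Real.pi_pos])
  -- `P` and `Q` span the boundary rays opposite to the sector.
  have hP' : ∀ a b : ℝ, 0 ≤ a → 0 ≤ b →
      ¬ (b * R.re + R'.re = a * Real.cos α ∧ b * R.im + R'.im = -(a * Real.sin α)) := by
    rintro a b ha hb ⟨h1, h2⟩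
    refine hP (a / p) b (by positivity) hb (Complex.ext ?_ ?_)
    · simp only [Complex.add_re, Complex.re_ofReal_mul, Complex.neg_re, exp_neg_mul_I_re,
        Complex.zero_re]
      field_simp
      linarith
    · simp only [Complex.add_im, Complex.im_ofReal_mul, Complex.neg_im, exp_neg_mul_I_im,
        Complex.zero_im]
      field_simp
      linarith
  have hQ' : ∀ a b : ℝ, 0 ≤ a → 0 ≤ b →
      ¬ (b * R.re + R'.re = a * Real.cos α ∧ b * R.im + R'.im = a * Real.sin α) := by
    rintro a b ha hb ⟨h1, h2⟩
    refine hQ (a / q) b (by positivity) hb (Complex.ext ?_ ?_)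
    · simp only [Complex.add_re, Complex.re_ofReal_mul, Complex.neg_re,
        Complex.exp_ofReal_mul_I_re, Complex.zero_re]
      field_simp
      linarith
    · simp only [Complex.add_im, Complex.im_ofReal_mul, Complex.neg_im,
        Complex.exp_ofReal_mul_I_im, Complex.zero_im]
      field_simp
      linarith
  by_contra hcon
  rcases eq_or_lt_of_le hα' with hα2 | hα2
  · have hcos : Real.cos α = 0 := by rw [hα2, Real.cos_pi_div_two]
    have hsin : Real.sin α = 1 := by rw [hα2, Real.sin_pi_div_two]
    have hre : R'.re ≤ 0 := by
      by_contra! h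
      exact hcon ⟨h, by rw [hcos, hsin]; simpa using h⟩
    have hb : 0 ≤ -R'.re / R.re := div_nonneg (by linarith) hR.1.le
    have hbR : -R'.re / R.re * R.re = -R'.re := div_mul_cancel₀ _ hR.1.ne'
    rcases le_total (-R'.re / R.re * R.im + R'.im) 0 with h | h
    · refine hP' (-(-R'.re / R.re * R.im + R'.im)) _ (by linarith) hb ⟨?_, ?_⟩
      · rw [hcos, hbR]; ring
      · rw [hsin]; ring
    · refine hQ' (-R'.re / R.re * R.im + R'.im) _ h hb ⟨?_, ?_⟩
      · rw [hcos, hbR]; ring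
      · rw [hsin]; ring
  · have hc : 0 < Real.cos α := Real.cos_pos_of_mem_Ioo ⟨by linarith [Real.pi_pos], hα2⟩
    have hRabs := hR.2
    have hL : 0 < R.re * Real.sin α + R.im * Real.cos α := by
      have := mul_le_mul_of_nonneg_right (neg_abs_le R.im) hc.le
      linarith
    have hM : 0 < R.re * Real.sin α - R.im * Real.cos α := by
      have := mul_le_mul_of_nonneg_right (le_abs_self R.im) hc.le
      linarith
    set L := R.re * Real.sin α + R.im * Real.cos α with hLdef
    set M := R.re * Real.sin α - R.im * Real.cos α with hMdef
    set L' := R'.re * Real.sin α + R'.im * Real.cos α with hLdef'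
    set M' := R'.re * Real.sin α - R'.im * Real.cos α with hMdef'
    rcases le_total (M' * L) (L' * M) with h | h
    · have hM' : M' ≤ 0 := by
        by_contra! hM'
        have hL' : 0 < L' := by
          by_contra! hL'
          nlinarith [mul_pos hM' hL]
        exact hcon (mem_openSector_of_pos hα hα' hL' hM')
      have hb : 0 ≤ -M' / M := div_nonneg (by linarith) hM.le
      have hbM : -M' / M * M = -M' := div_mul_cancel₀ _ hM.ne'
      set b := -M' / M
      have hbL : 0 ≤ b * L + L' := by
        refine nonneg_of_mul_nonneg_left (b := M) ?_ hM
        calc 0 ≤ L' * M - M' * L := by linarith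
          _ = b * M * L + L' * M := by rw [hbM]; ring
          _ = _ := by ring
      refine hQ' ((b * L + L') / (2 * Real.sin α * Real.cos α)) b (by positivity) hb ⟨?_, ?_⟩
      · field_simp
        rw [hLdef, hLdef']
        rw [hMdef, hMdef'] at hbM
        linarith
      · field_simp
        rw [hLdef, hLdef']
        rw [hMdef, hMdef'] at hbM
        linarith
    · have hL' : L' ≤ 0 := by
        by_contra! hL'
        have hM' : 0 < M' := by
          by_contra! hM'
          nlinarith [mul_pos hL' hM]
        exact hcon (mem_openSector_of_pos hα hα' hL' hM')
      have hb : 0 ≤ -L' / L := div_nonneg (by linarith) hL.le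
      have hbL : -L' / L * L = -L' := div_mul_cancel₀ _ hL.ne'
      set b := -L' / L
      have hbM : 0 ≤ b * M + M' := by
        refine nonneg_of_mul_nonneg_left (b := L) ?_ hL
        calc 0 ≤ M' * L - L' * M := by linarith
          _ = b * L * M + M' * L := by rw [hbL]; ring
          _ = _ := by ring
      refine hP' ((b * M + M') / (2 * Real.sin α * Real.cos α)) b (by positivity) hb ⟨?_, ?_⟩
      · field_simp
        rw [hMdef, hMdef']
        rw [hLdef, hLdef'] at hbL
        linarith
      · field_simp
        rw [hMdef, hMdef']
        rw [hLdef, hLdef'] at hbL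
        linarith

/-! ### Three pairs of complex numbers without facet relations -/

theorem exists_ne_and_ne : ∀ k₀ k₁ : Fin 3, ∃ k₂, k₀ ≠ k₂ ∧ k₁ ≠ k₂ := by decide

theorem univ_fin_three_eq : ∀ k₀ k₁ k₂ : Fin 3, k₀ ≠ k₁ → k₀ ≠ k₂ → k₁ ≠ k₂ →
    (Finset.univ : Finset (Fin 3)) = {k₀, k₁, k₂} := by decide

/-- No nontrivial combination with nonnegative coefficients of three numbers, one from each pair,
vanishes. -/
def NoFacetRelation (X : Fin 3 → Bool → ℂ) : Prop :=
  ∀ (sel : Fin 3 → Bool) (s : Fin 3 → ℝ), (∀ k, 0 ≤ s k) →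
    ∑ k, (s k : ℂ) * X k (sel k) = 0 → ∀ k, s k = 0

namespace NoFacetRelation

variable {X : Fin 3 → Bool → ℂ}

theorem mul_const (h : NoFacetRelation X) {c : ℂ} (hc : c ≠ 0) :
    NoFacetRelation fun k σ => X k σ * c := by
  intro sel s hs h0
  refine h sel s hs ?_
  simp only [← mul_assoc, ← Finset.sum_mul] at h0
  exact (mul_eq_zero.1 h0).resolve_right hc

theorem eq_zero (h : NoFacetRelation X) {k₀ k₁ k₂ : Fin 3} (h₀₁ : k₀ ≠ k₁) (h₀₂ : k₀ ≠ k₂)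
    (h₁₂ : k₁ ≠ k₂) (σ₀ σ₁ σ₂ : Bool) {a b c : ℝ} (ha : 0 ≤ a) (hb : 0 ≤ b) (hc : 0 ≤ c)
    (hsum : (a : ℂ) * X k₀ σ₀ + (b : ℂ) * X k₁ σ₁ + (c : ℂ) * X k₂ σ₂ = 0) :
    a = 0 ∧ b = 0 ∧ c = 0 := by
  have huniv : (Finset.univ : Finset (Fin 3)) = {k₀, k₁, k₂} :=
    univ_fin_three_eq _ _ _ h₀₁ h₀₂ h₁₂
  have key := h (fun k => if k = k₀ then σ₀ else if k = k₁ then σ₁ else σ₂)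
    (fun k => if k = k₀ then a else if k = k₁ then b else c)
    (fun k => by
      split_ifs <;> assumption)
    (by
      rw [huniv, Finset.sum_insert (by simp [h₀₁, h₀₂]), Finset.sum_insert (by simp [h₁₂]),
        Finset.sum_singleton]
      simp only [if_true, h₀₁.symm, h₀₂.symm, h₁₂.symm, if_false]
      rw [← hsum]
      ring)
  refine ⟨by simpa using key k₀, by simpa [h₀₁.symm] using key k₁, ?_⟩
  simpa [h₀₂.symm, h₁₂.symm] using key k₂

theorem mem_openSector_of_ne (h : NoFacetRelation X) {α p q : ℝ} (hα : 0 < α)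
    (hα' : α ≤ Real.pi / 2) (hp : 0 < p) (hq : 0 < q) {k₀ k₁ k₂ : Fin 3} {σ₀ σ₁ : Bool}
    (hP : X k₀ σ₀ = -(p * Complex.exp (-(α * Complex.I))))
    (hQ : X k₀ (!σ₀) = -(q * Complex.exp (α * Complex.I)))
    (h₀₁ : k₀ ≠ k₁) (h₀₂ : k₀ ≠ k₂) (h₁₂ : k₁ ≠ k₂) (hR : X k₁ σ₁ ∈ openSector α) (σ₂ : Bool) :
    X k₂ σ₂ ∈ openSector α := by
  refine mem_openSector_of_no_relation hα hα' hp hq hR (fun a b ha hb h0 => ?_)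
    (fun a b ha hb h0 => ?_)
  · rw [← hP, ← one_mul (X k₂ σ₂), ← Complex.ofReal_one] at h0
    exact one_ne_zero (h.eq_zero h₀₁ h₀₂ h₁₂ _ _ _ ha hb zero_le_one h0).2.2
  · rw [← hQ, ← one_mul (X k₂ σ₂), ← Complex.ofReal_one] at h0
    exact one_ne_zero (h.eq_zero h₀₁ h₀₂ h₁₂ _ _ _ ha hb zero_le_one h0).2.2

theorem mem_openSector_all (h : NoFacetRelation X) {α p q : ℝ} (hα : 0 < α)
    (hα' : α ≤ Real.pi / 2) (hp : 0 < p) (hq : 0 < q) {k₀ k₁ : Fin 3} {σ₀ σ₁ : Bool}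
    (hP : X k₀ σ₀ = -(p * Complex.exp (-(α * Complex.I))))
    (hQ : X k₀ (!σ₀) = -(q * Complex.exp (α * Complex.I)))
    (h₀₁ : k₀ ≠ k₁) (hR : X k₁ σ₁ ∈ openSector α) {k : Fin 3} (hk : k₀ ≠ k) (σ : Bool) :
    X k σ ∈ openSector α := by
  obtain ⟨k₂, h₀₂, h₁₂⟩ : ∃ k₂, k₀ ≠ k₂ ∧ k₁ ≠ k₂ := exists_ne_and_ne k₀ k₁
  have h2 := h.mem_openSector_of_ne hα hα' hp hq hP hQ h₀₁ h₀₂ h₁₂ hR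
  by_cases hkk : k₁ = k
  · subst hkk
    exact h.mem_openSector_of_ne hα hα' hp hq hP hQ h₀₂ h₀₁ h₁₂.symm (h2 true) σ
  · exact h.mem_openSector_of_ne hα hα' hp hq hP hQ h₀₁ hk hkk hR σ

/-- By Carathéodory's theorem `0` is a combination with positive coefficients of at most three
numbers; without facet relations these include both members of some pair. -/
theorem exists_pair_relation (h : NoFacetRelation X)
    (h0 : (0 : ℂ) ∈ convexHull ℝ (Set.range fun p : Fin 3 × Bool => X p.1 p.2)) :
    ∃ (k₀ k₁ : Fin 3) (σ₁ : Bool) (a b c : ℝ), k₀ ≠ k₁ ∧ 0 < a ∧ 0 < b ∧ 0 ≤ c ∧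
      (a : ℂ) * X k₀ true + (b : ℂ) * X k₀ false + (c : ℂ) * X k₁ σ₁ = 0 := by
  classical
  obtain ⟨ι, _, z, w, hz, hind, hw, hw1, hsum⟩ := eq_pos_convex_span_of_mem_convexHull h0
  have hex : ∀ i, ∃ p : Fin 3 × Bool, X p.1 p.2 = z i := fun i => hz ⟨i, rfl⟩
  choose idx hidx using hex
  have hinj : Function.Injective idx := by
    intro i i' hii
    apply hind.injective
    rw [← hidx, ← hidx, hii]
  have hcard : Fintype.card ι ≤ 3 := by
    have h1 := hind.card_le_finrank_succ
    have h2 := Submodule.finrank_le (vectorSpan ℝ (Set.range z))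
    rw [Complex.finrank_real_complex] at h2
    omega
  simp only [Complex.real_smul] at hsum
  by_cases hfst : Function.Injective fun i => (idx i).1
  · -- If all indices belong to different pairs, the combination is a facet relation.
    exfalso
    have hne : Nonempty ι := by
      by_contra hcon
      rw [not_nonempty_iff] at hcon
      simp at hw1
    obtain ⟨i₀⟩ := hne
    have hsel : ∀ k, ∃ σ, ∀ i, (idx i).1 = k → (idx i).2 = σ := by
      intro k
      by_cases hk : ∃ i, (idx i).1 = k
      · obtain ⟨i, rfl⟩ := hk
        exact ⟨(idx i).2, fun i' hi' => by rw [hfst hi']⟩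
      · exact ⟨true, fun i hi => absurd ⟨i, hi⟩ hk⟩
    choose sel hsel using hsel
    have hs := h sel (fun k => ∑ i with (idx i).1 = k, w i)
      (fun k => Finset.sum_nonneg fun i _ => (hw i).le) (by
        rw [← hsum, ← Finset.sum_fiberwise (Finset.univ : Finset ι) (fun i => (idx i).1)]
        refine Finset.sum_congr rfl fun k _ => ?_
        push_cast
        rw [Finset.sum_mul]
        refine Finset.sum_congr rfl fun i hi => ?_
        have hi : (idx i).1 = k := (Finset.mem_filter.1 hi).2
        rw [← hidx, hi, hsel k i hi]) (idx i₀).1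
    have := Finset.single_le_sum (f := w) (s := Finset.univ.filter fun i => (idx i).1 = (idx i₀).1)
      (fun i _ => (hw i).le) (Finset.mem_filter.2 ⟨Finset.mem_univ i₀, rfl⟩)
    linarith [hw i₀]
  · simp only [Function.Injective] at hfst
    push Not at hfst
    obtain ⟨i, i', hk, hne⟩ := hfst
    -- Order the two members of the pair.
    obtain ⟨i, i', hk, hne, hi, hi'⟩ : ∃ i i', (idx i).1 = (idx i').1 ∧ i ≠ i' ∧
        (idx i).2 = true ∧ (idx i').2 = false := by
      have hsnd : (idx i).2 ≠ (idx i').2 := fun hs => hne (hinj (Prod.ext hk hs))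
      cases h1 : (idx i).2 <;> cases h2 : (idx i').2
      · exact absurd (h1.trans h2.symm) hsnd
      · exact ⟨i', i, hk.symm, hne.symm, h2, h1⟩
      · exact ⟨i, i', hk, hne, h1, h2⟩
      · exact absurd (h1.trans h2.symm) hsnd
    have hzi : z i = X (idx i).1 true := by rw [← hidx, hi]
    have hzi' : z i' = X (idx i).1 false := by rw [← hidx, hi', hk]
    by_cases hthird : ∃ i'', i'' ≠ i ∧ i'' ≠ i'
    · obtain ⟨l, hl, hl'⟩ := hthird
      have huniv : (Finset.univ : Finset ι) = {i, i', l} := by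
        symm
        apply Finset.eq_univ_of_card
        rw [Finset.card_eq_three.2 ⟨i, i', l, hne, hl.symm, hl'.symm, rfl⟩]
        refine le_antisymm ?_ hcard
        have : ({i, i', l} : Finset ι).card ≤ Fintype.card ι := Finset.card_le_univ _
        rwa [Finset.card_eq_three.2 ⟨i, i', l, hne, hl.symm, hl'.symm, rfl⟩] at this
      refine ⟨(idx i).1, (idx l).1, (idx l).2, w i, w i', w l, ?_, hw i, hw i', (hw l).le, ?_⟩
      · intro hkl
        cases hb : (idx l).2
        · exact hl' (hinj (Prod.ext (hkl.symm.trans hk) (hb.trans hi'.symm)))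
        · exact hl (hinj (Prod.ext hkl.symm (hb.trans hi.symm)))
      · rw [← hsum, huniv, Finset.sum_insert (by simp [hne, hl.symm]),
          Finset.sum_insert (by simp [hl'.symm]), Finset.sum_singleton, hzi, hzi', ← hidx l]
        ring
    · push Not at hthird
      have huniv : (Finset.univ : Finset ι) = {i, i'} := by
        ext l
        simp only [Finset.mem_univ, Finset.mem_insert, Finset.mem_singleton, true_iff]
        by_cases hl : l = i
        · exact Or.inl hl
        · exact Or.inr (hthird l hl)
      refine ⟨(idx i).1, (idx i).1 + 1, true, w i, w i', 0, ?_, hw i, hw i', le_rfl, ?_⟩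
      · generalize (idx i).1 = k
        revert k
        decide
      · rw [← hsum, huniv, Finset.sum_insert (by simp [hne]), Finset.sum_singleton, hzi, hzi']
        simp

/-- If no facet relation holds, then either all six numbers lie in an open half-plane, or, after a
rotation, the members of one pair have directions `-e^{∓iα}` with `0 < α ≤ π / 2` and the other
four lie in the open sector of half-opening `α`. -/
theorem exists_rotation (h : NoFacetRelation X) :
    (∃ ψ : ℝ, ∀ k σ, 0 < (X k σ * Complex.exp (ψ * Complex.I)).re) ∨
    ∃ (ψ α p q : ℝ) (k₀ : Fin 3) (σ₀ : Bool), 0 < α ∧ α ≤ Real.pi / 2 ∧ 0 < p ∧ 0 < q ∧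
      X k₀ σ₀ * Complex.exp (ψ * Complex.I) = -(p * Complex.exp (-(α * Complex.I))) ∧
      X k₀ (!σ₀) * Complex.exp (ψ * Complex.I) = -(q * Complex.exp (α * Complex.I)) ∧
      ∀ k, k₀ ≠ k → ∀ σ, X k σ * Complex.exp (ψ * Complex.I) ∈ openSector α := by
  by_cases h0 : (0 : ℂ) ∈ convexHull ℝ (Set.range fun p : Fin 3 × Bool => X p.1 p.2)
  swap
  · obtain ⟨ψ, hψ⟩ := exists_rotation_re_pos (Set.finite_range _) h0
    exact Or.inl ⟨ψ, fun k σ => hψ _ ⟨(k, σ), rfl⟩⟩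
  right
  obtain ⟨k₀, k₁, σ₁, a, b, c, h₀₁, ha, hb, hc, hrel⟩ := h.exists_pair_relation h0
  have hpi := Real.pi_pos
  have hX : ∀ k σ, X k σ ≠ 0 := by
    intro k σ hk
    have := h (fun _ => σ) (Pi.single k 1) (fun l => by
      by_cases hl : l = k
      · subst hl; simp
      · simp [hl]) (by
      rw [Finset.sum_eq_single k]
      · simp [hk]
      · intro l _ hl
        simp [hl]
      · simp) k
    simp at this
  -- Name the two members of the pair so that the second is counterclockwise from the first.
  obtain ⟨σ₀, a, b, ha, hb, harg, hrel⟩ : ∃ (σ₀ : Bool) (a b : ℝ), 0 < a ∧ 0 < b ∧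
      0 ≤ (X k₀ (!σ₀) / X k₀ σ₀).arg ∧
      (a : ℂ) * X k₀ σ₀ + (b : ℂ) * X k₀ (!σ₀) + (c : ℂ) * X k₁ σ₁ = 0 := by
    rcases le_or_gt 0 (X k₀ false / X k₀ true).arg with harg | harg
    · exact ⟨true, a, b, ha, hb, harg, hrel⟩
    · refine ⟨false, b, a, hb, ha, ?_, by rw [← hrel, Bool.not_false]; ring⟩
      rw [Bool.not_false, ← inv_div, Complex.arg_inv]
      split_ifs <;> linarith
  set α : ℝ := (X k₀ (!σ₀) / X k₀ σ₀).arg / 2 with hαdef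
  have hα' : α ≤ Real.pi / 2 := by
    have := Complex.arg_le_pi (X k₀ (!σ₀) / X k₀ σ₀)
    linarith
  have hp : 0 < ‖X k₀ σ₀‖ := norm_pos_iff.2 (hX _ _)
  have hq : 0 < ‖X k₀ (!σ₀)‖ := norm_pos_iff.2 (hX _ _)
  obtain ⟨k₂, h₀₂, h₁₂⟩ : ∃ k₂, k₀ ≠ k₂ ∧ k₁ ≠ k₂ := exists_ne_and_ne k₀ k₁
  set ψ : ℝ := Real.pi - α - (X k₀ σ₀).arg with hψ
  have hP : X k₀ σ₀ * Complex.exp (ψ * Complex.I) =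
      -(‖X k₀ σ₀‖ * Complex.exp (-(α * Complex.I))) := by
    conv_lhs => rw [← Complex.norm_mul_exp_arg_mul_I (X k₀ σ₀)]
    rw [mul_assoc, ← Complex.exp_add, ← add_mul, ← Complex.ofReal_add, hψ,
      show (X k₀ σ₀).arg + (Real.pi - α - (X k₀ σ₀).arg) = Real.pi - α by ring,
      exp_pi_sub_mul_I]
    ring
  have hQ : X k₀ (!σ₀) * Complex.exp (ψ * Complex.I) =
      -(‖X k₀ (!σ₀)‖ * Complex.exp (α * Complex.I)) := by
    have hquot : X k₀ (!σ₀) = X k₀ σ₀ *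
        ((‖X k₀ (!σ₀)‖ / ‖X k₀ σ₀‖ : ℝ) * Complex.exp ((2 * α : ℝ) * Complex.I)) := by
      rw [← norm_div, show 2 * α = (X k₀ (!σ₀) / X k₀ σ₀).arg by rw [hαdef]; ring,
        Complex.norm_mul_exp_arg_mul_I, mul_div_cancel₀ _ (hX _ _)]
    have hpc : (‖X k₀ σ₀‖ : ℂ) ≠ 0 := by exact_mod_cast hp.ne'
    conv_lhs => rw [hquot]
    rw [mul_right_comm, hP]
    have hexp2 : Complex.exp ((2 * α : ℝ) * Complex.I) =
        Complex.exp (α * Complex.I) * Complex.exp (α * Complex.I) := by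
      rw [← Complex.exp_add]
      push_cast
      ring_nf
    have hexp1 : Complex.exp (-(α * Complex.I)) * Complex.exp (α * Complex.I) = 1 := by
      rw [← Complex.exp_add]
      simp
    rw [hexp2]
    push_cast
    calc _ = -(‖X k₀ (!σ₀)‖ * Complex.exp (α * Complex.I)) *
          (Complex.exp (-(α * Complex.I)) * Complex.exp (α * Complex.I)) := by
          field_simp
      _ = _ := by rw [hexp1, mul_one]
  have hα : 0 < α := by
    refine lt_of_le_of_ne (by linarith) fun hα0 => ?_
    -- Otherwise the two members are positive multiples of each other.
    have hquot : X k₀ (!σ₀) = ((‖X k₀ (!σ₀)‖ / ‖X k₀ σ₀‖ : ℝ) : ℂ) * X k₀ σ₀ := by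
      have h1 := Complex.norm_mul_exp_arg_mul_I (X k₀ (!σ₀) / X k₀ σ₀)
      rw [show (X k₀ (!σ₀) / X k₀ σ₀).arg = 0 by linarith, norm_div] at h1
      simp only [Complex.ofReal_zero, zero_mul, Complex.exp_zero, mul_one] at h1
      rw [h1, div_mul_cancel₀ _ (hX _ _)]
    have hpos : 0 < a + b * (‖X k₀ (!σ₀)‖ / ‖X k₀ σ₀‖) := by positivity
    have := h.eq_zero h₀₁ h₀₂ h₁₂ σ₀ σ₁ true hpos.le hc le_rfl (by
      rw [hquot] at hrel
      rw [← hrel]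
      push_cast
      ring)
    linarith [this.1]
  have hrot := h.mul_const (Complex.exp_ne_zero (ψ * Complex.I))
  have hrel' : (a : ℂ) * (X k₀ σ₀ * Complex.exp (ψ * Complex.I)) +
      (b : ℂ) * (X k₀ (!σ₀) * Complex.exp (ψ * Complex.I)) +
      (c : ℂ) * (X k₁ σ₁ * Complex.exp (ψ * Complex.I)) = 0 := by
    linear_combination Complex.exp (ψ * Complex.I) * hrel
  rcases eq_or_lt_of_le hα' with hα2 | hα2
  · have hcos : Real.cos α = 0 := by rw [hα2, Real.cos_pi_div_two]
    have hsin : Real.sin α = 1 := by rw [hα2, Real.sin_pi_div_two]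
    have hsector : ∀ z : ℂ, z ∈ openSector α ↔ 0 < z.re := by
      intro z
      rw [openSector, hcos, hsin]
      simp
    have e1 : Complex.exp (-(α * Complex.I)) = -Complex.I := by
      apply Complex.ext
      · rw [exp_neg_mul_I_re, hcos]; simp
      · rw [exp_neg_mul_I_im, hsin]; simp
    have e2 : Complex.exp (α * Complex.I) = Complex.I := by
      apply Complex.ext
      · rw [Complex.exp_ofReal_mul_I_re, hcos]; simp
      · rw [Complex.exp_ofReal_mul_I_im, hsin]; simp
    set Z := X k₁ σ₁ * Complex.exp (ψ * Complex.I) with hZ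
    -- For `α = π / 2` the pair is opposite, and a rotation by `π` exchanges its two sides.
    rcases lt_trichotomy Z.re 0 with hneg | hzero | hpos
    · have hflip : Complex.exp ((ψ + Real.pi : ℝ) * Complex.I) =
          -Complex.exp (ψ * Complex.I) := by
        push_cast
        rw [add_mul, Complex.exp_add, Complex.exp_pi_mul_I]
        ring
      have hrot' := h.mul_const (Complex.exp_ne_zero ((ψ + Real.pi : ℝ) * Complex.I))
      have hP' : X k₀ (!σ₀) * Complex.exp ((ψ + Real.pi : ℝ) * Complex.I) =
          -(‖X k₀ (!σ₀)‖ * Complex.exp (-(α * Complex.I))) := by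
        rw [hflip, mul_neg, hQ, e1, e2]; ring
      have hQ' : X k₀ (!!σ₀) * Complex.exp ((ψ + Real.pi : ℝ) * Complex.I) =
          -(‖X k₀ σ₀‖ * Complex.exp (α * Complex.I)) := by
        rw [Bool.not_not, hflip, mul_neg, hP, e1, e2]; ring
      refine ⟨ψ + Real.pi, α, _, _, k₀, !σ₀, hα, hα', hq, hp, hP', hQ', fun k hk σ => ?_⟩
      refine hrot'.mem_openSector_all hα hα' hq hp hP' hQ' h₀₁ (σ₁ := σ₁) ?_ hk σ
      rw [hsector]
      simp only [hflip, mul_neg, Complex.neg_re, ← hZ]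
      linarith
    · -- A member of another pair on the line through `P` and `Q` is opposite to `P` or to `Q`.
      exfalso
      have hZim : Z = (Z.im : ℂ) * Complex.I := by
        apply Complex.ext <;> simp [hzero]
      rcases le_total Z.im 0 with him | him
      · have := hrot.eq_zero h₀₁ h₀₂ h₁₂ σ₀ σ₁ true (a := -Z.im / ‖X k₀ σ₀‖) (b := 1) (c := 0)
          (div_nonneg (by linarith) hp.le) zero_le_one le_rfl (by
            have hpc : (‖X k₀ σ₀‖ : ℂ) ≠ 0 := by exact_mod_cast hp.ne'
            simp only [hP, e1, ← hZ]
            rw [hZim]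
            push_cast
            simp
            field_simp
            ring)
        exact one_ne_zero this.2.1
      · have := hrot.eq_zero h₀₁ h₀₂ h₁₂ (!σ₀) σ₁ true (a := Z.im / ‖X k₀ (!σ₀)‖) (b := 1)
          (c := 0) (div_nonneg him hq.le) zero_le_one le_rfl (by
            have hqc : (‖X k₀ (!σ₀)‖ : ℂ) ≠ 0 := by exact_mod_cast hq.ne'
            simp only [hQ, e2, ← hZ]
            rw [hZim]
            push_cast
            simp
            field_simp
            ring)
        exact one_ne_zero this.2.1
    · exact ⟨ψ, α, _, _, k₀, σ₀, hα, hα', hp, hq, hP, hQ, fun k hk σ =>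
        hrot.mem_openSector_all hα hα' hp hq hP hQ h₀₁ ((hsector _).2 hpos) hk σ⟩
  · have hcos : 0 < Real.cos α := Real.cos_pos_of_mem_Ioo ⟨by linarith, hα2⟩
    have hsin : 0 < Real.sin α := Real.sin_pos_of_pos_of_lt_pi hα (by linarith)
    refine ⟨ψ, α, _, _, k₀, σ₀, hα, hα', hp, hq, hP, hQ, fun k hk σ =>
      hrot.mem_openSector_all hα hα' hp hq hP hQ h₀₁ (σ₁ := σ₁) ?_ hk σ⟩
    have hre := congrArg Complex.re hrel'
    have him := congrArg Complex.im hrel'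
    rw [hP, hQ] at hre him
    set Z := X k₁ σ₁ * Complex.exp (ψ * Complex.I) with hZ
    simp only [Complex.add_re, Complex.add_im, Complex.re_ofReal_mul, Complex.im_ofReal_mul,
      Complex.neg_re, Complex.neg_im, exp_neg_mul_I_re, exp_neg_mul_I_im,
      Complex.exp_ofReal_mul_I_re, Complex.exp_ofReal_mul_I_im, Complex.zero_re,
      Complex.zero_im] at hre him
    have hA : 0 < a * ‖X k₀ σ₀‖ := by positivity
    have hB : 0 < b * ‖X k₀ (!σ₀)‖ := by positivity
    set A := a * ‖X k₀ σ₀‖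
    set B := b * ‖X k₀ (!σ₀)‖
    have hre' : c * Z.re = (A + B) * Real.cos α := by linarith
    have him' : c * Z.im = (B - A) * Real.sin α := by linarith
    have hc0 : 0 < c := by
      refine lt_of_le_of_ne hc fun hc0 => ?_
      rw [← hc0, zero_mul] at hre'
      have : 0 < (A + B) * Real.cos α := by positivity
      linarith
    refine mem_openSector_of_pos hα hα' ?_ ?_
    · refine pos_of_mul_pos_right (a := c) ?_ hc0.le
      have : 0 < 2 * B * (Real.cos α * Real.sin α) := by positivity
      calc 0 < 2 * B * (Real.cos α * Real.sin α) := this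
        _ = _ := by linear_combination (-Real.sin α) * hre' - Real.cos α * him'
    · refine pos_of_mul_pos_right (a := c) ?_ hc0.le
      have : 0 < 2 * A * (Real.cos α * Real.sin α) := by positivity
      calc 0 < 2 * A * (Real.cos α * Real.sin α) := this
        _ = _ := by linear_combination (-Real.sin α) * hre' + Real.cos α * him'

end NoFacetRelation

/-! ### Admissible coefficients -/

theorem pairSum_const_mul (X : Fin 3 → Bool → ℂ) (τ : Fin 3 → ℝ) (c : ℂ) :
    pairSum (fun k σ => c * X k σ) τ = c * pairSum X τ := by
  simp only [pairSum, Finset.mul_sum]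
  exact Finset.sum_congr rfl fun k _ => by ring

/-- Two pairs separated from the third. -/
theorem pairSum_eq (X : Fin 3 → Bool → ℂ) (τ : Fin 3 → ℝ) {k₀ k₁ k₂ : Fin 3} (h₀₁ : k₀ ≠ k₁)
    (h₀₂ : k₀ ≠ k₂) (h₁₂ : k₁ ≠ k₂) (σ₀ : Bool) :
    pairSum X τ = X k₀ σ₀ * (Real.exp (if σ₀ then τ k₀ else -τ k₀) : ℂ) +
      X k₀ (!σ₀) * (Real.exp (-(if σ₀ then τ k₀ else -τ k₀)) : ℂ) +
      (X k₁ true * (Real.exp (τ k₁) : ℂ) + X k₁ false * (Real.exp (-τ k₁) : ℂ) +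
      (X k₂ true * (Real.exp (τ k₂) : ℂ) + X k₂ false * (Real.exp (-τ k₂) : ℂ))) := by
  rw [pairSum, univ_fin_three_eq k₀ k₁ k₂ h₀₁ h₀₂ h₁₂, Finset.sum_insert (by simp [h₀₁, h₀₂]),
    Finset.sum_insert (by simp [h₁₂]), Finset.sum_singleton]
  cases σ₀
  · simp only [Bool.false_eq_true, if_false, Bool.not_false, neg_neg]
    ring
  · simp only [if_true, Bool.not_true]

theorem exp_eq_exp_re_mul (z : ℂ) :
    Complex.exp z = Real.exp z.re * Complex.exp (z.im * Complex.I) := by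
  conv_lhs => rw [← Complex.re_add_im z, Complex.exp_add]
  push_cast
  rfl

theorem exp_sub_pi_mul_I (α : ℝ) :
    Complex.exp ((α - Real.pi : ℝ) * Complex.I) = -Complex.exp (α * Complex.I) := by
  push_cast
  rw [sub_mul, Complex.exp_sub, Complex.exp_pi_mul_I]
  ring

/-- Logarithmic form of `pair_sum_ne_zero_of_le` for a pair in general position: a rotation by the
angle `ω` moves the bisector of the pair to the real axis. Since `c ≥ 0` is arbitrary, the sums
avoid the half-line `(-∞, 0]`. -/
theorem pairSum_add_ne_zero {Z Z' : Fin 3 → Bool → ℂ} {k₀ : Fin 3} {σ₀ : Bool} {α ω a : ℝ}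
    (hα : 0 < α) (ha : 0 ≤ a) (haα : α + a < Real.pi)
    (hαZ : (Z k₀ σ₀).im + ω = Real.pi - α) (hαZ' : (Z k₀ (!σ₀)).im + ω = α - Real.pi)
    (hZ₀ : Z' k₀ σ₀ = Z k₀ σ₀ - a * Complex.I) (hZ₁ : Z' k₀ (!σ₀) = Z k₀ (!σ₀) + a * Complex.I)
    (hZ : ∀ k, k₀ ≠ k → ∀ σ, Z' k σ = Z k σ)
    (hsec : ∀ k, k₀ ≠ k → ∀ σ, Complex.exp (Z k σ) * Complex.exp (ω * Complex.I) ∈ openSector α)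
    (hω : Complex.exp (ω * Complex.I) ∈ openSector α)
    (hne : ∀ τ, pairSum (fun k σ => Complex.exp (Z k σ)) τ ≠ 0) (τ : Fin 3 → ℝ) {c : ℝ}
    (hc : 0 ≤ c) : pairSum (fun k σ => Complex.exp (Z' k σ)) τ + c ≠ 0 := by
  obtain ⟨k₁, h₀₁, -⟩ := exists_ne_and_ne k₀ k₀
  obtain ⟨k₂, h₀₂, h₁₂⟩ := exists_ne_and_ne k₀ k₁
  have hrot : ∀ (z : ℂ) (β : ℝ), z.im + ω = β →
      Complex.exp (ω * Complex.I) * Complex.exp z =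
        Real.exp z.re * Complex.exp (β * Complex.I) := by
    intro z β hβ
    rw [exp_eq_exp_re_mul z, ← hβ, Complex.ofReal_add, add_mul, Complex.exp_add]
    ring
  have hP : Complex.exp (ω * Complex.I) * Complex.exp (Z k₀ σ₀) =
      -(Real.exp (Z k₀ σ₀).re * Complex.exp (-(α * Complex.I))) := by
    rw [hrot _ _ hαZ, exp_pi_sub_mul_I]; ring
  have hQ : Complex.exp (ω * Complex.I) * Complex.exp (Z k₀ (!σ₀)) =
      -(Real.exp (Z k₀ (!σ₀)).re * Complex.exp (α * Complex.I)) := by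
    rw [hrot _ _ hαZ', exp_sub_pi_mul_I]; ring
  have hP' : Complex.exp (ω * Complex.I) * Complex.exp (Z' k₀ σ₀) =
      -(Real.exp (Z k₀ σ₀).re * Complex.exp (-((α + a : ℝ) * Complex.I))) := by
    rw [hZ₀, hrot _ (Real.pi - (α + a)) (by simp; linarith), exp_pi_sub_mul_I]
    simp
  have hQ' : Complex.exp (ω * Complex.I) * Complex.exp (Z' k₀ (!σ₀)) =
      -(Real.exp (Z k₀ (!σ₀)).re * Complex.exp ((α + a : ℝ) * Complex.I)) := by
    rw [hZ₁, hrot _ ((α + a) - Real.pi) (by simp; linarith), exp_sub_pi_mul_I]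
    simp
  set g : ℝ × ℝ → ℂ := fun t =>
    Complex.exp (ω * Complex.I) * Complex.exp (Z k₁ true) * (Real.exp t.1 : ℂ) +
      Complex.exp (ω * Complex.I) * Complex.exp (Z k₁ false) * (Real.exp (-t.1) : ℂ) +
    (Complex.exp (ω * Complex.I) * Complex.exp (Z k₂ true) * (Real.exp t.2 : ℂ) +
      Complex.exp (ω * Complex.I) * Complex.exp (Z k₂ false) * (Real.exp (-t.2) : ℂ)) with hg
  have hsec' : ∀ k, k₀ ≠ k → ∀ σ,
      Complex.exp (ω * Complex.I) * Complex.exp (Z k σ) ∈ openSector α := by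
    intro k hk σ
    rw [mul_comm]
    exact hsec k hk σ
  have key := pair_sum_ne_zero_of_le (α' := α + a) hα (by linarith) haα
    (Real.exp_pos (Z k₀ σ₀).re) (Real.exp_pos (Z k₀ (!σ₀)).re) (g := g) (fun t => rfl)
    (hsec' k₁ h₀₁ true) (hsec' k₁ h₀₁ false) (hsec' k₂ h₀₂ true) (hsec' k₂ h₀₂ false)
    (by
      rintro t ⟨v₁, v₂⟩ h0
      refine hne (fun k => if k = k₀ then (if σ₀ then t else -t) else if k = k₁ then v₁ else v₂) ?_
      refine (mul_eq_zero.1 ?_).resolve_left (Complex.exp_ne_zero (ω * Complex.I))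
      rw [← h0, ← pairSum_const_mul, pairSum_eq _ _ h₀₁ h₀₂ h₁₂ σ₀]
      simp only [if_true, h₀₁.symm, h₀₂.symm, h₁₂.symm, if_false, hg]
      rw [hP, hQ]
      cases σ₀ <;> simp)
    (z := Complex.exp (ω * Complex.I) * c)
    (by
      rcases hc.eq_or_lt with h | h
      · left
        simp [← h]
      · exact Or.inr (openSector_smul hω h))
    (if σ₀ then τ k₀ else -τ k₀) (τ k₁, τ k₂)
  intro h0
  apply key
  rw [← mul_zero (Complex.exp (ω * Complex.I)), ← h0, mul_add, ← pairSum_const_mul,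
    pairSum_eq _ _ h₀₁ h₀₂ h₁₂ σ₀]
  simp only [hP', hQ', hZ k₁ h₀₁, hZ k₂ h₀₂, hg]

/-- A property of the coefficients holds near `exp z` if it holds in logarithmic coordinates
near `z`. -/
theorem eventually_nhds_exp {ι : Type*} [Finite ι] {p : (ι → ℂ) → Prop} {z : ι → ℂ}
    (h : ∀ᶠ w in 𝓝 z, p fun j => Complex.exp (w j)) :
    ∀ᶠ x in 𝓝 fun j => Complex.exp (z j), p x := by
  set Λ : (ι → ℂ) → ι → ℂ := fun x j => z j + Complex.log (x j * Complex.exp (-z j)) with hΛ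
  have hone : ∀ j, Complex.exp (z j) * Complex.exp (-z j) = 1 := fun j => by
    rw [← Complex.exp_add]; simp
  have hΛ0 : Λ (fun j => Complex.exp (z j)) = z := by
    funext j
    simp [hΛ, hone]
  have hcont : ContinuousAt Λ fun j => Complex.exp (z j) := by
    rw [continuousAt_pi]
    intro j
    refine continuousAt_const.add
      (ContinuousAt.clog ((continuous_apply j).mul continuous_const).continuousAt ?_)
    rw [hone]
    exact Complex.one_mem_slitPlane
  have h1 := hcont.tendsto.eventually (by rw [hΛ0]; exact h)
  have h2 : ∀ᶠ x : ι → ℂ in 𝓝 fun j => Complex.exp (z j), ∀ j, x j ≠ 0 := by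
    rw [eventually_all]
    intro j
    exact (continuous_apply j).continuousAt.eventually_ne (Complex.exp_ne_zero _)
  filter_upwards [h1, h2] with x hx hx0
  convert hx using 1
  funext j
  simp only [hΛ]
  rw [Complex.exp_add, Complex.exp_log (mul_ne_zero (hx0 j) (Complex.exp_ne_zero _)), mul_left_comm,
    hone, mul_one]

namespace StandardForm

variable {m r : ℕ} (S : StandardForm appellMatrix m r)

theorem mem_admissible_of_re_pos (hb : ∀ i, ∃ j, S.block j = i) {x : Fin 6 → ℂ}
    (hx : ∀ j, 0 < (x j).re) : x ∈ S.admissible := by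
  have hopen : IsOpen {y : Fin 6 → ℂ | ∀ j, 0 < (y j).re} := by
    simp only [Set.ofPred_forall]
    exact isOpen_iInter_of_finite fun j =>
      isOpen_lt continuous_const (Complex.continuous_re.comp (continuous_apply j))
  refine mem_interior.2 ⟨_, fun y hy i u => Or.inl ?_, hopen, hx⟩
  obtain ⟨j₀, hj₀⟩ := hb i
  rw [orthantPoly, Complex.re_sum]
  refine Finset.sum_pos' (fun j _ => ?_) ⟨j₀, Finset.mem_univ _, ?_⟩
  · split_ifs
    · rw [Complex.re_mul_ofReal]
      exact (mul_pos (hy j) (S.weight_pos j u)).le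
    · simp
  · rw [if_pos hj₀, Complex.re_mul_ofReal]
    exact mul_pos (hy j₀) (S.weight_pos j₀ u)

theorem orthantPoly_mul_const (i : Fin m) (x : Fin 6 → ℂ) (c : Fin m → ℂ) (u : Fin r → ℝ) :
    S.orthantPoly i (fun j => x j * c (S.block j)) u = c i * S.orthantPoly i x u := by
  simp only [orthantPoly, Finset.mul_sum]
  refine Finset.sum_congr rfl fun j _ => ?_
  split_ifs with h
  · rw [h]; ring
  · simp

variable {S}

theorem exists_block_eq_of_ne_zero {x : Fin 6 → ℂ} (hx : ∀ i u, S.orthantPoly i x u ≠ 0)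
    (i : Fin m) : ∃ j, S.block j = i := by
  by_contra! h
  refine hx i 0 ?_
  rw [orthantPoly]
  exact Finset.sum_eq_zero fun j _ => by rw [if_neg (h j)]

/-- If the `f_i` have no zero on the orthant for all coefficients near `x`, then no nontrivial
combination with nonnegative coefficients of three coefficients of one `f_i`, one from each
antipodal pair, vanishes. -/
theorem eq_zero_of_facet_relation {x : Fin 6 → ℂ}
    (hx : ∀ᶠ y in 𝓝 x, ∀ i u, S.orthantPoly i y u ≠ 0) {i : Fin m} {sel : Fin 3 → Bool}
    (hsel : ∀ k, S.block (vertex k (sel k)) = i) {s : Fin 3 → ℝ} (hs : ∀ k, 0 ≤ s k)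
    (h0 : ∑ k, (s k : ℂ) * x (vertex k (sel k)) = 0) (k : Fin 3) : s k = 0 := by
  obtain ⟨δ, hδ, hball⟩ := Metric.eventually_nhds_iff_ball.1 hx
  have h := mul_le_norm_sum_selection (X := S.vertexCoeff i x) (δ := δ) (k₀ := k) (sel := sel)
    (fun τ => by
      obtain ⟨ρ, u, hw, hP⟩ := S.exists_orthantPoly_eq τ
      have h1 := S.mul_weight_le_norm_orthantPoly (fun y hy => hball y hy i u) (hsel k)
      rw [hw, hP, hsel, norm_mul, Complex.norm_real, Real.norm_of_nonneg (Real.exp_pos _).le,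
        mul_left_comm] at h1
      exact le_of_mul_le_mul_left h1 (Real.exp_pos _)) hs
  have h2 : ∑ k, (s k : ℂ) * S.vertexCoeff i x k (sel k) = 0 := by
    rw [← h0]
    exact Finset.sum_congr rfl fun k _ => by rw [vertexCoeff, if_pos (hsel k)]
  rw [h2, norm_zero] at h
  exact le_antisymm (by nlinarith) (hs k)

theorem pairSum_ne_zero (hb : ∀ j j', S.block j = S.block j') {x : Fin 6 → ℂ}
    (hx : ∀ i u, S.orthantPoly i x u ≠ 0) (τ : Fin 3 → ℝ) :
    pairSum (fun k σ => x (vertex k σ)) τ ≠ 0 := by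
  obtain ⟨ρ, u, -, hP⟩ := S.exists_orthantPoly_eq τ
  have h := hx (S.block 0) u
  rw [hP] at h
  have : S.vertexCoeff (S.block 0) x = fun k σ => x (vertex k σ) := by
    funext k σ
    rw [vertexCoeff, if_pos (hb _ _)]
  rw [this] at h
  exact right_ne_zero_of_mul h

theorem orthantPoly_mem_slitPlane (hb : ∀ j j', S.block j = S.block j')
    (hne : ∀ i, ∃ j, S.block j = i) {x : Fin 6 → ℂ}
    (hx : ∀ (τ : Fin 3 → ℝ) (c : ℝ), 0 ≤ c → pairSum (fun k σ => x (vertex k σ)) τ + c ≠ 0)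
    (i : Fin m) (u : Fin r → ℝ) : S.orthantPoly i x u ∈ Complex.slitPlane := by
  obtain ⟨ρ, τ, h⟩ := S.orthantPoly_eq_of_block_eq hb (hne i) u
  rw [h, Complex.mem_slitPlane_iff]
  by_contra! hcon
  rw [Complex.re_ofReal_mul, Complex.im_ofReal_mul] at hcon
  obtain ⟨h1, h2⟩ := hcon
  have hρ := Real.exp_pos ρ
  set v := pairSum (fun k σ => x (vertex k σ)) τ with hv
  have him : v.im = 0 := (mul_eq_zero.1 h2).resolve_left hρ.ne'
  have hre : v.re ≤ 0 := by
    by_contra! hpos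
    linarith [mul_pos hρ hpos]
  -- A value `v ≤ 0` contradicts the hypothesis for `c = -v`.
  refine hx τ (-v.re) (by linarith) (Complex.ext ?_ ?_)
  · simp [← hv]
  · simp [← hv, him]

/-- The case of two antipodal blocks: the coefficients of each block lie in an open half-plane. -/
theorem exists_rotation_of_block_ne {x : Fin 6 → ℂ}
    (hx : ∀ᶠ y in 𝓝 x, ∀ i u, S.orthantPoly i y u ≠ 0)
    (hb : ∀ k, S.block (vertex k true) ≠ S.block (vertex k false)) (i : Fin m) :
    ∃ ψ : ℝ, ∀ j, S.block j = i → 0 < (x j * Complex.exp (ψ * Complex.I)).re := by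
  obtain ⟨j₀, hj₀⟩ := exists_block_eq_of_ne_zero hx.self_of_nhds i
  choose sel hsel using S.exists_block_vertex_eq j₀
  have hsel' : ∀ k, S.block (vertex k (sel k)) = i := fun k => (hsel k).trans hj₀
  have h0 : (0 : ℂ) ∉ convexHull ℝ (Set.range fun k => x (vertex k (sel k))) := by
    intro h0
    set f : (Fin 3 → ℝ) →ₗ[ℝ] ℂ :=
      Fintype.linearCombination ℝ fun k => x (vertex k (sel k)) with hf
    have hsub : convexHull ℝ (Set.range fun k => x (vertex k (sel k))) ⊆
        f '' stdSimplex ℝ (Fin 3) := by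
      refine convexHull_min ?_ ((convex_stdSimplex ℝ (Fin 3)).linear_image f)
      rintro _ ⟨k, rfl⟩
      exact ⟨Pi.single k 1, single_mem_stdSimplex ℝ k, by simp [hf]⟩
    obtain ⟨s, ⟨hs0, hs1⟩, hs⟩ := hsub h0
    have hall := eq_zero_of_facet_relation hx hsel' hs0 (by
      rw [← hs, hf, Fintype.linearCombination_apply]
      simp [Complex.real_smul])
    simp [hall] at hs1
  obtain ⟨ψ, hψ⟩ := exists_rotation_re_pos (Set.finite_range _) h0
  refine ⟨ψ, fun j hj => ?_⟩
  obtain ⟨k, σ, rfl⟩ := exists_eq_vertex j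
  have hσ : σ = sel k := by
    by_contra hne
    apply hb k
    cases σ
    · have h2 : sel k = true := by simpa using hne
      rw [hj, ← h2]
      exact hsel' k
    · have h2 : sel k = false := by simpa using hne
      rw [hj, ← h2]
      exact (hsel' k).symm
  subst hσ
  exact hψ _ ⟨k, rfl⟩

/-- If all coefficients, after a rotation of each block, lie in the right half-plane, then they are
admissible, with logarithms of imaginary part less than `π / 2`. -/
theorem exists_log_of_re_pos {x : Fin 6 → ℂ} (hne : ∀ i, ∃ j, S.block j = i)
    {ψ : Fin m → ℝ} (hψ : ∀ j, 0 < (x j * Complex.exp (ψ (S.block j) * Complex.I)).re) :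
    ∃ z : Fin 6 → ℂ,
      (∀ j, Complex.exp (z j) = x j * Complex.exp (ψ (S.block j) * Complex.I)) ∧
      (∀ j, |(z j).im| < Real.pi / 2) ∧ (fun j => Complex.exp (z j)) ∈ S.admissible := by
  have hexp : ∀ j, Complex.exp (Complex.log (x j * Complex.exp (ψ (S.block j) * Complex.I))) =
      x j * Complex.exp (ψ (S.block j) * Complex.I) := fun j =>
    Complex.exp_log fun h => by simpa [h] using hψ j
  refine ⟨fun j => Complex.log (x j * Complex.exp (ψ (S.block j) * Complex.I)), hexp,
    fun j => ?_, S.mem_admissible_of_re_pos hne fun j => ?_⟩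
  · rw [Complex.log_im]
    exact Complex.abs_arg_lt_pi_div_two_iff.2 (Or.inl (hψ j))
  · rw [hexp]
    exact hψ j

theorem eventually_mem_openSector {T : Type*} [TopologicalSpace T] {f : T → ℂ} {g : T → ℝ} {t : T}
    (hf : ContinuousAt f t) (hg : ContinuousAt g t) (h : f t ∈ openSector (g t)) :
    ∀ᶠ s in 𝓝 t, f s ∈ openSector (g s) := by
  have hre : ContinuousAt (fun s => (f s).re) t := Complex.continuous_re.continuousAt.comp hf
  have him : ContinuousAt (fun s => (f s).im) t := Complex.continuous_im.continuousAt.comp hf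
  have hcos : ContinuousAt (fun s => Real.cos (g s)) t :=
    Real.continuous_cos.continuousAt.comp hg
  have hsin : ContinuousAt (fun s => Real.sin (g s)) t :=
    Real.continuous_sin.continuousAt.comp hg
  filter_upwards [continuousAt_const.eventually_lt hre h.1,
    (him.abs.mul hcos).eventually_lt (hre.mul hsin) h.2] with s h1 h2
  exact ⟨h1, h2⟩

/-- The exceptional case of a single block: the members of one pair have directions `-e^{∓iα}`, and
the other coefficients lie in the sector between. Turning this pair outward by an angle
`a ≤ (π - α) / 2` does not leave the admissible set. -/
theorem mem_admissible_of_outward (hb : ∀ j j', S.block j = S.block j')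
    (hne : ∀ i, ∃ j, S.block j = i) {z : Fin 6 → ℂ} {α a : ℝ} {k₀ : Fin 3} {σ₀ : Bool}
    (hα : 0 < α) (hα' : α < Real.pi) (ha : 0 ≤ a) (haα : a ≤ (Real.pi - α) / 2)
    (hx : ∀ᶠ y in 𝓝 fun j => Complex.exp (z j), ∀ i u, S.orthantPoly i y u ≠ 0)
    (h₀ : (z (vertex k₀ σ₀)).im = Real.pi - α) (h₁ : (z (vertex k₀ (!σ₀))).im = α - Real.pi)
    (hsec : ∀ k, k₀ ≠ k → ∀ σ, Complex.exp (z (vertex k σ)) ∈ openSector α) {o : Fin 6 → ℂ}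
    (ho₀ : o (vertex k₀ σ₀) = -(a * Complex.I)) (ho₁ : o (vertex k₀ (!σ₀)) = a * Complex.I)
    (ho : ∀ k, k₀ ≠ k → ∀ σ, o (vertex k σ) = 0) :
    (fun j => Complex.exp (z j + o j)) ∈ S.admissible := by
  rw [admissible, mem_interior_iff_mem_nhds]
  refine eventually_nhds_exp (z := fun j => z j + o j)
    (p := fun x => ∀ i u, S.orthantPoly i x u ∈ Complex.slitPlane) ?_
  -- Near `z` the pair is in general position: its half-opening angle is `α'` instead of `α`, and
  -- its bisector is turned by `-ω`.
  set α' : (Fin 6 → ℂ) → ℝ := fun w =>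
    Real.pi - ((w (vertex k₀ σ₀)).im - (w (vertex k₀ (!σ₀))).im) / 2 with hα'def
  set ω : (Fin 6 → ℂ) → ℝ := fun w =>
    -((w (vertex k₀ σ₀)).im + (w (vertex k₀ (!σ₀))).im) / 2 with hωdef
  have hα'z : α' z = α := by
    simp only [hα'def, h₀, h₁]
    ring
  have hωz : ω z = 0 := by
    simp only [hωdef, h₀, h₁]
    ring
  have hα'c : Continuous α' := by fun_prop
  have hωc : Continuous ω := by fun_prop
  have hev : ∀ᶠ w in 𝓝 z, ∀ i u, S.orthantPoly i (fun j => Complex.exp (w j + o j)) u ∈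
      Complex.slitPlane := by
    have e1 : ∀ᶠ w in 𝓝 z, ∀ i u, S.orthantPoly i (fun j => Complex.exp (w j)) u ≠ 0 :=
      (Continuous.tendsto (by fun_prop : Continuous fun (w : Fin 6 → ℂ) j => Complex.exp (w j))
        z).eventually hx
    have e2 : ∀ᶠ w in 𝓝 z, 0 < α' w :=
      continuousAt_const.eventually_lt hα'c.continuousAt (by rwa [hα'z])
    have e3 : ∀ᶠ w in 𝓝 z, α' w + a < Real.pi :=
      (hα'c.add continuous_const).continuousAt.eventually_lt continuousAt_const
        (by
          change α' z + a < Real.pi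
          rw [hα'z]
          linarith)
    have e4 : ∀ᶠ w in 𝓝 z, Complex.exp (ω w * Complex.I) ∈ openSector (α' w) := by
      refine eventually_mem_openSector (by fun_prop) hα'c.continuousAt ?_
      rw [hωz, hα'z]
      refine ⟨by simp, ?_⟩
      simpa using Real.sin_pos_of_pos_of_lt_pi hα hα'
    have e5 : ∀ᶠ w in 𝓝 z, ∀ k, k₀ ≠ k → ∀ σ,
        Complex.exp (w (vertex k σ)) * Complex.exp (ω w * Complex.I) ∈ openSector (α' w) := by
      rw [eventually_all]
      intro k
      by_cases hk : k₀ = k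
      · exact Eventually.of_forall fun w h => absurd hk h
      · have : ∀ σ, ∀ᶠ w in 𝓝 z, Complex.exp (w (vertex k σ)) * Complex.exp (ω w * Complex.I) ∈
            openSector (α' w) := by
          intro σ
          refine eventually_mem_openSector (by fun_prop) hα'c.continuousAt ?_
          rw [hωz, hα'z]
          simpa using hsec k hk σ
        filter_upwards [eventually_all.2 this] with w hw _ σ using hw σ
    filter_upwards [e1, e2, e3, e4, e5] with w w1 w2 w3 w4 w5
    refine orthantPoly_mem_slitPlane hb hne fun τ c hc => ?_
    refine pairSum_add_ne_zero (Z := fun k σ => w (vertex k σ))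
      (Z' := fun k σ => w (vertex k σ) + o (vertex k σ)) (k₀ := k₀) (σ₀ := σ₀) (ω := ω w)
      w2 ha w3 ?_ ?_ ?_ ?_ ?_ w5 w4 ?_ τ hc
    · simp only [hα'def, hωdef]; ring
    · simp only [hα'def, hωdef]; ring
    · simp only [ho₀, sub_eq_add_neg]
    · simp only [ho₁]
    · intro k hk σ
      simp only [ho k hk, add_zero]
    · exact pairSum_ne_zero hb w1
  have ht : Tendsto (fun (w : Fin 6 → ℂ) j => w j - o j) (𝓝 fun j => z j + o j) (𝓝 z) := by
    have hc : Continuous fun (w : Fin 6 → ℂ) (j : Fin 6) => w j - o j := by fun_prop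
    have := hc.tendsto fun j => z j + o j
    simpa using this
  filter_upwards [ht.eventually hev] with w hw
  simpa using hw

/-- Coefficients for which the `f_i` have no zero on the orthant, stably, can be rotated blockwise
and then moved, without changing their moduli and without leaving the admissible set, into the open
right half-plane. -/
theorem exists_admissible_path {x : Fin 6 → ℂ} (hx0 : ∀ j, x j ≠ 0)
    (hx : ∀ᶠ y in 𝓝 x, ∀ i u, S.orthantPoly i y u ≠ 0) :
    ∃ (ψ : Fin m → ℝ) (z₀ z₁ : Fin 6 → ℂ),
      (∀ j, Complex.exp (z₀ j) = x j * Complex.exp (ψ (S.block j) * Complex.I)) ∧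
      (∀ j, |(z₁ j).im| < Real.pi / 2) ∧ (∀ j, (z₁ j).re = (z₀ j).re) ∧
      ∀ t ∈ Set.Icc (0 : ℝ) 1,
        (fun j => Complex.exp (z₀ j + t * (z₁ j - z₀ j))) ∈ S.admissible := by
  have hne := exists_block_eq_of_ne_zero hx.self_of_nhds
  have hpi := Real.pi_pos
  have hdone : ∀ ψ : Fin m → ℝ,
      (∀ j, 0 < (x j * Complex.exp (ψ (S.block j) * Complex.I)).re) →
      ∃ (ψ : Fin m → ℝ) (z₀ z₁ : Fin 6 → ℂ),
      (∀ j, Complex.exp (z₀ j) = x j * Complex.exp (ψ (S.block j) * Complex.I)) ∧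
      (∀ j, |(z₁ j).im| < Real.pi / 2) ∧ (∀ j, (z₁ j).re = (z₀ j).re) ∧
      ∀ t ∈ Set.Icc (0 : ℝ) 1,
        (fun j => Complex.exp (z₀ j + t * (z₁ j - z₀ j))) ∈ S.admissible := by
    intro ψ hψ
    obtain ⟨z, hz1, hz2, hz3⟩ := exists_log_of_re_pos hne hψ
    exact ⟨ψ, z, z, hz1, hz2, fun _ => rfl, fun t _ => by simpa using hz3⟩
  rcases S.block_dichotomy with hb | hb
  swap
  · choose ψ hψ using exists_rotation_of_block_ne hx hb
    exact hdone ψ fun j => hψ _ j rfl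
  have hrel : NoFacetRelation fun k σ => x (vertex k σ) := fun sel s hs h0 =>
    eq_zero_of_facet_relation hx (i := S.block 0) (fun k => hb _ _) hs h0
  rcases hrel.exists_rotation with ⟨ψ, hψ⟩ | ⟨ψ, α, p, q, k₀, σ₀, hα, hα', hp, hq, hP, hQ, hsec⟩
  · refine hdone (fun _ => ψ) fun j => ?_
    obtain ⟨k, σ, rfl⟩ := exists_eq_vertex j
    exact hψ k σ
  set z₀ : Fin 6 → ℂ := fun j => Complex.log (x j * Complex.exp (ψ * Complex.I)) with hz₀
  have hz₀exp : ∀ j, Complex.exp (z₀ j) = x j * Complex.exp (ψ * Complex.I) := fun j =>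
    Complex.exp_log (mul_ne_zero (hx0 j) (Complex.exp_ne_zero _))
  have hP0 : (z₀ (vertex k₀ σ₀)).im = Real.pi - α := by
    rw [hz₀, Complex.log_im, hP, ← mul_neg, ← exp_pi_sub_mul_I, Complex.arg_real_mul _ hp]
    exact Complex.arg_exp_mul_I _ ▸ (toIocMod_eq_self _).2 ⟨by linarith, by linarith⟩
  have hQ0 : (z₀ (vertex k₀ (!σ₀))).im = α - Real.pi := by
    rw [hz₀, Complex.log_im, hQ, ← mul_neg, ← exp_sub_pi_mul_I, Complex.arg_real_mul _ hq]
    exact Complex.arg_exp_mul_I _ ▸ (toIocMod_eq_self _).2 ⟨by linarith, by linarith⟩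
  -- The pair is turned by `(π - α) / 2`, into the right half-plane.
  set a₁ : ℝ := (Real.pi - α) / 2 with ha₁
  set o : Fin 6 → ℂ := fun j => if j = vertex k₀ σ₀ then -(a₁ * Complex.I) else
    if j = vertex k₀ (!σ₀) then a₁ * Complex.I else 0 with ho
  have hne' : vertex k₀ (!σ₀) ≠ vertex k₀ σ₀ := by
    rw [Ne, vertex_eq_vertex_iff]
    simp
  have ho₀ : o (vertex k₀ σ₀) = -(a₁ * Complex.I) := by simp [ho]
  have ho₁ : o (vertex k₀ (!σ₀)) = a₁ * Complex.I := by simp [ho, hne']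
  have ho₂ : ∀ k, k₀ ≠ k → ∀ σ, o (vertex k σ) = 0 := by
    intro k hk σ
    have h1 : vertex k σ ≠ vertex k₀ σ₀ := by
      rw [Ne, vertex_eq_vertex_iff]
      exact fun h => hk h.1.symm
    have h2 : vertex k σ ≠ vertex k₀ (!σ₀) := by
      rw [Ne, vertex_eq_vertex_iff]
      exact fun h => hk h.1.symm
    simp [ho, h1, h2]
  refine ⟨fun _ => ψ, z₀, fun j => z₀ j + o j, hz₀exp, fun j => ?_, fun j => ?_, fun t ht => ?_⟩
  · obtain ⟨k, σ, rfl⟩ := exists_eq_vertex j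
    by_cases hk : k₀ = k
    · subst hk
      by_cases hσ : σ = σ₀
      · subst hσ
        rw [Complex.add_im, hP0, ho₀, abs_lt]
        simp only [Complex.neg_im, Complex.im_ofReal_mul, Complex.I_im]
        constructor <;> linarith
      · have hσ' : σ = !σ₀ := Bool.eq_not_of_ne hσ
        subst hσ'
        rw [Complex.add_im, hQ0, ho₁, abs_lt]
        simp only [Complex.im_ofReal_mul, Complex.I_im]
        constructor <;> linarith
    · change |(z₀ (vertex k σ) + o (vertex k σ)).im| < Real.pi / 2
      rw [ho₂ k hk, add_zero, hz₀, Complex.log_im]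
      exact (abs_arg_lt_of_mem_openSector hα hα' (hsec k hk σ)).trans_le hα'
  · have : (o j).re = 0 := by
      simp only [ho]
      split_ifs <;> simp
    simp [this]
  · have hscale : (fun j => Complex.exp (z₀ j + t * (z₀ j + o j - z₀ j))) =
        fun j => Complex.exp (z₀ j + t * o j) := by
      funext j
      ring_nf
    rw [hscale]
    refine mem_admissible_of_outward hb hne (a := t * a₁) (o := fun j => t * o j) hα
      (by linarith) (mul_nonneg ht.1 (by linarith)) ?_ ?_ hP0 hQ0 ?_ ?_ ?_ ?_
    · exact mul_le_of_le_one_left (by linarith) ht.2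
    · have hcont : Continuous fun (y : Fin 6 → ℂ) (j : Fin 6) =>
          y j * Complex.exp (-(ψ * Complex.I)) := by fun_prop
      have ht : Tendsto (fun (y : Fin 6 → ℂ) (j : Fin 6) => y j * Complex.exp (-(ψ * Complex.I)))
          (𝓝 fun j => Complex.exp (z₀ j)) (𝓝 x) := by
        have := hcont.tendsto fun j => Complex.exp (z₀ j)
        have hlim : (fun j => Complex.exp (z₀ j) * Complex.exp (-(ψ * Complex.I))) = x := by
          funext j
          rw [hz₀exp, mul_assoc, ← Complex.exp_add]
          simp
        rwa [hlim] at this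
      filter_upwards [ht.eventually hx] with y hy i u
      have h1 := hy i u
      rw [S.orthantPoly_mul_const i y (fun _ => Complex.exp (-(ψ * Complex.I)))] at h1
      exact right_ne_zero_of_mul h1
    · intro k hk σ
      rw [hz₀exp]
      exact hsec k hk σ
    · simp only [ho₀]
      push_cast
      ring
    · simp only [ho₁]
      push_cast
      ring
    · intro k hk σ
      simp only [ho₂ k hk, mul_zero]

end StandardForm

/-! ### Analytic continuation in logarithmic coordinates -/

/-- A continuous logarithm of a constant on a preconnected set is constant. -/
theorem eq_of_exp_eq_const {T : Type*} [TopologicalSpace T] {s : Set T} (hs : IsPreconnected s)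
    {f : T → ℂ} (hf : ContinuousOn f s) {c : ℂ} (hc : ∀ t ∈ s, Complex.exp (f t) = c) {t t' : T}
    (ht : t ∈ s) (ht' : t' ∈ s) : f t = f t' := by
  -- The imaginary part takes values in a coset of `2πℤ`, and the real part is constant.
  set g : T → ℝ := fun t => ((f t).im - (f t').im) / (2 * Real.pi) with hg
  have hgc : ContinuousOn g s :=
    ((Complex.continuous_im.comp_continuousOn hf).sub continuousOn_const).div_const _
  have hdiff : ∀ t ∈ s, ∃ n : ℤ, f t = f t' + n * (2 * Real.pi * Complex.I) := fun t ht =>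
    Complex.exp_eq_exp_iff_exists_int.1 ((hc t ht).trans (hc t' ht').symm)
  have hpi : (2 * Real.pi : ℝ) ≠ 0 := by positivity
  have hgi : ∀ t ∈ s, ∀ n : ℤ, f t = f t' + n * (2 * Real.pi * Complex.I) → g t = n := by
    intro t _ n hn
    rw [hg]
    simp only [hn]
    simp
  have hmaps : Set.MapsTo g s (Set.range ((↑) : ℤ → ℝ)) := by
    intro t ht
    obtain ⟨n, hn⟩ := hdiff t ht
    exact ⟨n, (hgi t ht n hn).symm⟩
  have hdisc : IsDiscrete (Set.range ((↑) : ℤ → ℝ)) :=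
    Int.isClosedEmbedding_coe_real.isInducing.isDiscrete_range
  have hconst := hs.constant_of_mapsTo hdisc hgc hmaps ht ht'
  obtain ⟨n, hn⟩ := hdiff t ht
  have h0 : g t' = 0 := by simp [hg]
  rw [hgi t ht n hn, h0] at hconst
  rw [hn]
  simp [show n = 0 by exact_mod_cast hconst]

theorem appellY₁_exp (z : Fin 6 → ℂ) :
    appellY₁ (fun j => Complex.exp (z j)) = Complex.exp (z 1 + z 4 - z 0 - z 3) := by
  rw [appellY₁, sub_sub, Complex.exp_sub, Complex.exp_add, Complex.exp_add]

theorem appellY₂_exp (z : Fin 6 → ℂ) :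
    appellY₂ (fun j => Complex.exp (z j)) = Complex.exp (z 2 + z 5 - z 0 - z 3) := by
  rw [appellY₂, sub_sub, Complex.exp_sub, Complex.exp_add, Complex.exp_add]

theorem sqrt_norm_exp (w : ℂ) : Real.sqrt ‖Complex.exp w‖ = Real.exp (w.re / 2) := by
  rw [Complex.norm_exp, Real.sqrt_eq_rpow, ← Real.exp_mul]
  ring_nf

theorem exp_mem_appellDomain_iff (z : Fin 6 → ℂ) :
    (fun j => Complex.exp (z j)) ∈ appellDomain ↔
      Real.exp ((z 1 + z 4 - z 0 - z 3).re / 2) +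
        Real.exp ((z 2 + z 5 - z 0 - z 3).re / 2) < 1 := by
  rw [appellDomain, Set.mem_ofPred_eq, appellY₁_exp, appellY₂_exp, sqrt_norm_exp, sqrt_norm_exp]
  exact ⟨fun h => h.2, fun h => ⟨fun j => Complex.exp_ne_zero _, h⟩⟩

/-- In logarithmic coordinates the domain of convergence is convex. -/
theorem exp_mem_appellDomain_of_segment {z₀ z₁ : Fin 6 → ℂ}
    (h₀ : (fun j => Complex.exp (z₀ j)) ∈ appellDomain)
    (h₁ : (fun j => Complex.exp (z₁ j)) ∈ appellDomain) {t : ℝ} (ht : t ∈ Set.Icc (0 : ℝ) 1) :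
    (fun j => Complex.exp (z₀ j + t * (z₁ j - z₀ j))) ∈ appellDomain := by
  rw [exp_mem_appellDomain_iff] at *
  have key : ∀ A B : ℝ, Real.exp ((1 - t) * A + t * B) ≤ (1 - t) * Real.exp A + t * Real.exp B :=
    fun A B => convexOn_exp.2 (Set.mem_univ A) (Set.mem_univ B) (by linarith [ht.2]) ht.1 (by ring)
  have k1 := key ((z₀ 1 + z₀ 4 - z₀ 0 - z₀ 3).re / 2) ((z₁ 1 + z₁ 4 - z₁ 0 - z₁ 3).re / 2)
  have k2 := key ((z₀ 2 + z₀ 5 - z₀ 0 - z₀ 3).re / 2) ((z₁ 2 + z₁ 5 - z₁ 0 - z₁ 3).re / 2)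
  have hlt : (1 - t) * (Real.exp ((z₀ 1 + z₀ 4 - z₀ 0 - z₀ 3).re / 2) +
      Real.exp ((z₀ 2 + z₀ 5 - z₀ 0 - z₀ 3).re / 2)) +
      t * (Real.exp ((z₁ 1 + z₁ 4 - z₁ 0 - z₁ 3).re / 2) +
      Real.exp ((z₁ 2 + z₁ 5 - z₁ 0 - z₁ 3).re / 2)) < 1 := by
    rcases ht.1.eq_or_lt with h | h
    · rw [← h]
      linarith
    · have := mul_lt_mul_of_pos_left h₁ h
      have := mul_le_mul_of_nonneg_left h₀.le (by linarith [ht.2] : 0 ≤ 1 - t)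
      linarith
  refine lt_of_le_of_lt (add_le_add (le_of_eq_of_le ?_ k1) (le_of_eq_of_le ?_ k2)) (by linarith)
  · congr 1
    simp
    ring
  · congr 1
    simp
    ring

/-- The homogenized function `x^κ F₄` in the coordinates `z_j = log x_j`. -/
noncomputable def appellPhiLog (a b c c' : ℂ) (z : Fin 6 → ℂ) : ℂ :=
  Complex.exp (∑ j, appellKappa a b c c' j * z j) *
    appellF4 a b c c' (appellY₁ fun j => Complex.exp (z j)) (appellY₂ fun j => Complex.exp (z j))

theorem differentiableAt_appellPhiLog_line (a b : ℂ) {c c' : ℂ} (hc : ∀ k : ℕ, c ≠ -(k : ℂ))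
    (hc' : ∀ k : ℕ, c' ≠ -(k : ℂ)) (z v : Fin 6 → ℂ) {ζ : ℂ}
    (h : (fun j => Complex.exp (z j + ζ * v j)) ∈ appellDomain) :
    DifferentiableAt ℂ (fun ζ => appellPhiLog a b c c' fun j => z j + ζ * v j) ζ := by
  have h2 := h.2
  unfold appellPhiLog
  simp only [appellY₁_exp, appellY₂_exp] at h2 ⊢
  exact DifferentiableAt.mul (by fun_prop) (differentiableAt_appellF4 a b hc hc'
    (h₁ := fun ζ => Complex.exp (z 1 + ζ * v 1 + (z 4 + ζ * v 4) - (z 0 + ζ * v 0) -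
      (z 3 + ζ * v 3)))
    (h₂ := fun ζ => Complex.exp (z 2 + ζ * v 2 + (z 5 + ζ * v 5) - (z 0 + ζ * v 0) -
      (z 3 + ζ * v 3))) (by fun_prop) (by fun_prop) h2)

theorem isOpen_exp_mem_appellDomain :
    IsOpen {z : Fin 6 → ℂ | (fun j => Complex.exp (z j)) ∈ appellDomain} := by
  simp only [exp_mem_appellDomain_iff]
  exact isOpen_lt (by fun_prop) continuous_const

namespace StandardForm

variable {m r : ℕ} {S : StandardForm appellMatrix m r}

theorem isOpen_exp_mem_admissible :
    IsOpen {z : Fin 6 → ℂ | (fun j => Complex.exp (z j)) ∈ S.admissible} :=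
  isOpen_interior.preimage (by fun_prop : Continuous fun (z : Fin 6 → ℂ) j => Complex.exp (z j))

theorem differentiableAt_eulerIntegral_line (β : Fin m ⊕ Fin r → ℂ) {x₀ : Fin 6 → ℂ}
    (hx₀ : x₀ ∈ S.admissible) (hint : MeasureTheory.Integrable (S.kernel β x₀))
    (z v : Fin 6 → ℂ) {ζ : ℂ} (h : (fun j => Complex.exp (z j + ζ * v j)) ∈ S.admissible) :
    DifferentiableAt ℂ (fun ζ => S.eulerIntegral β fun j => Complex.exp (z j + ζ * v j)) ζ := by
  have hd : DifferentiableAt ℂ (fun (ζ : ℂ) (j : Fin 6) => Complex.exp (z j + ζ * v j)) ζ := by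
    rw [differentiableAt_pi]
    intro j
    fun_prop
  exact DifferentiableAt.comp (g := S.eulerIntegral β) ζ
    (S.differentiableAt_eulerIntegral β hx₀ hint h) hd

/-- If `x^κ F₄` is a multiple of the Euler-type integral near `z₀`, then also near `z₁`, provided
the segment from `z₀` to `z₁` in logarithmic coordinates stays in the domain of both functions. -/
theorem eventually_eq_of_segment {a b c c' : ℂ} (hc : ∀ k : ℕ, c ≠ -(k : ℂ))
    (hc' : ∀ k : ℕ, c' ≠ -(k : ℂ)) {β : Fin m ⊕ Fin r → ℂ} {x₀ : Fin 6 → ℂ}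
    (hx₀ : x₀ ∈ S.admissible) (hint : MeasureTheory.Integrable (S.kernel β x₀)) {K : ℂ}
    {z₀ z₁ : Fin 6 → ℂ}
    (hseg : ∀ t ∈ Set.Icc (0 : ℝ) 1,
      (fun j => Complex.exp (z₀ j + t * (z₁ j - z₀ j))) ∈ S.admissible ∧
      (fun j => Complex.exp (z₀ j + t * (z₁ j - z₀ j))) ∈ appellDomain)
    (h : ∀ᶠ z in 𝓝 z₀, appellPhiLog a b c c' z = K * S.eulerIntegral β fun j => Complex.exp (z j)) :
    ∀ᶠ z in 𝓝 z₁,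
      appellPhiLog a b c c' z = K * S.eulerIntegral β fun j => Complex.exp (z j) := by
  set V : Set (Fin 6 → ℂ) := {z | (fun j => Complex.exp (z j)) ∈ S.admissible} ∩
    {z | (fun j => Complex.exp (z j)) ∈ appellDomain} with hV
  have hVopen : IsOpen V := isOpen_exp_mem_admissible.inter isOpen_exp_mem_appellDomain
  have hsegV : segment ℝ z₀ z₁ ⊆ V := by
    rw [segment_eq_image']
    rintro _ ⟨t, ht, rfl⟩
    have := hseg t ht
    simpa [hV] using this
  have hcompact : IsCompact (segment ℝ z₀ z₁) := by
    rw [segment_eq_image']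
    exact isCompact_Icc.image (by fun_prop)
  obtain ⟨δ, hδ, hthick⟩ := hcompact.exists_thickening_subset_open hVopen hsegV
  have hconv : Convex ℝ (Metric.thickening δ (segment ℝ z₀ z₁)) :=
    (convex_segment z₀ z₁).thickening δ
  have hself := Metric.self_subset_thickening hδ (segment ℝ z₀ z₁)
  filter_upwards [Metric.isOpen_thickening.mem_nhds (hself (right_mem_segment ℝ z₀ z₁))] with z hz
  set v : Fin 6 → ℂ := fun j => z j - z₀ j with hv
  have hline : ∀ t ∈ Set.Icc (0 : ℝ) 1, (fun j => z₀ j + (t : ℂ) * v j) ∈ V := by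
    intro t ht
    apply hthick
    have hmem : z₀ + t • (z - z₀) ∈ segment ℝ z₀ z := by
      rw [segment_eq_image']
      exact ⟨t, ht, rfl⟩
    have := hconv.segment_subset (hself (left_mem_segment ℝ z₀ z₁)) hz hmem
    convert this using 1
    funext j
    simp [hv]
  set W : Set ℂ := {ζ | (fun j => z₀ j + ζ * v j) ∈ V} with hW
  have hWopen : IsOpen W :=
    hVopen.preimage (by fun_prop : Continuous fun (ζ : ℂ) (j : Fin 6) => z₀ j + ζ * v j)
  have hd₁ : DifferentiableOn ℂ (fun ζ => appellPhiLog a b c c' fun j => z₀ j + ζ * v j) W :=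
    fun ζ hζ => (differentiableAt_appellPhiLog_line a b hc hc' z₀ v hζ.2).differentiableWithinAt
  have hd₂ : DifferentiableOn ℂ
      (fun ζ => K * S.eulerIntegral β fun j => Complex.exp (z₀ j + ζ * v j)) W :=
    fun ζ hζ => ((differentiableAt_eulerIntegral_line β hx₀ hint z₀ v
      hζ.1).const_mul K).differentiableWithinAt
  have hpre : IsPreconnected (((↑) : ℝ → ℂ) '' Set.Icc (0 : ℝ) 1) :=
    isPreconnected_Icc.image _ Complex.continuous_ofReal.continuousOn
  have hsub : ∀ ζ ∈ ((↑) : ℝ → ℂ) '' Set.Icc (0 : ℝ) 1, W ∈ 𝓝 ζ := by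
    rintro _ ⟨t, ht, rfl⟩
    exact hWopen.mem_nhds (hline t ht)
  have hnear : (fun ζ => appellPhiLog a b c c' fun j => z₀ j + ζ * v j) =ᶠ[𝓝 0]
      fun ζ => K * S.eulerIntegral β fun j => Complex.exp (z₀ j + ζ * v j) := by
    have ht : Tendsto (fun (ζ : ℂ) (j : Fin 6) => z₀ j + ζ * v j) (𝓝 0) (𝓝 z₀) := by
      have hcont : Continuous fun (ζ : ℂ) (j : Fin 6) => z₀ j + ζ * v j := by fun_prop
      simpa using hcont.tendsto 0
    exact ht.eventually h
  have heq := AnalyticOnNhd.eqOn_of_preconnected_of_eventuallyEq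
    (fun ζ hζ => hd₁.analyticAt (hsub ζ hζ)) (fun ζ hζ => hd₂.analyticAt (hsub ζ hζ)) hpre
    (z₀ := 0) ⟨0, by simp⟩ hnear (⟨1, by simp⟩ : (1 : ℂ) ∈ ((↑) : ℝ → ℂ) '' Set.Icc (0 : ℝ) 1)
  simpa [hv] using heq

end StandardForm

/-! ### Entire continuation of a power series -/

/-- Let `G` be holomorphic in the strip `|Im w| < 2π`, and let `G w` be a power series in `e ^ w`
where the modulus of the latter is small. Then `G` is `2πi`-periodic, so that the power series is
the Taylor series of an entire function, and its coefficients tend to zero. -/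
theorem tendsto_coeff_of_strip {G F : ℂ → ℂ} {u : ℕ → ℂ} {ρ : ℝ} (hρ : 0 < ρ)
    (hG : ∀ w : ℂ, |w.im| < 2 * Real.pi → DifferentiableAt ℂ G w)
    (hGF : ∀ w : ℂ, |w.im| < 2 * Real.pi → ‖Complex.exp w‖ < ρ → G w = F (Complex.exp w))
    (hF : ∀ s : ℂ, ‖s‖ < ρ → HasSum (fun n => s ^ n * u n) (F s)) :
    Tendsto u atTop (𝓝 0) := by
  have hpi := Real.pi_pos
  have hseries : HasFPowerSeriesAt F (FormalMultilinearSeries.ofScalars ℂ u) 0 := by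
    rw [hasFPowerSeriesAt_iff]
    filter_upwards [Metric.ball_mem_nhds (0 : ℂ) hρ] with s hs
    have := hF s (by simpa using hs)
    simpa [FormalMultilinearSeries.coeff_ofScalars] using this
  have hFd : ∀ s : ℂ, ‖s‖ < ρ → DifferentiableAt ℂ F s := by
    intro s hs
    obtain ⟨R, hR⟩ := exists_between hs
    have hR0 : 0 < R := (norm_nonneg s).trans_lt hR.1
    have hsum : Summable fun n => ‖u n‖ * R ^ n := by
      obtain ⟨R', hR'⟩ := exists_between hR.2
      have h1 := (hF (R' : ℂ) (by
        rw [Complex.norm_real, Real.norm_of_nonneg (by linarith)]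
        exact hR'.2)).summable.tendsto_atTop_zero
      obtain ⟨C, hC⟩ := h1.norm.bddAbove_range
      have hq : R / R' < 1 := (div_lt_one (by linarith)).2 hR'.1
      have hR'0 : 0 < R' := by linarith
      refine Summable.of_nonneg_of_le (fun n => by positivity) (fun n => ?_)
        ((summable_geometric_of_lt_one (by positivity) hq).mul_left C)
      have h2 := hC ⟨n, rfl⟩
      simp only [norm_mul, norm_pow, Complex.norm_real, Real.norm_of_nonneg hR'0.le] at h2
      calc ‖u n‖ * R ^ n = (R' ^ n * ‖u n‖) * (R / R') ^ n := by
            rw [div_pow]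
            field_simp
        _ ≤ C * (R / R') ^ n := by gcongr
    have hd := Complex.differentiableOn_tsum_of_summable_norm (F := fun n (s : ℂ) => s ^ n * u n)
      (U := Metric.ball 0 R) hsum (fun n => by fun_prop) Metric.isOpen_ball (fun n w hw => by
        rw [norm_mul, norm_pow, mul_comm]
        have : ‖w‖ ≤ R := by simpa using (Metric.mem_ball.1 hw).le
        gcongr)
    have heq : Set.EqOn (fun s => ∑' n, s ^ n * u n) F (Metric.ball 0 R) := fun w hw =>
      (hF w (lt_trans (by simpa using hw) hR.2)).tsum_eq
    exact ((hd.congr fun w hw => (heq hw).symm).differentiableAt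
      (Metric.isOpen_ball.mem_nhds (by simpa using hR.1)))
  -- Periodicity, by the identity theorem in the lower half of the strip.
  have hper : ∀ w : ℂ, -(2 * Real.pi) < w.im → w.im < 0 →
      G (w + 2 * Real.pi * Complex.I) = G w := by
    set T : Set ℂ := {w | -(2 * Real.pi) < w.im ∧ w.im < 0} with hT
    have hTopen : IsOpen T :=
      (isOpen_lt continuous_const Complex.continuous_im).inter
        (isOpen_lt Complex.continuous_im continuous_const)
    have hTconv : Convex ℝ T := by
      have : T = Complex.imLm ⁻¹' Set.Ioo (-(2 * Real.pi)) 0 := by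
        ext w
        simp [hT]
      rw [this]
      exact (convex_Ioo _ _).linear_preimage _
    have him : ∀ w : ℂ, (w + 2 * Real.pi * Complex.I).im = w.im + 2 * Real.pi := by
      intro w
      simp
    have hd₁ : DifferentiableOn ℂ (fun w => G (w + 2 * Real.pi * Complex.I)) T := by
      intro w hw
      have h1 : DifferentiableAt ℂ G (w + 2 * Real.pi * Complex.I) := hG _ (by
        rw [him, abs_lt]
        constructor <;> linarith [hw.1, hw.2])
      exact (h1.comp w (by fun_prop : DifferentiableAt ℂ
        (fun w => w + 2 * Real.pi * Complex.I) w)).differentiableWithinAt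
    have hd₂ : DifferentiableOn ℂ G T := fun w hw => (hG w (by
      rw [abs_lt]
      constructor <;> linarith [hw.1, hw.2])).differentiableWithinAt
    have hw₀ : (⟨Real.log ρ - 1, -Real.pi⟩ : ℂ) ∈ T := ⟨by simp; linarith, by simpa using hpi⟩
    have hev : (fun w => G (w + 2 * Real.pi * Complex.I)) =ᶠ[𝓝 ⟨Real.log ρ - 1, -Real.pi⟩] G := by
      have hre : ∀ᶠ w : ℂ in 𝓝 ⟨Real.log ρ - 1, -Real.pi⟩, w.re < Real.log ρ :=
        Complex.continuous_re.continuousAt.eventually_lt continuousAt_const (by simp)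
      filter_upwards [hTopen.mem_nhds hw₀, hre] with w hw hwre
      have hlt : ‖Complex.exp w‖ < ρ := by
        rw [Complex.norm_exp, ← Real.exp_log hρ]
        exact Real.exp_lt_exp.2 hwre
      have hexp : Complex.exp (w + 2 * Real.pi * Complex.I) = Complex.exp w := by
        rw [Complex.exp_add, Complex.exp_two_pi_mul_I, mul_one]
      rw [hGF w (by rw [abs_lt]; constructor <;> linarith [hw.1, hw.2]) hlt,
        hGF _ (by rw [him, abs_lt]; constructor <;> linarith [hw.1, hw.2]) (by rwa [hexp]), hexp]
    intro w h1 h2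
    exact (AnalyticOnNhd.eqOn_of_preconnected_of_eventuallyEq (hd₁.analyticOnNhd hTopen)
      (hd₂.analyticOnNhd hTopen) hTconv.isPreconnected hw₀ hev) ⟨h1, h2⟩
  set E : ℂ → ℂ := fun s => if s = 0 then F 0 else G (Complex.log s) with hE
  have hlogim : ∀ s : ℂ, |(Complex.log s).im| < 2 * Real.pi := by
    intro s
    rw [Complex.log_im]
    exact (Complex.abs_arg_le_pi s).trans_lt (by linarith)
  have hEF : ∀ s : ℂ, ‖s‖ < ρ → E s = F s := by
    intro s hs
    by_cases h0 : s = 0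
    · simp [hE, h0]
    · rw [hE]
      simp only [if_neg h0]
      rw [hGF _ (hlogim s) (by rwa [Complex.exp_log h0]), Complex.exp_log h0]
  have hEF' : E =ᶠ[𝓝 0] F := by
    filter_upwards [Metric.ball_mem_nhds (0 : ℂ) hρ] with s hs
    exact hEF s (by simpa using hs)
  have hEd : Differentiable ℂ E := by
    intro s
    by_cases h0 : s = 0
    · subst h0
      exact (hFd 0 (by simpa using hρ)).congr_of_eventuallyEq hEF'
    · by_cases hs : s ∈ Complex.slitPlane
      · have h1 : DifferentiableAt ℂ (fun s => G (Complex.log s)) s :=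
          (hG _ (hlogim s)).comp s (Complex.differentiableAt_log hs)
        refine h1.congr_of_eventuallyEq ?_
        filter_upwards [isOpen_ne.mem_nhds h0] with w hw
        simp only [hE]
        rw [if_neg hw]
      · -- On the negative real axis another branch of the logarithm is used.
        have hneg : s.re < 0 := by
          rw [Complex.mem_slitPlane_iff] at hs
          push Not at hs
          refine lt_of_le_of_ne hs.1 fun hre => h0 (Complex.ext hre hs.2)
        have hbr : ∀ w : ℂ, w.re < 0 → |(Complex.log (-w)).im| < Real.pi / 2 := by
          intro w hw
          rw [Complex.log_im]
          exact Complex.abs_arg_lt_pi_div_two_iff.2 (Or.inl (by simpa using hw))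
        have himadd : ∀ w : ℂ, (Complex.log (-w) + Real.pi * Complex.I).im =
            (Complex.log (-w)).im + Real.pi := by
          intro w
          simp
        have h1 : DifferentiableAt ℂ (fun s => G (Complex.log (-s) + Real.pi * Complex.I)) s := by
          have h2 : DifferentiableAt ℂ G (Complex.log (-s) + Real.pi * Complex.I) := hG _ (by
            have := abs_lt.1 (hbr s hneg)
            rw [himadd, abs_lt]
            constructor <;> linarith)
          have h3 : DifferentiableAt ℂ (fun s => Complex.log (-s) + Real.pi * Complex.I) s :=
            (DifferentiableAt.clog (by fun_prop) (Or.inl (by simpa using hneg))).add_const _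
          exact h2.comp s h3
        refine h1.congr_of_eventuallyEq ?_
        filter_upwards [(isOpen_lt Complex.continuous_re continuous_const).mem_nhds hneg] with w hw
        have hw : w.re < 0 := hw
        have hw0 : w ≠ 0 := fun h => by simp [h] at hw
        simp only [hE]
        rw [if_neg hw0]
        have hexp : Complex.exp (Complex.log (-w) + Real.pi * Complex.I) =
            Complex.exp (Complex.log w) := by
          rw [Complex.exp_add, Complex.exp_log (neg_ne_zero.2 hw0), Complex.exp_pi_mul_I,
            Complex.exp_log hw0]
          ring
        obtain ⟨n, hn⟩ := Complex.exp_eq_exp_iff_exists_int.1 hexp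
        have hnim := congrArg Complex.im hn
        rw [himadd, Complex.add_im, show ((n : ℂ) * (2 * Real.pi * Complex.I)).im =
          n * (2 * Real.pi) by simp] at hnim
        have hb1 := abs_lt.1 (hbr w hw)
        have hb2 := Complex.neg_pi_lt_log_im w
        have hb3 := Complex.log_im_le_pi w
        have hn0 : -1 < n := by
          have : (-1 : ℝ) < n := by
            by_contra! hcon
            nlinarith
          exact_mod_cast this
        have hn1 : n < 2 := by
          have : (n : ℝ) < 2 := by
            by_contra! hcon
            nlinarith
          exact_mod_cast this
        obtain rfl | rfl : n = 0 ∨ n = 1 := by omega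
        · rw [hn]
          simp
        · rw [hn, Int.cast_one, one_mul]
          rw [Int.cast_one, one_mul] at hnim
          exact (hper _ (by linarith) (by linarith)).symm
  have hEs : HasFPowerSeriesAt E (FormalMultilinearSeries.ofScalars ℂ u) 0 :=
    hseries.congr hEF'.symm
  have hEball := hEd.hasFPowerSeriesOnBall 0 (R := 1) one_pos
  have huniq := hEs.eq_formalMultilinearSeries hEball.hasFPowerSeriesAt
  have hsum := hEball.hasSum (y := 1) (by simp)
  rw [← huniq] at hsum
  have := hsum.summable.tendsto_atTop_zero
  simpa [FormalMultilinearSeries.ofScalars_apply_eq] using this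

/-! ### From the rotated orthant to the positive orthant -/

namespace StandardForm

variable {m r : ℕ} {S : StandardForm appellMatrix m r}

/-- The argument by which the `j`-th coefficient has to be turned when the orthant rotated by `θ` is
replaced by the positive orthant and the `i`-th block is multiplied by `exp (I * ψ i)`. -/
noncomputable def twistAngle (S : StandardForm appellMatrix m r) (θ : Fin r → ℝ) (ψ : Fin m → ℝ)
    (j : Fin 6) : ℝ :=
  ∑ k, (S.expo j k : ℝ) * θ k + ψ (S.block j)

theorem twistAngle_eq_sum (θ : Fin r → ℝ) (ψ : Fin m → ℝ) (j : Fin 6) :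
    S.twistAngle θ ψ j =
      ∑ k, (S.expo j k : ℝ) * θ k +
        ∑ i, ((if S.block j = i then (1 : ℤ) else 0 : ℤ) : ℝ) * ψ i := by
  simp [twistAngle]

/-- The three antipodal pairs of columns have the same sum, hence so do their twists. -/
theorem twistAngle_vertex_add (θ : Fin r → ℝ) (ψ : Fin m → ℝ) (k l : Fin 3) :
    S.twistAngle θ ψ (vertex k true) + S.twistAngle θ ψ (vertex k false) =
      S.twistAngle θ ψ (vertex l true) + S.twistAngle θ ψ (vertex l false) := by
  simp only [twistAngle_eq_sum]
  rw [add_add_add_comm, add_add_add_comm (∑ k, (S.expo (vertex l true) k : ℝ) * θ k)]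
  simp only [← Finset.sum_add_distrib, ← add_mul]
  congr 1
  · refine Finset.sum_congr rfl fun i _ => ?_
    congr 1
    exact_mod_cast S.expo_vertex_add k l i
  · refine Finset.sum_congr rfl fun i _ => ?_
    congr 1
    exact_mod_cast S.indicator_block_vertex_add k l i

theorem orthantPoly_twist (θ : Fin r → ℝ) (ψ : Fin m → ℝ) (i : Fin m) (x : Fin 6 → ℂ)
    (u : Fin r → ℝ) :
    S.orthantPoly i (fun j => x j * Complex.exp (S.twistAngle θ ψ j * Complex.I)) u =
      Complex.exp (ψ i * Complex.I) * S.poly i x (rotatedOrthant θ u) := by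
  rw [orthantPoly, poly, Finset.mul_sum]
  refine Finset.sum_congr rfl fun j _ => ?_
  split_ifs with hj
  · have h : ∏ k, rotatedOrthant θ u k ^ S.expo j k =
        Complex.exp ((∑ k, (S.expo j k : ℝ) * θ k : ℝ) * Complex.I) * (S.weight j u : ℂ) := by
      simp only [rotatedOrthant, weight, ← Complex.exp_int_mul, ← Complex.exp_sum,
        Complex.ofReal_exp, ← Complex.exp_add]
      congr 1
      push_cast
      rw [Finset.sum_mul, ← Finset.sum_add_distrib]
      exact Finset.sum_congr rfl fun k _ => by ring
    rw [h, twistAngle, hj]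
    push_cast
    rw [add_mul, Complex.exp_add]
    ring
  · simp

theorem appellY₁_twist (θ : Fin r → ℝ) (ψ : Fin m → ℝ) (x : Fin 6 → ℂ) :
    appellY₁ (fun j => x j * Complex.exp (-(S.twistAngle θ ψ j * Complex.I))) = appellY₁ x := by
  have h : (S.twistAngle θ ψ 1 : ℂ) + S.twistAngle θ ψ 4 =
      S.twistAngle θ ψ 0 + S.twistAngle θ ψ 3 := by
    exact_mod_cast S.twistAngle_vertex_add θ ψ 1 0
  rw [appellY₁, mul_mul_mul_comm (x 1), mul_mul_mul_comm (x 0), ← Complex.exp_add,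
    ← Complex.exp_add, ← neg_add, ← neg_add, ← add_mul, ← add_mul, h,
    mul_div_mul_right _ _ (Complex.exp_ne_zero _)]
  rfl

theorem appellY₂_twist (θ : Fin r → ℝ) (ψ : Fin m → ℝ) (x : Fin 6 → ℂ) :
    appellY₂ (fun j => x j * Complex.exp (-(S.twistAngle θ ψ j * Complex.I))) = appellY₂ x := by
  have h : (S.twistAngle θ ψ 2 : ℂ) + S.twistAngle θ ψ 5 =
      S.twistAngle θ ψ 0 + S.twistAngle θ ψ 3 := by
    exact_mod_cast S.twistAngle_vertex_add θ ψ 2 0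
  rw [appellY₂, mul_mul_mul_comm (x 2), mul_mul_mul_comm (x 0), ← Complex.exp_add,
    ← Complex.exp_add, ← neg_add, ← neg_add, ← add_mul, ← add_mul, h,
    mul_div_mul_right _ _ (Complex.exp_ne_zero _)]
  rfl

/-- After the twist, a representation by an integral over a rotated orthant becomes, locally in
logarithmic coordinates, one by the integral over the positive orthant with principal branches. -/
theorem exists_eventually_eq_eulerIntegral {a b c c' : ℂ} {β : Fin 4 → ℂ} {θ : Fin r → ℝ}
    {U : Set (Fin 6 → ℂ)} (hUopen : IsOpen U) {ℓ : Fin 6 → (Fin 6 → ℂ) → ℂ}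
    (hℓ : ∀ j, ContinuousOn (ℓ j) U) (hexp : ∀ j, ∀ x ∈ U, Complex.exp (ℓ j x) = x j) {K : ℂ}
    (h : S.Represents β θ U (appellPhi a b c c' ℓ) K) {x₀ : Fin 6 → ℂ} (hx₀ : x₀ ∈ U)
    {ψ : Fin m → ℝ} {z₀ : Fin 6 → ℂ}
    (hz₀ : ∀ j, Complex.exp (z₀ j) = x₀ j * Complex.exp (S.twistAngle θ ψ j * Complex.I))
    (hadm : (fun j => Complex.exp (z₀ j)) ∈ S.admissible) :
    ∃ K', MeasureTheory.Integrable (S.kernel (S.param β) fun j => Complex.exp (z₀ j)) ∧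
      ∀ᶠ z in 𝓝 z₀, appellPhiLog a b c c' z =
        K' * S.eulerIntegral (S.param β) fun j => Complex.exp (z j) := by
  obtain ⟨L, hL, hrep⟩ := h
  set X : (Fin 6 → ℂ) → Fin 6 → ℂ := fun z j =>
    Complex.exp (z j) * Complex.exp (-(S.twistAngle θ ψ j * Complex.I)) with hX
  have hXc : Continuous X := by fun_prop
  have hXtwist : ∀ z, (fun j => X z j * Complex.exp (S.twistAngle θ ψ j * Complex.I)) =
      fun j => Complex.exp (z j) := by
    intro z
    funext j
    simp only [hX]
    rw [mul_assoc, ← Complex.exp_add, neg_add_cancel, Complex.exp_zero, mul_one]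
  have hX₀ : X z₀ = x₀ := by
    funext j
    simp only [hX]
    rw [hz₀, mul_assoc, ← Complex.exp_add, add_neg_cancel, Complex.exp_zero, mul_one]
  have hN : IsOpen (X ⁻¹' U ∩ {z | (fun j => Complex.exp (z j)) ∈ S.admissible}) :=
    (hUopen.preimage hXc).inter isOpen_exp_mem_admissible
  obtain ⟨δ, hδ, hball⟩ := Metric.isOpen_iff.1 hN z₀ ⟨by rwa [Set.mem_preimage, hX₀], hadm⟩
  have hB : IsPreconnected (Metric.ball z₀ δ) := (convex_ball z₀ δ).isPreconnected
  have hz₀B : z₀ ∈ Metric.ball z₀ δ := Metric.mem_ball_self hδ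
  have hslit : ∀ z ∈ Metric.ball z₀ δ, ∀ i u,
      S.orthantPoly i (fun j => Complex.exp (z j)) u ∈ Complex.slitPlane := fun z hz =>
    interior_subset (hball hz).2
  -- The given branches of the logarithms differ from the principal ones by constants.
  have hℓX : ∀ j, ∀ z ∈ Metric.ball z₀ δ, ℓ j (X z) = z j + (ℓ j (X z₀) - z₀ j) := by
    intro j z hz
    have := eq_of_exp_eq_const hB (f := fun z => ℓ j (X z) - z j)
      (c := Complex.exp (-(S.twistAngle θ ψ j * Complex.I)))
      (((hℓ j).comp hXc.continuousOn fun z hz => (hball hz).1).sub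
        (continuous_apply j).continuousOn) (fun z hz => by
        rw [Complex.exp_sub, hexp j _ (hball hz).1, div_eq_iff (Complex.exp_ne_zero _), mul_comm])
      hz hz₀B
    rw [← this]
    ring
  have hLX : ∀ i, ∀ z ∈ Metric.ball z₀ δ, ∀ u, L i (X z) u =
      Complex.log (S.orthantPoly i (fun j => Complex.exp (z j)) u) +
        (L i (X z₀) 0 - Complex.log (S.orthantPoly i (fun j => Complex.exp (z₀ j)) 0)) := by
    intro i z hz u
    have hcont : Continuous fun p : (Fin 6 → ℂ) × (Fin r → ℝ) =>
        S.orthantPoly i (fun j => Complex.exp (p.1 j)) p.2 :=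
      (S.continuous_orthantPoly i).comp (by fun_prop :
        Continuous fun p : (Fin 6 → ℂ) × (Fin r → ℝ) => ((fun j => Complex.exp (p.1 j)), p.2))
    have := eq_of_exp_eq_const (hB.prod isPreconnected_univ)
      (f := fun p : (Fin 6 → ℂ) × (Fin r → ℝ) => L i (X p.1) p.2 -
        Complex.log (S.orthantPoly i (fun j => Complex.exp (p.1 j)) p.2))
      (c := Complex.exp (-(ψ i * Complex.I)))
      (((hL i).1.comp (by fun_prop : Continuous fun p : (Fin 6 → ℂ) × (Fin r → ℝ) =>
          (X p.1, p.2)).continuousOn fun p hp => ⟨(hball hp.1).1, trivial⟩).sub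
        (hcont.continuousOn.clog fun p hp => hslit p.1 hp.1 i p.2)) (fun p hp => by
        have hne := Complex.slitPlane_ne_zero (hslit p.1 hp.1 i p.2)
        rw [Complex.exp_sub, (hL i).2 _ (hball hp.1).1, Complex.exp_log hne, div_eq_iff hne,
          ← hXtwist p.1, orthantPoly_twist, ← mul_assoc, ← Complex.exp_add, neg_add_cancel,
          Complex.exp_zero, one_mul])
      (t := (z, u)) (t' := (z₀, 0)) ⟨hz, trivial⟩ ⟨hz₀B, trivial⟩
    rw [← this]
    ring
  set E : ℂ := Complex.exp (-(∑ k, S.param β (Sum.inr k) * (θ k * Complex.I)) +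
    ∑ i, S.param β (Sum.inl i) * (L i (X z₀) 0 -
      Complex.log (S.orthantPoly i (fun j => Complex.exp (z₀ j)) 0))) with hE
  have hkernel : ∀ z ∈ Metric.ball z₀ δ, S.integrand β θ L (X z) =
      fun u => E * S.kernel (S.param β) (fun j => Complex.exp (z j)) u := by
    intro z hz
    funext u
    rw [integrand, kernel, hE, ← Complex.exp_add, ← Complex.exp_add]
    congr 1
    simp only [hLX _ z hz u, mul_add, Finset.sum_add_distrib]
    ring
  refine ⟨Complex.exp (-∑ j, appellKappa a b c c' j * (ℓ j (X z₀) - z₀ j)) * K * E, ?_, ?_⟩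
  · have hint := (hrep _ (hball hz₀B).1).1
    rw [hkernel z₀ hz₀B] at hint
    exact (MeasureTheory.integrable_const_mul_iff (IsUnit.mk0 _ (Complex.exp_ne_zero _)) _).1 hint
  · filter_upwards [Metric.ball_mem_nhds z₀ hδ] with z hz
    have hval := (hrep _ (hball hz).1).2
    rw [hkernel z hz, MeasureTheory.integral_const_mul, appellPhi] at hval
    have hY₁ : appellY₁ (X z) = appellY₁ fun j => Complex.exp (z j) := appellY₁_twist θ ψ _
    have hY₂ : appellY₂ (X z) = appellY₂ fun j => Complex.exp (z j) := appellY₂_twist θ ψ _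
    rw [hY₁, hY₂, Finset.sum_congr rfl fun j _ => by rw [hℓX j z hz, mul_add],
      Finset.sum_add_distrib, Complex.exp_add] at hval
    have hQ := mul_inv_cancel₀ (Complex.exp_ne_zero
      (∑ j, appellKappa a b c c' j * (ℓ j (X z₀) - z₀ j)))
    rw [appellPhiLog, eulerIntegral, Complex.exp_neg]
    linear_combination (Complex.exp (∑ j, appellKappa a b c c' j * (ℓ j (X z₀) - z₀ j)))⁻¹ * hval -
      Complex.exp (∑ j, appellKappa a b c c' j * z j) *
        appellF4 a b c c' (appellY₁ fun j => Complex.exp (z j))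
          (appellY₂ fun j => Complex.exp (z j)) * hQ

end StandardForm

/-! ### Continuation to the right half-plane -/

namespace StandardForm

variable {m r : ℕ} {S : StandardForm appellMatrix m r}

/-- The points whose coordinates have a logarithm with imaginary part less than `π / 2` in modulus
are admissible, whatever their moduli. -/
theorem exp_mem_admissible_of_abs_im_lt (hb : ∀ i, ∃ j, S.block j = i) {z : Fin 6 → ℂ}
    (hz : ∀ j, |(z j).im| < Real.pi / 2) : (fun j => Complex.exp (z j)) ∈ S.admissible := by
  refine S.mem_admissible_of_re_pos hb fun j => ?_
  rw [Complex.exp_re]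
  have := abs_lt.1 (hz j)
  exact mul_pos (Real.exp_pos _) (Real.cos_pos_of_mem_Ioo ⟨this.1, this.2⟩)

/-- If `x^κ F₄` has an Euler-type integral representation, then it has one by the integral over the
positive orthant on the whole of its domain of convergence where all coefficients lie in the right
half-plane; and the integral is holomorphic on lines in the whole of this half-plane. -/
theorem exists_forall_eq_eulerIntegral {a b c c' : ℂ} (hc : ∀ k : ℕ, c ≠ -(k : ℂ))
    (hc' : ∀ k : ℕ, c' ≠ -(k : ℂ)) {β : Fin 4 → ℂ} {θ : Fin r → ℝ}
    {U : Set (Fin 6 → ℂ)} (hUopen : IsOpen U) (hUne : U.Nonempty) (hU : U ⊆ appellDomain)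
    {ℓ : Fin 6 → (Fin 6 → ℂ) → ℂ}
    (hℓ : ∀ j, ContinuousOn (ℓ j) U) (hexp : ∀ j, ∀ x ∈ U, Complex.exp (ℓ j x) = x j) {K : ℂ}
    (h : S.Represents β θ U (appellPhi a b c c' ℓ) K) :
    ∃ K', (∀ z : Fin 6 → ℂ, (∀ j, |(z j).im| < Real.pi / 2) →
        (fun j => Complex.exp (z j)) ∈ appellDomain →
        appellPhiLog a b c c' z = K' * S.eulerIntegral (S.param β) fun j => Complex.exp (z j)) ∧
      ∀ z v : Fin 6 → ℂ, ∀ w : ℂ, (∀ j, |(z j + w * v j).im| < Real.pi / 2) →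
        DifferentiableAt ℂ
          (fun w => S.eulerIntegral (S.param β) fun j => Complex.exp (z j + w * v j)) w := by
  obtain ⟨x₀, hx₀⟩ := hUne
  have hstable : ∀ᶠ y in 𝓝 (fun j => x₀ j * Complex.exp (S.twistAngle θ 0 j * Complex.I)),
      ∀ i u, S.orthantPoly i y u ≠ 0 := by
    obtain ⟨L, hL, -⟩ := h
    have hcont : Continuous fun (y : Fin 6 → ℂ) j =>
        y j * Complex.exp (-(S.twistAngle θ 0 j * Complex.I)) := by fun_prop
    have hmem : ∀ᶠ y in 𝓝 (fun j => x₀ j * Complex.exp (S.twistAngle θ 0 j * Complex.I)),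
        (fun j => y j * Complex.exp (-(S.twistAngle θ 0 j * Complex.I))) ∈ U := by
      refine hcont.continuousAt.preimage_mem_nhds (hUopen.mem_nhds ?_)
      convert hx₀ using 1
      funext j
      rw [mul_assoc, ← Complex.exp_add, add_neg_cancel, Complex.exp_zero, mul_one]
    filter_upwards [hmem] with y hy i u
    have heq : y = fun j => y j * Complex.exp (-(S.twistAngle θ 0 j * Complex.I)) *
        Complex.exp (S.twistAngle θ 0 j * Complex.I) := by
      funext j
      rw [mul_assoc, ← Complex.exp_add, neg_add_cancel, Complex.exp_zero, mul_one]
    rw [heq, orthantPoly_twist, ← (hL i).2 _ hy]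
    exact mul_ne_zero (Complex.exp_ne_zero _) (Complex.exp_ne_zero _)
  have hblock := exists_block_eq_of_ne_zero hstable.self_of_nhds
  obtain ⟨ψ, z₀, z₁, hz₀, hz₁, hre, hpath⟩ := S.exists_admissible_path
    (fun j => mul_ne_zero ((hU hx₀).1 j) (Complex.exp_ne_zero _)) hstable
  have hz₀' : ∀ j, Complex.exp (z₀ j) = x₀ j * Complex.exp (S.twistAngle θ ψ j * Complex.I) := by
    intro j
    rw [hz₀, mul_assoc, ← Complex.exp_add]
    simp [twistAngle, add_mul]
  have hadm₀ : (fun j => Complex.exp (z₀ j)) ∈ S.admissible := by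
    simpa using hpath 0 ⟨le_rfl, zero_le_one⟩
  obtain ⟨K', hint, hloc⟩ := exists_eventually_eq_eulerIntegral hUopen hℓ hexp h hx₀ hz₀' hadm₀
  -- Moduli are unchanged along the path from `z₀` to `z₁`.
  have hdom : ∀ z : Fin 6 → ℂ, (∀ j, (z j).re = (z₀ j).re) →
      (fun j => Complex.exp (z j)) ∈ appellDomain := by
    have hnorm : ∀ j, ‖x₀ j‖ = Real.exp (z₀ j).re := by
      intro j
      rw [← Complex.norm_exp, hz₀' j, norm_mul, Complex.norm_exp_ofReal_mul_I, mul_one]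
    intro z hz
    refine ⟨fun j => Complex.exp_ne_zero _, ?_⟩
    have h2 := (hU hx₀).2
    rw [appellY₁, appellY₂] at h2 ⊢
    simp only [norm_div, norm_mul, hnorm, Complex.norm_exp, hz] at h2 ⊢
    exact h2
  have hev₁ := eventually_eq_of_segment hc hc' hadm₀ hint (z₁ := z₁) (fun t ht =>
    ⟨hpath t ht, hdom _ fun j => by simp [hre j]⟩) hloc
  refine ⟨K', fun z hz hzdom => ?_, fun z v w hw =>
    differentiableAt_eulerIntegral_line _ hadm₀ hint z v
      (exp_mem_admissible_of_abs_im_lt hblock hw)⟩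
  refine (eventually_eq_of_segment hc hc' hadm₀ hint (z₁ := z) (fun t ht => ⟨?_, ?_⟩)
    hev₁).self_of_nhds
  · refine exp_mem_admissible_of_abs_im_lt hblock fun j => ?_
    have h1 := abs_lt.1 (hz₁ j)
    have h2 := abs_lt.1 (hz j)
    have himz : (z₁ j + t * (z j - z₁ j)).im = (1 - t) * (z₁ j).im + t * (z j).im := by
      simp
      ring
    have hmem := (convex_Ioo (-(Real.pi / 2)) (Real.pi / 2)) h1 h2 (sub_nonneg.2 ht.2) ht.1
      (sub_add_cancel 1 t)
    rw [himz, abs_lt]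
    exact hmem
  · exact exp_mem_appellDomain_of_segment (hdom z₁ hre) hzdom ht

end StandardForm

/-! ### Nonexistence of the representation -/

theorem mainTheorem1 (a b c c' : ℂ) (hgen : AppellGeneric a b c c')
    {m r : ℕ} (S : StandardForm appellMatrix m r) (θ : Fin r → ℝ)
    (U : Set (Fin 6 → ℂ)) (hUopen : IsOpen U) (hUne : U.Nonempty) (hU : U ⊆ appellDomain)
    (ℓ : Fin 6 → (Fin 6 → ℂ) → ℂ) (hℓ : ∀ j, ContinuousOn (ℓ j) U)
    (hexp : ∀ j, ∀ x ∈ U, Complex.exp (ℓ j x) = x j) (K : ℂ) :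
    ¬ S.Represents (appellBeta a b c c') θ U (appellPhi a b c c' ℓ) K := by
  intro h
  have hc := hgen.c_ne
  have hc' := hgen.c'_ne
  obtain ⟨K', hrep, hdiff⟩ := S.exists_forall_eq_eulerIntegral hc hc' hUopen hUne hU hℓ hexp h
  refine not_tendsto_appellDiagCoeff (fun k => by simpa using hgen.a_ne (-k))
    (fun k => by simpa using hgen.b_ne (-k)) hc hc' ?_
  -- On the line `z = w v` both arguments of `F₄` are equal to `e ^ w`, and the arguments of the
  -- coefficients are `± Im w / 4`.
  set v : Fin 6 → ℂ := ![-1 / 4, 1 / 4, 1 / 4, -1 / 4, 1 / 4, 1 / 4] with hv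
  have hY₁ : ∀ w : ℂ, w * v 1 + w * v 4 - w * v 0 - w * v 3 = w := by
    intro w
    have : v 1 = 1 / 4 ∧ v 4 = 1 / 4 ∧ v 0 = -1 / 4 ∧ v 3 = -1 / 4 := ⟨rfl, rfl, rfl, rfl⟩
    obtain ⟨h1, h2, h3, h4⟩ := this
    rw [h1, h2, h3, h4]
    ring
  have hY₂ : ∀ w : ℂ, w * v 2 + w * v 5 - w * v 0 - w * v 3 = w := by
    intro w
    have : v 2 = 1 / 4 ∧ v 5 = 1 / 4 ∧ v 0 = -1 / 4 ∧ v 3 = -1 / 4 := ⟨rfl, rfl, rfl, rfl⟩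
    obtain ⟨h1, h2, h3, h4⟩ := this
    rw [h1, h2, h3, h4]
    ring
  have him : ∀ w : ℂ, |w.im| < 2 * Real.pi → ∀ j, |(w * v j).im| < Real.pi / 2 := by
    intro w hw j
    have : |(w * v j).im| = |w.im| / 4 := by
      have hvj : v j = ((1 / 4 : ℝ) : ℂ) ∨ v j = ((-(1 / 4) : ℝ) : ℂ) := by
        fin_cases j <;> simp [hv, neg_div]
      rcases hvj with h | h <;> rw [h, Complex.im_mul_ofReal, abs_mul] <;> norm_num <;> ring
    rw [this]
    linarith
  refine tendsto_coeff_of_strip (ρ := 1 / 4) (F := fun s => appellF4 a b c c' s s)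
    (G := fun w => Complex.exp (-∑ j, appellKappa a b c c' j * (w * v j)) *
      (K' * S.eulerIntegral (S.param (appellBeta a b c c')) fun j => Complex.exp (w * v j)))
    (by norm_num) (fun w hw => ?_) (fun w hw hsmall => ?_)
    (fun s hs => hasSum_appellDiagCoeff a b hc hc' hs)
  · have := hdiff 0 v w (by simpa using him w hw)
    simp only [Pi.zero_apply, zero_add] at this
    exact DifferentiableAt.mul (by fun_prop) (this.const_mul K')
  · have hdom : (fun j => Complex.exp (w * v j)) ∈ appellDomain := by
      rw [exp_mem_appellDomain_iff, hY₁, hY₂, ← sqrt_norm_exp]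
      have : Real.sqrt ‖Complex.exp w‖ < 1 / 2 := by
        rw [Real.sqrt_lt' (by norm_num)]
        linarith
      linarith
    have hval := hrep (fun j => w * v j) (him w hw) hdom
    rw [appellPhiLog, appellY₁_exp, appellY₂_exp, hY₁, hY₂] at hval
    rw [← hval, ← mul_assoc, ← Complex.exp_add, neg_add_cancel, Complex.exp_zero, one_mul]
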